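/- Let $G=A_1*\dots*A_n*F_k$, where the $A_i$ are nontrivial finitely generated groups and $F_k$ is free on $x_1,\dots,x_k$; write $A_{n+j}=\langle x_j\rangle$. For $i\ne j$ and $g\in A_i$, the partial conjugation $\chi_{g,j}$ sends $y\mapsto g^{-1}yg$ on $A_j$ and is the identity on the other factors; for $i\neq n+j$ and $g\in A_i$, the transvections $\lambda_{g,j}$ and $\rho_{g,j}$ send $x_j$ to $gx_j$ and $x_jg$ respectively and are the identity on the other factors. Let $\mathrm{Aut}^0(G)$ be the group generated by all of these. Fix for each $A_i$ a finite generating set and a normal form for its elements over it, and take $x_j$ as the generator of $A_{n+j}$. The $\chi_{g,j},\lambda_{g,j},\rho_{g,j}$ with $g$ a chosen generator are the Fouxe-Rabinovitch generators. Words are in these generators and their inverses, automorphisms are composed as functions, and $d$ is the word metric. A *folding normal form* of $\Phi\in\mathrm{Aut}^0(G)$ is a word obtained as follows. Let $\mathcal T$ be the graph of groups with a vertex $\star$ with trivial group, vertices $v_i$ with group $A_i$, edges $e_i$ joining $\star$ to $v_i$ ($i\le n$), loops $e_{n+j}$ at $\star$ ($j\le k$), and trivial edge groups. Realize $\Phi$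 by a map $\mathcal T\to\mathcal T$ that sends each edge to a tight path, subdivide so that it becomes a morphism, and choose a maximal tree which omits one edge of each subdivided loop (for the $j$-th loop, one mapped to $e_{n+j}$ if there is one). Now fold. Folds of two edges of the maximal tree are made first; they contribute nothing. Otherwise twist an edge at a vertex with group $A_i$ by an element $g\in A_i$ so that it can be folded with another edge there, or fold an edge of the maximal tree across a loop which represents $x_j$, or change the maximal tree: add an edge which represents $x_j$ and is to be folded with another edge, and remove the next edge of the cycle which it closes. Such a step contributes a commuting product of partial conjugations and transvections by the acting letter ($g^{\pm1}$, respectively $x_j^{\pm1}$), written in the order of the factors acted upon and with elements of the $A_i$ replaced by their normal forms. Among these steps one with the smallest index of the factor of the acting letter is made; a change of the tree after which the two edges still cannot be folded inside the tree is made only if nothing else is possible. When no step is possible the morphism is an isomorphism, inducing some $\sigma$, and $\Phi=\sigma\theta_r\cdots\theta_1$ with $\theta_1,\dots,\theta_r$ the contributions in order of occurrence; the normal form is this word, with $\sigma$ replaced by any word for it (the empty word if $\sigma=1$). All remaining choices are arbitrary. **Proposition.** Suppose $n+k\ge4$, or $n=0$ and $k=3$. Then the folding normal forms are not quasi-geodesic: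 for all real $K\ge1$, $C>0$ there is $\Phi\in\mathrm{Aut}^0(G)$ that has a folding normal form and such that every folding normal form $w$ of $\Phi$ represents $\Phi$ but fails to be a $(K,C)$-quasi-geodesic, that is, it is not true that $\frac1K|q-p|-C\le d(w_p,w_q)\le K|q-p|+C$ for all $0\le p,q\le|w|$, where $w_p$ is the product of the first $p$ letters of $w$. Moreover, let $A,B,C,D$ be four different factors among $A_1,\dots,A_{n+k}$, let $a\in A$, $b\in B$, $c\in C$ be nontrivial chosen generators, and let $m,N\ge1$. Put $u=(ab)^{-m}c(ab)^ma$, and let $|g|$ be the length of the normal form of an element $g$ of a factor. Consider the automorphisms that are the identity on all factors other than $D$ and are given on $D$ by * $\Phi_0$: $y\mapsto u^{-N}yu^N$ for $y\in D$, if $D$ is one of $A_1,\dots,A_n$; * $\Phi_1$: $x\mapsto xu^N$, if $D=\langle x\rangle$ is one of $\langle x_1\rangle,\dots,\langle x_k\rangle$; * $\Phi_2$: $x\mapsto x(c(ab)^m)^N$, if both $C=\langle c\rangle$ and $D=\langle x\rangle$ are among $\langle x_1\rangle,\dots,\langle x_k\rangle$. They lie in $\mathrm{Aut}^0(G)$ and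 have folding normal forms, and each folding normal form represents the automorphism and has length exactly $N\bigl(m(|b^{-1}|+|a^{-1}|)+|c|+m(|a|+|b|)+|a|\bigr)\ge N(4m+2)$ for $\Phi_0$ and $\Phi_1$, and $N\bigl(1+m(|a|+|b|)\bigr)\ge N(2m+1)$ for $\Phi_2$ (with equality if the normal forms involved have length one). But $\Phi_0$ and $\Phi_1$ are also represented by words of length $4m+2N$, and $\Phi_2$ by a word of length $4m+N$. -/

import Mathlib

namespace FoldingCombing

universe u

/-! ### The free product `G = A₁ * ⋯ * Aₙ * F_k` and its automorphisms -/

/-- Indices of the free factors: `inl i` stands for `A_i`, and `inr j` for `⟨x_j⟩`. -/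
abbrev Idx (n k : ℕ) : Type := Fin n ⊕ Fin k

/-- The free factors: the groups `A_i`, followed by `k` infinite cyclic groups `⟨x_j⟩`. -/
def Factor {n : ℕ} (A : Fin n → Type u) (k : ℕ) : Idx n k → Type u
  | .inl i => A i
  | .inr _ => FreeGroup PUnit.{u + 1}

instance {n : ℕ} (A : Fin n → Type u) (k : ℕ) [∀ i, Group (A i)] :
    ∀ c : Idx n k, Group (Factor A k c)
  | .inl i => inferInstanceAs (Group (A i))
  | .inr _ => inferInstanceAs (Group (FreeGroup PUnit.{u + 1}))

/-- `G = A₁ * ⋯ * Aₙ * F_k`, where `F_k = ⟨x_1⟩ * ⋯ * ⟨x_k⟩`. -/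
abbrev FreeProd {n : ℕ} (A : Fin n → Type u) (k : ℕ) [∀ i, Group (A i)] : Type u :=
  Monoid.CoprodI (Factor A k)

section

variable {n k : ℕ} {A : Fin n → Type u} [∀ i, Group (A i)]

/-- The inclusion of a free factor in `G`. -/
abbrev emb (c : Idx n k) : Factor A k c →* FreeProd A k := Monoid.CoprodI.of

/-- The generator `x_j` (for `b = true`) or its inverse (for `b = false`), in its own factor. -/
def xpow (j : Fin k) (b : Bool) : Factor A k (.inr j) :=
  if b then (FreeGroup.of PUnit.unit : FreeGroup PUnit.{u + 1})
  else ((FreeGroup.of PUnit.unit)⁻¹ : FreeGroup PUnit.{u + 1})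

/-- The element `x_j` of `G`. -/
def xG (j : Fin k) : FreeProd A k := emb (.inr j) (xpow j true)

/-- The endomorphism of `G` that sends `y` to `p⁻¹ y p` for `y` in the factor `c`, and that is the
identity on the other factors. -/
def conjHom (c : Idx n k) (p : FreeProd A k) : FreeProd A k →* FreeProd A k :=
  Monoid.CoprodI.lift fun m =>
    if m = c then (MulAut.conj p⁻¹).toMonoidHom.comp (emb m) else emb m

/-- The endomorphism of `G` that sends `x_j` to `p x_j q`, and that is the identity on the other
factors. -/
def transHom (j : Fin k) (p q : FreeProd A k) : FreeProd A k →* FreeProd A k :=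
  Monoid.CoprodI.lift fun m => match m with
    | .inl i => emb (.inl i)
    | .inr l => if l = j then FreeGroup.lift (fun _ : PUnit.{u + 1} => p * xG j * q)
        else emb (.inr l)

theorem conjHom_same (c : Idx n k) (p : FreeProd A k) (y : Factor A k c) :
    conjHom c p (emb c y) = p⁻¹ * emb c y * p := by
  simp [conjHom]

theorem conjHom_of_ne {c m : Idx n k} (h : m ≠ c) (p : FreeProd A k) (y : Factor A k m) :
    conjHom c p (emb m y) = emb m y := by
  simp [conjHom, h]

theorem transHom_same (j : Fin k) (p q : FreeProd A k) :
    transHom j p q (xG j) = p * xG j * q := by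
  unfold transHom
  conv_lhs => rw [xG, xpow]
  erw [Monoid.CoprodI.lift_of]
  simp only
  exact FreeGroup.lift_apply_of

theorem transHom_of_ne {j : Fin k} {m : Idx n k} (h : m ≠ .inr j) (p q : FreeProd A k)
    (y : Factor A k m) : transHom j p q (emb m y) = emb m y := by
  unfold transHom
  rw [Monoid.CoprodI.lift_of]
  rcases m with i | l
  · rfl
  · have : l ≠ j := fun e => h (by rw [e])
    simp [this]

theorem hom_ext_x {f g : FreeProd A k →* FreeProd A k} (j : Fin k)
    (h : ∀ m : Idx n k, m ≠ .inr j → ∀ y : Factor A k m, f (emb m y) = g (emb m y))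
    (hx : f (xG j) = g (xG j)) : f = g := by
  refine Monoid.CoprodI.ext_hom _ _ fun m => ?_
  by_cases hm : m = .inr j
  · subst hm
    refine FreeGroup.ext_hom (f := (f.comp (emb (.inr j)) : FreeGroup PUnit.{u + 1} →* _))
      (g := (g.comp (emb (.inr j)) : FreeGroup PUnit.{u + 1} →* _)) fun _ => ?_
    exact hx
  · exact MonoidHom.ext fun y => h m hm y

theorem conjHom_comp {c i : Idx n k} (h : i ≠ c) (s t : Factor A k i) (hst : s * t = 1) :
    (conjHom c (emb i s)).comp (conjHom c (emb i t)) = MonoidHom.id (FreeProd A k) := by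
  refine Monoid.CoprodI.ext_hom _ _ fun m => MonoidHom.ext fun y => ?_
  have e : emb i s * emb i t = 1 := by rw [← map_mul, hst, map_one]
  have e' : (emb i t)⁻¹ * (emb i s)⁻¹ = 1 := by rw [← mul_inv_rev, e, inv_one]
  by_cases hm : m = c
  · subst hm
    simp only [MonoidHom.comp_apply, conjHom_same, map_mul, map_inv, conjHom_of_ne h,
      MonoidHom.id_apply]
    calc _ = ((emb i t)⁻¹ * (emb i s)⁻¹) * emb m y * (emb i s * emb i t) := by group
      _ = _ := by rw [e, e']; simp
  · simp only [MonoidHom.comp_apply, conjHom_of_ne hm, MonoidHom.id_apply]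

theorem transHom_comp {j : Fin k} {p q p' q' : FreeProd A k}
    (hp' : transHom j p q p' = p') (hq' : transHom j p q q' = q')
    (hp : p' * p = 1) (hq : q * q' = 1) :
    (transHom j p q).comp (transHom j p' q') = MonoidHom.id (FreeProd A k) := by
  refine hom_ext_x j (fun m hm y => ?_) ?_
  · simp only [MonoidHom.comp_apply, transHom_of_ne hm, MonoidHom.id_apply]
  · simp only [MonoidHom.comp_apply, transHom_same, map_mul, hp', hq', MonoidHom.id_apply]
    calc _ = (p' * p) * xG j * (q * q') := by group
      _ = _ := by rw [hp, hq]; simp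

/-- The partial conjugation `χ_{s,c}` of the factor `c` by an element `s` of another factor. -/
def partialConj {i c : Idx n k} (h : i ≠ c) (s : Factor A k i) : MulAut (FreeProd A k) :=
  MonoidHom.toMulEquiv (conjHom c (emb i s)) (conjHom c (emb i s⁻¹))
    (conjHom_comp h _ _ (inv_mul_cancel s)) (conjHom_comp h _ _ (mul_inv_cancel s))

/-- The left transvection `λ_{s,j} : x_j ↦ s x_j`. -/
def leftTransv {i : Idx n k} {j : Fin k} (h : i ≠ .inr j) (s : Factor A k i) :
    MulAut (FreeProd A k) :=
  MonoidHom.toMulEquiv (transHom j (emb i s) 1) (transHom j (emb i s⁻¹) 1)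
    (transHom_comp (transHom_of_ne h _ _ _) (map_one _) (by rw [← map_mul]; simp) (by simp))
    (transHom_comp (transHom_of_ne h _ _ _) (map_one _) (by rw [← map_mul]; simp) (by simp))

/-- The right transvection `ρ_{s,j} : x_j ↦ x_j s`. -/
def rightTransv {i : Idx n k} {j : Fin k} (h : i ≠ .inr j) (s : Factor A k i) :
    MulAut (FreeProd A k) :=
  MonoidHom.toMulEquiv (transHom j 1 (emb i s)) (transHom j 1 (emb i s⁻¹))
    (transHom_comp (map_one _) (transHom_of_ne h _ _ _) (by simp) (by rw [← map_mul]; simp))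
    (transHom_comp (map_one _) (transHom_of_ne h _ _ _) (by simp) (by rw [← map_mul]; simp))

/-- All partial conjugations and transvections by elements of the sets `T c`. -/
def frSet (T : ∀ c : Idx n k, Set (Factor A k c)) : Set (MulAut (FreeProd A k)) :=
  {φ | (∃ (i c : Idx n k) (h : i ≠ c), ∃ s ∈ T i, φ = partialConj h s) ∨
    (∃ (i : Idx n k) (j : Fin k) (h : i ≠ .inr j), ∃ s ∈ T i, φ = leftTransv h s) ∨
    (∃ (i : Idx n k) (j : Fin k) (h : i ≠ .inr j), ∃ s ∈ T i, φ = rightTransv h s)}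

/-- `Aut⁰(G)`, the group generated by all partial conjugations and transvections. -/
def autZero {n : ℕ} (A : Fin n → Type u) (k : ℕ) [∀ i, Group (A i)] :
    Subgroup (MulAut (FreeProd A k)) :=
  Subgroup.closure (frSet fun _ => Set.univ)

end

/-! ### Generators, words and quasi-geodesics -/

/-- The choices on which the combing rests: a finite generating set of each `A_i`, and a normal
form for the elements of `A_i` over it. -/
structure FactorData {n : ℕ} (A : Fin n → Type u) [∀ i, Group (A i)] where
  gens : ∀ i, Set (A i)
  finite_gens : ∀ i, (gens i).Finite
  closure_gens : ∀ i, Subgroup.closure (gens i) = ⊤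
  nf : ∀ i, A i → List (A i)
  nf_letters : ∀ i a, ∀ s ∈ nf i a, s ∈ gens i ∨ s⁻¹ ∈ gens i
  nf_prod : ∀ i a, (nf i a).prod = a

section

variable {n k : ℕ} {A : Fin n → Type u} [∀ i, Group (A i)]

/-- The chosen generators of each free factor; that of `⟨x_j⟩` is `x_j`. -/
def FactorData.factorGens (D : FactorData A) : ∀ c : Idx n k, Set (Factor A k c)
  | .inl i => D.gens i
  | .inr j => {xpow j true}

/-- The normal form of an element of a free factor; in `⟨x_j⟩` it is the reduced word. -/
def FactorData.factorNF (D : FactorData A) : ∀ c : Idx n k, Factor A k c → List (Factor A k c)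
  | .inl i, a => D.nf i a
  | .inr j, g => (FreeGroup.toWord (α := PUnit.{u + 1}) g).map fun p => xpow j p.2

/-- The length of the normal form of an element of a free factor. -/
def FactorData.len (D : FactorData A) (c : Idx n k) (a : Factor A k c) : ℕ :=
  (D.factorNF c a).length

/-- The Fouxe-Rabinovitch generators of `Aut⁰(G)`. -/
def FactorData.frGens (D : FactorData A) (k : ℕ) : Set (MulAut (FreeProd A k)) :=
  frSet D.factorGens

/-- `w` is a word in the Fouxe-Rabinovitch generators and their inverses whose product is `Φ`.
Automorphisms are composed as functions, so the last letter acts first. -/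
def FactorData.Represents (D : FactorData A) (w : List (MulAut (FreeProd A k)))
    (Φ : MulAut (FreeProd A k)) : Prop :=
  (∀ x ∈ w, x ∈ D.frGens k ∨ x⁻¹ ∈ D.frGens k) ∧ w.prod = Φ

/-- The word length of `Φ` with respect to the Fouxe-Rabinovitch generators. -/
noncomputable def FactorData.wordNorm (D : FactorData A) (Φ : MulAut (FreeProd A k)) : ℕ :=
  sInf {ℓ | ∃ w, D.Represents w Φ ∧ w.length = ℓ}

/-- The path in the Cayley graph that starts at `1` and reads the word `w` is a
`(K, C)`-quasi-geodesic. -/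
def FactorData.IsQuasiGeodesic (D : FactorData A) (K C : ℝ)
    (w : List (MulAut (FreeProd A k))) : Prop :=
  ∀ p q : ℕ, p ≤ w.length → q ≤ w.length →
    K⁻¹ * |(q : ℝ) - p| - C ≤ D.wordNorm ((w.take p).prod⁻¹ * (w.take q).prod) ∧
    (D.wordNorm ((w.take p).prod⁻¹ * (w.take q).prod) : ℝ) ≤ K * |(q : ℝ) - p| + C

end

/-! ### Graphs of groups over the thistle

The thistle has a vertex `⋆` with trivial group, vertices `v_i` with group `A_i`, an edge
("prickle") from `⋆` to `v_i` for `i = 1, …, n` and a loop ("petal") at `⋆` for `j = 1, …, k`; its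
edge groups are trivial. We represent graphs of groups `Λ` with a morphism to the thistle, such
that the only nontrivial vertex groups of `Λ` are one copy of each `A_i`, sitting at the
vertex `cone i` and mapped identically to the group of `v_i`. -/

/-- Names for the vertices: the base point, the vertex with group `A_i`, and the
vertices with trivial group that come from subdividing the edge `c` of the thistle. -/
inductive Vtx (n k : ℕ) : Type
  | base : Vtx n k
  | cone (i : Fin n) : Vtx n k
  | joint (c : Idx n k) (t : ℕ) : Vtx n k
  | tip (c : Idx n k) (t : ℕ) : Vtx n k

/-- The image of an edge in the thistle; for a prickle, together with the group element
that the morphism carries at the end of the edge over `v_i`. -/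
inductive Lab {n : ℕ} (A : Fin n → Type u) (k : ℕ) : Type u
  | prickle (i : Fin n) (a : A i) : Lab A k
  | petal (j : Fin k) : Lab A k

/-- An edge, oriented as its image (prickles from `⋆` to `v_i`). -/
structure Edge {n : ℕ} (A : Fin n → Type u) (k : ℕ) : Type u where
  src : Vtx n k
  tgt : Vtx n k
  lab : Lab A k

/-- A graph of groups over the thistle with a maximal tree. The edge `(mark j).1` is the edge
outside of the tree that represents `x_j`, traversed forwards if and only if `(mark j).2`. -/
structure State {n : ℕ} (A : Fin n → Type u) (k : ℕ) : Type u where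
  tree : Set (Edge A k)
  mark : Fin k → Edge A k × Bool

section

variable {n k : ℕ} {A : Fin n → Type u} [∀ i, Group (A i)]

/-- The vertices with trivial group other than the base point. They may lose their names. -/
def Vtx.Free (v : Vtx n k) : Prop := v ≠ .base ∧ ∀ i, v ≠ .cone i

def Lab.val : Lab A k → FreeProd A k
  | .prickle i a => emb (.inl i) a
  | .petal j => xG j

/-- The origin of an edge that is traversed forwards (`true`) or backwards (`false`). -/
def orig (p : Edge A k × Bool) : Vtx n k := if p.2 then p.1.src else p.1.tgt

/-- The end of an edge that is traversed forwards (`true`) or backwards (`false`). -/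
def term (p : Edge A k × Bool) : Vtx n k := if p.2 then p.1.tgt else p.1.src

/-- The element of `G` that is read along a traversed edge. -/
def dartVal (p : Edge A k × Bool) : FreeProd A k := if p.2 then p.1.lab.val else p.1.lab.val⁻¹

/-- The edges of the graph. -/
def State.edges (s : State A k) : Set (Edge A k) := s.tree ∪ Set.range fun j => (s.mark j).1

/-- `Φ` is the homomorphism on fundamental groups that the morphism induces when the maximal tree
identifies the fundamental group of the graph of groups with `G`: here `pos v` is read along
the path in the tree from the base point to `v`. -/
def State.Realizes (s : State A k) (Φ : MulAut (FreeProd A k)) : Prop :=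
  ∃ pos : Vtx n k → FreeProd A k, pos .base = 1 ∧
    (∀ e ∈ s.tree, pos e.tgt = pos e.src * e.lab.val) ∧
    (∀ (i : Fin n) (a : A i), Φ (emb (.inl i) a) =
      pos (.cone i) * emb (.inl i) a * (pos (.cone i))⁻¹) ∧
    ∀ j, Φ (xG j) = pos (orig (s.mark j)) * dartVal (s.mark j) * (pos (term (s.mark j)))⁻¹

/-- Two vertices are joined by a path in the set `T` of edges. -/
def Joined (T : Set (Edge A k)) : Vtx n k → Vtx n k → Prop :=
  Relation.EqvGen fun v v' => ∃ e ∈ T, e.src = v ∧ e.tgt = v'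

/-- The vertices that the edge `e` of the tree `T` separates from the base point. -/
def beyond (T : Set (Edge A k)) (e : Edge A k) : Set (Vtx n k) :=
  {v | ¬ Joined (T \ {e}) .base v}

open Classical in
/-- The effect on an edge of identifying the vertex `v` with `v'`. If `v` lies over `v_i`, then
the morphism is first replaced by an equivalent one: the group elements carried at `v`
are multiplied by `c i`. -/
noncomputable def Edge.merge (v v' : Vtx n k) (c : ∀ i, A i) (e : Edge A k) : Edge A k where
  src := if e.src = v then v' else e.src
  tgt := if e.tgt = v then v' else e.tgt
  lab := match e.lab with
    | .prickle i a => .prickle i (if e.tgt = v then a * c i else a)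
    | .petal j => .petal j

/-- The edges `e₁` and `e₂` start from a common vertex and have the same image (after replacing the
morphism by an equivalent one, as described by `c`); folding them identifies `v` with `v'`. -/
inductive FoldPair : Edge A k → Edge A k → Vtx n k → Vtx n k → (∀ i, A i) → Prop
  | prickle_src (w v v' : Vtx n k) (i : Fin n) (a a' : A i) :
      FoldPair ⟨w, v, .prickle i a⟩ ⟨w, v', .prickle i a'⟩ v v' (Pi.mulSingle i (a⁻¹ * a'))
  | prickle_tgt (w v v' : Vtx n k) (i : Fin n) (a : A i) :
      FoldPair ⟨v, w, .prickle i a⟩ ⟨v', w, .prickle i a⟩ v v' 1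
  | petal_src (w v v' : Vtx n k) (j : Fin k) :
      FoldPair ⟨w, v, .petal j⟩ ⟨w, v', .petal j⟩ v v' 1
  | petal_tgt (w v v' : Vtx n k) (j : Fin k) :
      FoldPair ⟨v, w, .petal j⟩ ⟨v', w, .petal j⟩ v v' 1

open Classical in
/-- The commuting product of partial conjugations and transvections by `h`, an element of the
factor `i`, that sends `y` to `h⁻¹ y h` on `A_l` for `l ∈ X`, and multiplies `x_j`
by `h⁻¹` on the left if `j ∈ L` and by `h` on the right if `j ∈ R`. It is written as a word in the
Fouxe-Rabinovitch generators in the order of the factors. The factor `i` itself is fixed. -/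
noncomputable def whitehead (D : FactorData A) (i : Idx n k) (h : Factor A k i)
    (X : Set (Fin n)) (L R : Set (Fin k)) : List (MulAut (FreeProd A k)) :=
  ((List.finRange n).flatMap fun l =>
    if hl : i ≠ .inl l then
      if l ∈ X then (D.factorNF i h).map (partialConj hl) else []
    else []) ++
  (List.finRange k).flatMap fun j =>
    if hj : i ≠ .inr j then
      if j ∈ L ∧ j ∈ R then (D.factorNF i h).map (partialConj hj)
      else if j ∈ L then (D.factorNF i h).map fun s => (leftTransv hj s)⁻¹
      else if j ∈ R then (D.factorNF i h).map (rightTransv hj)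
      else []
    else []

/-- The product for which all generators are affected whose loops cross into `B`. -/
noncomputable def State.whitehead (s : State A k) (D : FactorData A) (i : Idx n k)
    (h : Factor A k i) (B : Set (Vtx n k)) : List (MulAut (FreeProd A k)) :=
  FoldingCombing.whitehead D i h {l | .cone l ∈ B} {j | orig (s.mark j) ∈ B}
    {j | term (s.mark j) ∈ B}

/-! ### The folding procedure -/

open Classical in
/-- `Move D s r w s'`: one step of the folding procedure leads from `s` to `s'`, and the
automorphism that it contributes is the word `w`. The number `r` is the rank of the step:
`0` for a fold in the maximal tree, which contributes nothing, and otherwise the position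
`1, …, n + k` of the factor that contains the acting letter (with one exception). -/
inductive Move (D : FactorData A) :
    State A k → ℕ → List (MulAut (FreeProd A k)) → State A k → Prop
  /-- Fold two edges of the maximal tree. -/
  | treeFold (s : State A k) (e₁ e₂ : Edge A k) (v v' : Vtx n k) (c : ∀ i, A i)
      (h₁ : e₁ ∈ s.tree) (h₂ : e₂ ∈ s.tree) (hf : FoldPair e₁ e₂ v v' c)
      (hv : v.Free) (hne : v ≠ v') :
      Move D s 0 [] ⟨Edge.merge v v' c '' s.tree,
        fun l => (Edge.merge v v' c (s.mark l).1, (s.mark l).2)⟩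
  /-- Twist an edge of the maximal tree that leads away from the base point at the vertex with
  group `A_i`, so that it can be folded with another edge there. -/
  | twistTree (s : State A k) (i : Fin n) (z z' : Vtx n k) (a a' : A i)
      (h₁ : ⟨z, .cone i, .prickle i a⟩ ∈ s.tree)
      (h₂ : ⟨z', .cone i, .prickle i a'⟩ ∈ s.edges) (hne : a ≠ a')
      (hz : z ∈ beyond s.tree ⟨z, .cone i, .prickle i a⟩) :
      Move D s (i + 1)
        (s.whitehead D (.inl i) (a'⁻¹ * a : A i) (beyond s.tree ⟨z, .cone i, .prickle i a⟩))
        ⟨insert ⟨z, .cone i, .prickle i a'⟩ (s.tree \ {⟨z, .cone i, .prickle i a⟩}), s.mark⟩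
  /-- The same for an edge outside of the maximal tree. -/
  | twistMark (s : State A k) (i : Fin n) (j : Fin k) (b : Bool) (z z' : Vtx n k) (a a' : A i)
      (h₁ : s.mark j = (⟨z, .cone i, .prickle i a⟩, b))
      (h₂ : ⟨z', .cone i, .prickle i a'⟩ ∈ s.edges) (hne : a ≠ a') :
      Move D s (i + 1)
        (whitehead D (.inl i) (a'⁻¹ * a : A i) ∅
          {l | l = j ∧ b = false} {l | l = j ∧ b = true})
        ⟨s.tree, Function.update s.mark j (⟨z, .cone i, .prickle i a'⟩, b)⟩
  /-- Fold an edge `e'` of the maximal tree with a loop outside of the tree that represents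
  `x_j`, at the common origin. The other end of `e'` is `y`. -/
  | loopFoldSrc (s : State A k) (j p : Fin k) (b : Bool) (w y v v' : Vtx n k)
      (h₁ : s.mark j = (⟨w, w, .petal p⟩, b)) (h₂ : ⟨w, y, .petal p⟩ ∈ s.tree) (hy : y ≠ w)
      (hv : v.Free) (hvv : v = y ∧ v' = w ∨ v = w ∧ v' = y) :
      Move D s (n + j + 1)
        (s.whitehead D (.inr j)
          (xpow j (if y ∈ beyond s.tree ⟨w, y, .petal p⟩ then !b else b))
          (beyond s.tree ⟨w, y, .petal p⟩))
        ⟨Edge.merge v v' 1 '' (s.tree \ {⟨w, y, .petal p⟩}),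
          fun l => (Edge.merge v v' 1 (s.mark l).1, (s.mark l).2)⟩
  /-- The same at the common end. -/
  | loopFoldTgt (s : State A k) (j p : Fin k) (b : Bool) (w y v v' : Vtx n k)
      (h₁ : s.mark j = (⟨w, w, .petal p⟩, b)) (h₂ : ⟨y, w, .petal p⟩ ∈ s.tree) (hy : y ≠ w)
      (hv : v.Free) (hvv : v = y ∧ v' = w ∨ v = w ∧ v' = y) :
      Move D s (n + j + 1)
        (s.whitehead D (.inr j)
          (xpow j (if y ∈ beyond s.tree ⟨y, w, .petal p⟩ then b else !b))
          (beyond s.tree ⟨y, w, .petal p⟩))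
        ⟨Edge.merge v v' 1 '' (s.tree \ {⟨y, w, .petal p⟩}),
          fun l => (Edge.merge v v' 1 (s.mark l).1, (s.mark l).2)⟩
  /-- Change the maximal tree: if the edge outside of the tree that represents `x_j` is not a loop
  and has the same image as another edge `e₂` at one of its ends, add it to the tree, and remove the
  next edge `e'` of the cycle that it closes. Then `e'` represents `x_j`. If this does not yet put
  both edges of the fold into the tree, the step is postponed: its rank is `n + k + 1`. -/
  | treeChange (s : State A k) (j : Fin k) (e₂ e' : Edge A k) (b' : Bool)
      (v v' : Vtx n k) (c : ∀ i, A i)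
      (hloop : (s.mark j).1.src ≠ (s.mark j).1.tgt)
      (h₂ : e₂ ∈ s.edges) (hf : FoldPair (s.mark j).1 e₂ v v' c) (hne : v ≠ v')
      (h' : e' ∈ s.tree) (ho : orig (e', b') = term (s.mark j))
      (hsep : ¬ Joined (s.tree \ {e'}) (term (s.mark j)) (orig (s.mark j))) :
      Move D s (if e₂ ∈ s.tree ∧ e₂ ≠ e' then n + j + 1 else n + k + 1)
        (s.whitehead D (.inr j) (xpow j (decide (term (s.mark j) ∈ beyond s.tree e')))
          (beyond s.tree e'))
        ⟨insert (s.mark j).1 (s.tree \ {e'}), Function.update s.mark j (e', b')⟩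

/-- A sequence of steps, each of which has the smallest rank among the possible ones, with the word
that it contributes. -/
inductive Folds (D : FactorData A) :
    State A k → List (MulAut (FreeProd A k)) → State A k → Prop
  | refl (s : State A k) : Folds D s [] s
  | step (s s' s'' : State A k) (r : ℕ) (w w' : List (MulAut (FreeProd A k)))
      (hm : Move D s r w s') (hmin : ∀ r' w₁ s₁, Move D s r' w₁ s₁ → r ≤ r')
      (h : Folds D s' w' s'') : Folds D s (w' ++ w) s''

/-- No step is possible: the morphism to the thistle is an immersion. -/
def State.Terminal (s : State A k) (D : FactorData A) : Prop :=
  ∀ r w s', ¬ Move D s r w s'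

/-! ### The initial state -/

/-- The letters of a path in the thistle: go along the prickle `i` and back, picking up
`a ∈ A_i`, or go around the petal `j` forwards (`true`) or backwards (`false`). -/
inductive Letter {n : ℕ} (A : Fin n → Type u) (k : ℕ) : Type u
  | prickle (i : Fin n) (a : A i) : Letter A k
  | petal (j : Fin k) (b : Bool) : Letter A k

def Letter.val : Letter A k → FreeProd A k
  | .prickle i a => emb (.inl i) a
  | .petal j b => emb (.inr j) (xpow j b)

/-- Two letters may follow each other in a tight path. -/
def Letter.Compatible : Letter A k → Letter A k → Prop
  | .prickle i _, .prickle i' _ => i ≠ i'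
  | .petal j b, .petal j' b' => j = j' → b = b'
  | _, _ => True

/-- The list of letters describes a tight path. -/
def Tight (P : List (Letter A k)) : Prop :=
  P.IsChain Letter.Compatible ∧ ∀ i, .prickle i 1 ∉ P

/-- The vertex reached after `t` of the `ℓ` letters of the path along which the edge `c` of
the thistle is mapped. -/
def node (c : Idx n k) (ℓ t : ℕ) : Vtx n k :=
  if t = 0 then .base else if c.isRight ∧ t = ℓ then .base else .joint c t

/-- The edges into which the edge `c` of the thistle is subdivided for the letters of `P`. -/
def segments (c : Idx n k) (P : List (Letter A k)) : List (Edge A k × Bool) :=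
  P.zipIdx.flatMap fun x => match x.1 with
    | .prickle i a => [(⟨node c P.length x.2, .tip c x.2, .prickle i a⟩, true),
        (⟨node c P.length (x.2 + 1), .tip c x.2, .prickle i 1⟩, false)]
    | .petal j true => [(⟨node c P.length x.2, node c P.length (x.2 + 1), .petal j⟩, true)]
    | .petal j false => [(⟨node c P.length (x.2 + 1), node c P.length x.2, .petal j⟩, false)]

/-- `s` is the subdivided thistle with the morphism that realizes `Φ`. The prickle `i` is mapped to
the tight path that reads `P (inl i)` and then ends in the prickle `i` with the group
element `z i`; the petal `j` is mapped to the tight path that reads `P (inr j)`. The maximal tree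
omits one edge of every subdivided petal; for the petal `j` it is an edge that is mapped
to the petal `j`, if there is one. -/
structure IsInitial (Φ : MulAut (FreeProd A k)) (P : Idx n k → List (Letter A k))
    (z : ∀ i, A i) (s : State A k) : Prop where
  tight : ∀ c, Tight (P c)
  tight_end : ∀ (i : Fin n) (a : A i), .prickle i a ∉ (P (.inl i)).getLast?
  map_factor : ∀ (i : Fin n) (a : A i), Φ (emb (.inl i) a) =
    (((P (.inl i)).map Letter.val).prod * emb (.inl i) (z i)) * emb (.inl i) a *
      (((P (.inl i)).map Letter.val).prod * emb (.inl i) (z i))⁻¹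
  map_x : ∀ j, Φ (xG j) = ((P (.inr j)).map Letter.val).prod
  mark_mem : ∀ j, s.mark j ∈ segments (.inr j) (P (.inr j))
  mark_lab : ∀ j, (∃ p ∈ segments (.inr j) (P (.inr j)), p.1.lab = .petal j) →
    (s.mark j).1.lab = .petal j
  tree_eq : s.tree =
    ({e | ∃ c, ∃ p ∈ segments c (P c), p.1 = e} ∪
      Set.range fun i => ⟨node (.inl i) (P (.inl i)).length (P (.inl i)).length, .cone i,
        .prickle i (z i)⟩) \ Set.range fun j => (s.mark j).1

/-- `w` is a folding normal form of `Φ`: realize `Φ` on the thistle, fold until the morphism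
is an immersion, and record the automorphisms that occur, the first one as the last letters of the
word. The remaining immersion induces an automorphism `σ`; if it is not the identity, a
word for it is put in front. -/
def IsFoldingNormalForm (D : FactorData A) (Φ : MulAut (FreeProd A k))
    (w : List (MulAut (FreeProd A k))) : Prop :=
  ∃ (P : Idx n k → List (Letter A k)) (z : ∀ i, A i) (s s' : State A k)
    (σ : MulAut (FreeProd A k)) (w₀ w₁ : List (MulAut (FreeProd A k))),
    IsInitial Φ P z s ∧ Folds D s w₁ s' ∧ s'.Terminal D ∧ s'.Realizes σ ∧
    D.Represents w₀ σ ∧ (σ = 1 → w₀ = []) ∧ w = w₀ ++ w₁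

/-- `Φ` has folding normal forms, each of them has length exactly `N`, and `Φ` is also represented
by a word of length `N'`. -/
def FoldingLengths (D : FactorData A) (Φ : MulAut (FreeProd A k)) (N N' : ℕ) : Prop :=
  Φ ∈ autZero A k ∧ (∃ w, IsFoldingNormalForm D Φ w) ∧
    (∀ w, IsFoldingNormalForm D Φ w → D.Represents w Φ ∧ w.length = N) ∧
    ∃ w, D.Represents w Φ ∧ w.length = N'

end

end FoldingCombing

open FoldingCombing

/-! The automorphisms in question move a single factor `δ`, by a tight word `L` that avoids `δ`. For
these the folding procedure has no real choice, and it spells `L` letter by letter.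

Tight words are normal forms in the free product (`Tight.eq_of_lval_eq`), so the paths that realize
such an automorphism are determined; only the elements `z i` at the vertices with group `A_i` remain
free, and they must be central (`conj_tight_unique`, `IsInitial.paths_unique`). The condition on the
maximal tree forces the marked edges. The initial graph is thus a thistle that is already folded,
together with one arc at the base point to whose far end the factor `δ` is attached
(`startState_eq_pathState`). The arc is immersed and never crosses `δ`, so the only edge on which a
step can act is its first one, folded onto the thistle (`PathOK.fold`, `move_cases`). At every stage
exactly one step is possible, so the rule of smallest rank is vacuous.

The arc, read from the base point, spells the inverse of `L`, so the letters of `L` are folded off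
from the last to the first. Each contributes a partial conjugation or right transvection of `δ` by
that letter, written in its normal form. Later contributions stand further left, so the word comes
out in the order of `L` (`folds_iff`). What remains is the thistle with central twists, which
induces the identity. Hence there is exactly one folding normal form, and its length is the sum of
the lengths of the letters of `L` (`isFoldingNormalForm_iff`, `length_letterWord`).

Short words come from conjugating inside the automorphism group, which folding never does. If `φ`
acts on `δ` by `v`, and `θ` fixes `δ` and preserves the product of the other factors, then `θ φ θ⁻¹`
acts on `δ` by `θ v` (`Acts.conj`). Let `θ` conjugate the factor of `c` by `ab`, and let `φ` act on
`δ` by `ca`. Then `θ^m (ca) = (ab)⁻ᵐ c (ab)ᵐ a = u`, so `θ^m φ^N θ⁻ᵐ` acts by `u^N` and has a word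
of length `2m + 2N + 2m`. If `c` is some `x_j`, the transvection `x_j ↦ x_j ab` can be used as `θ`,
with `φ` acting by `x_j` alone; a single free generator in place of `ab` then covers rank three.

For `m = N` the folding normal form has length at least `N²`, against a word of length at most `6N`,
which violates every lower quasi-geodesic bound once `N` is large. -/

namespace FoldingCombing

universe u

set_option linter.unusedSectionVars false

section NormalForm

variable {n k : ℕ} {A : Fin n → Type u} [∀ i, Group (A i)]

/-! ### Letters and tight words -/

/-- The factor a letter belongs to. -/
def Letter.idx : Letter A k → Idx n k
  | .prickle i _ => .inl i
  | .petal j _ => .inr j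

/-- The element of its factor that a letter denotes. -/
def Letter.elt : (x : Letter A k) → Factor A k x.idx
  | .prickle _ a => a
  | .petal j b => xpow j b

/-- The formal inverse of a letter. -/
def Letter.inv : Letter A k → Letter A k
  | .prickle i a => .prickle i a⁻¹
  | .petal j b => .petal j !b

/-- The product of a list of letters. -/
def lval (P : List (Letter A k)) : FreeProd A k := (P.map Letter.val).prod

/-- The formal inverse of a list of letters. -/
def linv (P : List (Letter A k)) : List (Letter A k) := (P.map Letter.inv).reverse

theorem xpow_not (j : Fin k) (b : Bool) :
    (xpow j (!b) : Factor A k (.inr j)) = (xpow j b)⁻¹ := by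
  cases b
  · exact (inv_inv (FreeGroup.of PUnit.unit : FreeGroup PUnit.{u + 1})).symm
  · rfl

theorem Letter.val_eq (x : Letter A k) : x.val = emb x.idx x.elt := by cases x <;> rfl

@[simp] theorem Letter.idx_inv (x : Letter A k) : x.inv.idx = x.idx := by cases x <;> rfl

theorem Letter.val_inv (x : Letter A k) : x.inv.val = x.val⁻¹ := by
  cases x with
  | prickle i a => exact map_inv (emb (.inl i)) a
  | petal j b => exact (congrArg _ (xpow_not j b)).trans (map_inv (emb (.inr j)) _)

@[simp] theorem lval_nil : lval ([] : List (Letter A k)) = 1 := rfl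

@[simp] theorem lval_cons (x : Letter A k) (P : List (Letter A k)) :
    lval (x :: P) = x.val * lval P := by simp [lval]

@[simp] theorem lval_append (P Q : List (Letter A k)) : lval (P ++ Q) = lval P * lval Q := by
  simp [lval]

@[simp] theorem lval_linv (P : List (Letter A k)) : lval (linv P) = (lval P)⁻¹ := by
  induction P with
  | nil => simp [linv]
  | cons x P ih =>
    have : linv (x :: P) = linv P ++ [x.inv] := by simp [linv]
    rw [this, lval_append, ih]
    simp [Letter.val_inv]

theorem Letter.compatible_of_idx_ne {x y : Letter A k} (h : x.idx ≠ y.idx) : x.Compatible y := by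
  cases x <;> cases y <;> simp_all [Letter.Compatible, Letter.idx]

theorem Letter.Compatible.inv {x y : Letter A k} (h : x.Compatible y) :
    y.inv.Compatible x.inv := by
  cases x <;> cases y <;> simp_all [Letter.Compatible, Letter.inv]
  exact fun e => h e.symm

theorem Tight.inv {P : List (Letter A k)} (h : Tight P) : Tight (linv P) := by
  refine ⟨?_, fun i => ?_⟩
  · rw [linv, List.isChain_reverse, List.isChain_map]
    exact h.1.imp fun _ _ => Letter.Compatible.inv
  · rw [linv, List.mem_reverse, List.mem_map]
    rintro ⟨x, hx, e⟩
    cases x with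
    | prickle i' a =>
      simp only [Letter.inv, Letter.prickle.injEq] at e
      obtain ⟨rfl, e⟩ := e
      obtain rfl : a = 1 := by simpa using e
      exact h.2 _ hx
    | petal j b => simp [Letter.inv] at e

/-! ### Tight words as normal forms in the free product -/

/-- The exponent of an element of an infinite cyclic factor. -/
def expHom (j : Fin k) : Factor A k (.inr j) →* Multiplicative ℤ :=
  (FreeGroup.lift fun _ => Multiplicative.ofAdd (1 : ℤ) :
    FreeGroup PUnit.{u + 1} →* Multiplicative ℤ)

theorem expHom_xpow (j : Fin k) (b : Bool) :
    expHom (A := A) j (xpow j b) = Multiplicative.ofAdd (if b then 1 else -1 : ℤ) := by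
  cases b
  · change (FreeGroup.lift _ : FreeGroup PUnit.{u + 1} →* _) (FreeGroup.of _)⁻¹ = _
    simp
  · change (FreeGroup.lift _ : FreeGroup PUnit.{u + 1} →* _) (FreeGroup.of _) = _
    simp

theorem expHom_xpow_pow (j : Fin k) (b : Bool) (m : ℕ) :
    expHom (A := A) j (xpow j b ^ m) = Multiplicative.ofAdd (if b then (m : ℤ) else -m) := by
  rw [map_pow, expHom_xpow, ← ofAdd_nsmul]
  cases b <;> simp

theorem xpow_pow_ne_one (j : Fin k) (b : Bool) (m : ℕ) :
    (xpow j b ^ (m + 1) : Factor A k (.inr j)) ≠ 1 := fun h => by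
  have := congrArg (expHom (A := A) j) h
  rw [expHom_xpow_pow, map_one, ← ofAdd_zero] at this
  have := Multiplicative.ofAdd.injective this
  cases b <;> simp at this <;> omega

theorem xpow_pow_sign {j : Fin k} {b b' : Bool} {m m' : ℕ}
    (h : (xpow j b ^ (m + 1) : Factor A k (.inr j)) = xpow j b' ^ (m' + 1)) : b = b' := by
  have := congrArg (expHom (A := A) j) h
  rw [expHom_xpow_pow, expHom_xpow_pow] at this
  have := Multiplicative.ofAdd.injective this
  cases b <;> cases b' <;> simp at this ⊢ <;> omega

/-- The reduced word of the free product that begins with a power of the given letter. -/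
def BeginsWith (w : Monoid.CoprodI.Word (Factor A k)) (x : Letter A k) : Prop :=
  ∃ m : ℕ, (x.idx.isLeft → m = 0) ∧ ∃ tl, w.toList = ⟨x.idx, x.elt ^ (m + 1)⟩ :: tl

theorem BeginsWith.eq {w : Monoid.CoprodI.Word (Factor A k)} {x y : Letter A k}
    (hx : BeginsWith w x) (hy : BeginsWith w y) : x = y := by
  obtain ⟨m, hm, tl, h⟩ := hx
  obtain ⟨m', hm', tl', h'⟩ := hy
  rw [h] at h'
  simp only [List.cons.injEq] at h'
  have h1 := h'.1
  cases x <;> cases y <;> simp only [Letter.idx, Letter.elt, Sigma.mk.injEq, reduceCtorEq,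
    false_and, Sum.inl.injEq, Sum.inr.injEq] at h1 hm hm'
  · obtain ⟨rfl, e⟩ := h1
    obtain rfl := hm rfl
    obtain rfl := hm' rfl
    exact congrArg _ ((pow_one _).symm.trans ((eq_of_heq e).trans (pow_one _)))
  · obtain ⟨rfl, e⟩ := h1
    rw [xpow_pow_sign (eq_of_heq e)]

/-- Reduced words of the free product have one syllable per factor, whereas a tight word spells a
power of `x_j` letter by letter. Collecting equal consecutive petals into one power gives the
reduced word. Its first syllable still determines the first letter, through the factor and the sign
of the exponent, and this is what makes an induction on uniqueness possible. -/
theorem exists_word_of_tight {P : List (Letter A k)} (h : Tight P) :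
    ∃ w : Monoid.CoprodI.Word (Factor A k), w.prod = lval P ∧
      ∀ x, P.head? = some x → BeginsWith w x := by
  induction P with
  | nil => exact ⟨Monoid.CoprodI.Word.empty, by simp, by simp⟩
  | cons x P ih =>
    obtain ⟨w, hw, hh⟩ := ih ⟨h.1.tail, fun i hi => h.2 i (List.mem_cons_of_mem _ hi)⟩
    have hx1 : x.elt ≠ 1 := by
      cases x with
      | prickle i a =>
        intro e
        exact h.2 i (by rw [show a = 1 from e]; exact List.mem_cons_self)
      | petal j b => exact fun e => xpow_pow_ne_one (A := A) j b 0 ((pow_one _).trans e)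
    by_cases hf : w.fstIdx = some x.idx
    · obtain ⟨y, P', rfl⟩ : ∃ y P', P = y :: P' := by
        cases P with
        | nil =>
          have : w = Monoid.CoprodI.Word.empty := by
            classical
            apply Monoid.CoprodI.Word.equiv.symm.injective
            change w.prod = Monoid.CoprodI.Word.prod _
            rw [hw]; simp
          subst this
          simp [Monoid.CoprodI.Word.fstIdx, Monoid.CoprodI.Word.empty] at hf
        | cons y P' => exact ⟨y, P', rfl⟩
      obtain ⟨m, hm, tl, e⟩ := hh y rfl
      -- Neighbouring letters over the same factor are compatible only if they are the same petal in
      -- the same direction.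
      have hxy : x = y := by
        have e1 : y.idx = x.idx := by
          simpa [Monoid.CoprodI.Word.fstIdx, e] using hf
        have hc : x.Compatible y := by
          have := h.1
          rw [List.isChain_cons_cons] at this
          exact this.1
        cases x <;> cases y <;> simp_all [Letter.Compatible, Letter.idx]
      subst hxy
      cases x with
      | prickle i a =>
        exfalso
        have hc := h.1
        rw [List.isChain_cons_cons] at hc
        exact hc.1 rfl
      | petal j b =>
        have hc := w.chain_ne
        have hn := w.ne_one
        rw [e] at hc hn
        -- The syllable `x_j^(±(m+1))` of the tail absorbs one more letter.
        refine ⟨⟨⟨.inr j, xpow j b ^ (m + 2)⟩ :: tl, ?_, ?_⟩, ?_, ?_⟩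
        · intro l hl
          rcases List.mem_cons.1 hl with rfl | hl
          · exact xpow_pow_ne_one j b (m + 1)
          · exact hn l (List.mem_cons_of_mem _ hl)
        · cases tl with
          | nil => exact List.isChain_singleton _
          | cons _ _ =>
            rw [List.isChain_cons_cons] at hc ⊢
            exact hc
        · rw [lval_cons, ← hw, Letter.val_eq]
          simp only [Monoid.CoprodI.Word.prod, e, List.map_cons, List.prod_cons]
          rw [← mul_assoc]
          congr 1
          exact (congrArg (emb (.inr j)) (pow_succ' (xpow j b) (m + 1))).trans (map_mul _ _ _)
        · rintro _ ⟨⟩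
          exact ⟨m + 1, by simp [Letter.idx], tl, rfl⟩
    · refine ⟨w.cons x.elt hf hx1, ?_, ?_⟩
      · rw [Monoid.CoprodI.Word.prod_cons, lval_cons, hw, Letter.val_eq]
      · rintro _ ⟨⟩
        exact ⟨0, fun _ => rfl, w.toList, by simp [Monoid.CoprodI.Word.cons]⟩

theorem Tight.tail {x : Letter A k} {P : List (Letter A k)} (h : Tight (x :: P)) : Tight P :=
  ⟨h.1.tail, fun i hi => h.2 i (List.mem_cons_of_mem _ hi)⟩

theorem word_prod_injective :
    Function.Injective (Monoid.CoprodI.Word.prod : Monoid.CoprodI.Word (Factor A k) → _) := by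
  classical
  exact (Monoid.CoprodI.Word.equiv (M := Factor A k)).symm.injective

theorem lval_ne_one {x : Letter A k} {P : List (Letter A k)} (h : Tight (x :: P)) :
    lval (x :: P) ≠ 1 := fun e => by
  obtain ⟨w, hw, hh⟩ := exists_word_of_tight h
  obtain rfl : w = Monoid.CoprodI.Word.empty := word_prod_injective (by rw [hw, e]; simp)
  obtain ⟨_, _, _, h⟩ := hh x rfl
  simp [Monoid.CoprodI.Word.empty] at h

/-- Tight words with the same value are equal. -/
theorem Tight.eq_of_lval_eq {P Q : List (Letter A k)} (hP : Tight P) (hQ : Tight Q)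
    (h : lval P = lval Q) : P = Q := by
  induction P generalizing Q with
  | nil =>
    cases Q with
    | nil => rfl
    | cons y Q => exact absurd h.symm (lval_ne_one hQ)
  | cons x P ih =>
    cases Q with
    | nil => exact absurd h (lval_ne_one hP)
    | cons y Q =>
      obtain ⟨w, hw, hx⟩ := exists_word_of_tight hP
      obtain ⟨w', hw', hy⟩ := exists_word_of_tight hQ
      obtain rfl : w = w' := word_prod_injective (by rw [hw, hw', h])
      obtain rfl := (hx x rfl).eq (hy y rfl)
      rw [ih hP.tail hQ.tail (by simpa using h)]

/-- No cancellation or amalgamation can occur at the middle letter, because `P` does not end in the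
prickle `i`. -/
theorem tight_conj {i : Fin n} {P : List (Letter A k)} (hP : Tight P)
    (he : ∀ a, Letter.prickle i a ∉ P.getLast?) {a : A i} (ha : a ≠ 1) :
    Tight (P ++ (.prickle i a :: linv P)) := by
  refine ⟨?_, fun i' => ?_⟩
  · have hp : ∀ x ∈ P.getLast?, x.Compatible (.prickle i a) := by
      intro x hx
      cases x with
      | prickle i' a' => rintro rfl; exact he _ hx
      | petal j b => trivial
    refine hP.1.append (hP.inv.1.cons ?_) ?_
    · intro y hy
      simp only [linv, List.head?_reverse, List.getLast?_map, Option.mem_def,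
        Option.map_eq_some_iff] at hy
      obtain ⟨x, hx, rfl⟩ := hy
      have := hp x hx
      cases x with
      | prickle i' a' => exact fun e => this e.symm
      | petal j b => trivial
    · intro x hx y hy
      simp only [List.head?_cons, Option.mem_def, Option.some.injEq] at hy
      subst hy
      exact hp x hx
  · simp only [List.mem_append, List.mem_cons, not_or]
    refine ⟨hP.2 i', ?_, hP.inv.2 i'⟩
    intro e
    simp only [Letter.prickle.injEq] at e
    obtain ⟨rfl, e⟩ := e
    exact ha (eq_of_heq e).symm

/-- If two tight words act in the same way by conjugation on a vertex group, then they are equal,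
up to a central element. -/
theorem conj_tight_unique {i : Fin n} [Nontrivial (A i)] {P Q : List (Letter A k)}
    (hP : Tight P) (hQ : Tight Q) (heP : ∀ a, Letter.prickle i a ∉ P.getLast?)
    (heQ : ∀ a, Letter.prickle i a ∉ Q.getLast?) (z : A i)
    (h : ∀ a : A i, (lval P * emb (.inl i) z) * emb (.inl i) a *
      (lval P * emb (.inl i) z)⁻¹ = lval Q * emb (.inl i) a * (lval Q)⁻¹) :
    P = Q ∧ ∀ a : A i, z * a = a * z := by
  have key : ∀ a : A i, a ≠ 1 → P = Q ∧ z * a * z⁻¹ = a := by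
    intro a ha
    have hz : z * a * z⁻¹ ≠ 1 := by simpa using ha
    -- The image of one nontrivial `a` has two tight spellings, with `z` absorbed into the middle
    -- letter. Their lengths `2|P| + 1` and `2|Q| + 1` agree, so the middle letters correspond: this
    -- gives `P = Q` and shows that `z` commutes with `a`.
    have e : P ++ (.prickle i (z * a * z⁻¹) :: linv P) = Q ++ (.prickle i a :: linv Q) := by
      refine (tight_conj hP heP hz).eq_of_lval_eq (tight_conj hQ heQ ha) ?_
      have h1 : (Letter.prickle i (z * a * z⁻¹) : Letter A k).val =
          emb (.inl i) z * emb (.inl i) a * (emb (.inl i) z)⁻¹ :=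
        (map_mul (emb (k := k) (.inl i)) (z * a : A i) (z⁻¹ : A i)).trans
          (congrArg₂ _ (map_mul (emb (k := k) (.inl i)) z a) (map_inv (emb (k := k) (.inl i)) z))
      have h2 := h a
      simp only [lval_append, lval_cons, lval_linv, h1]
      rw [show (Letter.prickle i a : Letter A k).val = emb (.inl i) a from rfl,
        ← mul_assoc (lval Q)]
      refine Eq.trans ?_ h2
      group
    have hl := congrArg List.length e
    simp only [List.length_append, List.length_cons, linv, List.length_reverse,
      List.length_map] at hl
    obtain ⟨e1, e2⟩ := List.append_inj e (by omega)
    refine ⟨e1, ?_⟩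
    simpa using (List.cons.inj e2).1
  obtain ⟨a₀, ha₀⟩ := exists_ne (1 : A i)
  refine ⟨(key a₀ ha₀).1, fun a => ?_⟩
  by_cases ha : a = 1
  · simp [ha]
  · have := (key a ha).2
    rwa [mul_inv_eq_iff_eq_mul] at this

end NormalForm

section PathStates

variable {n k : ℕ} {A : Fin n → Type u} [∀ i, Group (A i)]

/-! ### Immersed paths of darts -/

/-- The factor over which an edge lies. -/
def Lab.idx : Lab A k → Idx n k
  | .prickle i _ => .inl i
  | .petal j => .inr j

/-- The reversed dart. -/
def rev (d : Edge A k × Bool) : Edge A k × Bool := (d.1, !d.2)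

@[simp] theorem orig_rev (d : Edge A k × Bool) : orig (rev d) = term d := by
  rcases d with ⟨e, _ | _⟩ <;> rfl

@[simp] theorem term_rev (d : Edge A k × Bool) : term (rev d) = orig d := by
  rcases d with ⟨e, _ | _⟩ <;> rfl

@[simp] theorem rev_rev (d : Edge A k × Bool) : rev (rev d) = d := by simp [rev]

/-- The germ of the image of a dart; a forward prickle can be twisted at its end. -/
def germ (d : Edge A k × Bool) : Lab A k × Bool :=
  (match d.1.lab, d.2 with
    | .prickle i _, true => .prickle i 1
    | l, _ => l, d.2)

theorem germ_idx (d : Edge A k × Bool) : (germ d).1.idx = d.1.lab.idx := by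
  rcases d with ⟨⟨s, t, l⟩, b⟩
  cases l <;> cases b <;> rfl

/-- A path of darts from a vertex that never backtracks up to folding. -/
def ImmPath : Vtx n k → List (Edge A k × Bool) → Prop
  | _, [] => True
  | v, d :: l => orig d = v ∧ (∀ d' ∈ l.head?, germ d' ≠ germ (rev d)) ∧ ImmPath (term d) l

/-- The end of a path of darts. -/
def endV : Vtx n k → List (Edge A k × Bool) → Vtx n k
  | v, [] => v
  | _, d :: l => endV (term d) l

/-- The dart belongs to the path or to its inverse. -/
def OnPath (l : List (Edge A k × Bool)) (d : Edge A k × Bool) : Prop := d ∈ l ∨ rev d ∈ l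

theorem onPath_iff {l : List (Edge A k × Bool)} {e : Edge A k} (b : Bool) :
    OnPath l (e, b) ↔ ∃ d ∈ l, d.1 = e := by
  constructor
  · rintro (h | h)
    · exact ⟨_, h, rfl⟩
    · exact ⟨_, h, rfl⟩
  · rintro ⟨⟨e, b'⟩, h, rfl⟩
    cases b <;> cases b' <;> simp_all [OnPath, rev]

theorem onPath_cons {l : List (Edge A k × Bool)} {d d' : Edge A k × Bool} :
    OnPath (d' :: l) d ↔ d = d' ∨ d = rev d' ∨ OnPath l d := by
  have : rev d = d' ↔ d = rev d' := ⟨fun h => by rw [← h, rev_rev], fun h => by rw [h, rev_rev]⟩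
  simp only [OnPath, List.mem_cons, this]
  tauto

theorem ImmPath.orig_mem {v : Vtx n k} {l : List (Edge A k × Bool)} (h : ImmPath v l)
    {d : Edge A k × Bool} (hd : OnPath l d) : orig d ∈ v :: l.map term := by
  induction l generalizing v with
  | nil => simp [OnPath] at hd
  | cons d₀ l ih =>
    rcases onPath_cons.1 hd with rfl | rfl | hd
    · simp [h.1]
    · simp
    · exact List.mem_cons_of_mem _ (ih h.2.2 hd)

/-- The path never returns to its start, so the only dart of the path or its inverse that leaves the
start is the first one. -/
theorem ImmPath.head {v : Vtx n k} {l : List (Edge A k × Bool)} (h : ImmPath v l)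
    {d : Edge A k × Bool} (hd : OnPath l d) (hv : v ∉ l.map term) (ho : orig d = v) :
    ∃ tl, l = d :: tl := by
  cases l with
  | nil => simp [OnPath] at hd
  | cons d₀ l =>
    rcases onPath_cons.1 hd with rfl | rfl | hd
    · exact ⟨l, rfl⟩
    · simp at ho
      simp [ho] at hv
    · exact absurd (ho ▸ h.2.2.orig_mem hd) hv

/-- At a vertex of an embedded path at most two darts leave: the next one and the reverse of the
previous one. The immersion condition says that their germs differ. So two edges of the path can
never be folded with each other. -/
theorem ImmPath.eq_of_germ {v : Vtx n k} {l : List (Edge A k × Bool)} (h : ImmPath v l)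
    (hn : (v :: l.map term).Nodup) {d d' : Edge A k × Bool} (hd : OnPath l d)
    (hd' : OnPath l d') (ho : orig d = orig d') (hg : germ d = germ d') : d = d' := by
  induction l generalizing v with
  | nil => simp [OnPath] at hd
  | cons d₀ l ih =>
    obtain ⟨hv, hn'⟩ := List.nodup_cons.1 hn
    have hv' := (List.nodup_cons.1 hn').1
    have aux : ∀ {x y : Edge A k × Bool}, OnPath l y → orig x = orig y → germ x = germ y →
        x = d₀ ∨ x = rev d₀ → x = y := by
      rintro x y hy ho hg (rfl | rfl)
      · exact absurd (h.1 ▸ ho ▸ h.2.2.orig_mem hy) hv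
      · rw [orig_rev] at ho
        obtain ⟨tl, rfl⟩ := h.2.2.head hy hv' ho.symm
        exact absurd hg.symm (h.2.1 y rfl)
    have hne : orig d₀ ≠ orig (rev d₀) := by
      rw [orig_rev, h.1]
      rintro rfl
      simp at hv
    rcases onPath_cons.1 hd with e | e | p <;> rcases onPath_cons.1 hd' with e' | e' | p'
    · rw [e, e']
    · exact absurd (by rw [e, e'] at ho; exact ho) hne
    · exact aux p' ho hg (.inl e)
    · exact absurd (by rw [e, e'] at ho; exact ho.symm) hne
    · rw [e, e']
    · exact aux p' ho hg (.inr e)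
    · exact (aux p ho.symm hg.symm (.inl e')).symm
    · exact (aux p ho.symm hg.symm (.inr e')).symm
    · exact ih h.2.2 hn' p p'

/-- This treats the four kinds of folds uniformly; `b` records whether the common vertex is the
source or the target. Germs forget the group element of a forward prickle because a fold at its
source may replace the morphism by an equivalent one. -/
theorem FoldPair.germ_eq {e₁ e₂ : Edge A k} {v v' : Vtx n k} {c : ∀ i, A i}
    (h : FoldPair e₁ e₂ v v' c) : ∃ b, orig (e₁, b) = orig (e₂, b) ∧
      germ (e₁, b) = germ (e₂, b) ∧ v = term (e₁, b) ∧ v' = term (e₂, b) := by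
  cases h with
  | prickle_src => exact ⟨true, rfl, rfl, rfl, rfl⟩
  | prickle_tgt => exact ⟨false, rfl, rfl, rfl, rfl⟩
  | petal_src => exact ⟨true, rfl, rfl, rfl, rfl⟩
  | petal_tgt => exact ⟨false, rfl, rfl, rfl, rfl⟩

/-! ### States that consist of a path attached to a folded thistle -/

open Classical in
/-- The prickle `i` of a folded thistle; that of the factor `δ` is attached at `v`. -/
noncomputable def prickleEdge (δ : Idx n k) (z : ∀ i, A i) (v : Vtx n k) (i : Fin n) : Edge A k :=
  ⟨if .inl i = δ then v else .base, .cone i, .prickle i (z i)⟩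

open Classical in
/-- The petal `j` of a folded thistle; that of the factor `δ` ends at `v`. -/
noncomputable def petalEdge (δ : Idx n k) (v : Vtx n k) (j : Fin k) : Edge A k :=
  ⟨.base, if .inr j = δ then v else .base, .petal j⟩

/-- The state that consists of a folded thistle and a path of darts to whose end the factor `δ` is
attached. -/
noncomputable def pathState (δ : Idx n k) (z : ∀ i, A i) (v : Vtx n k)
    (l : List (Edge A k × Bool)) : State A k where
  tree := {e | (∃ i, e = prickleEdge δ z (endV v l) i) ∨ ∃ d ∈ l, d.1 = e}
  mark j := (petalEdge δ (endV v l) j, true)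

/-- The edge belongs to the folded thistle. -/
def IsStar (δ : Idx n k) (z : ∀ i, A i) (v : Vtx n k) (e : Edge A k) : Prop :=
  (∃ i, e = prickleEdge δ z v i) ∨ ∃ j, e = petalEdge δ v j

theorem mem_edges_pathState {δ : Idx n k} {z : ∀ i, A i} {v : Vtx n k}
    {l : List (Edge A k × Bool)} {e : Edge A k} (b : Bool) :
    e ∈ (pathState δ z v l).edges ↔ IsStar δ z (endV v l) e ∨ OnPath l (e, b) := by
  rw [onPath_iff]
  simp only [State.edges, pathState, IsStar, Set.mem_union, Set.mem_ofPred_eq, Set.mem_range,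
    eq_comm (a := e)]
  exact or_right_comm

theorem IsStar.eq {δ : Idx n k} {z : ∀ i, A i} {v : Vtx n k} {e e' : Edge A k}
    (h : IsStar δ z v e) (h' : IsStar δ z v e') (hi : e.lab.idx = e'.lab.idx) : e = e' := by
  rcases h with ⟨i, rfl⟩ | ⟨i, rfl⟩ <;> rcases h' with ⟨i', rfl⟩ | ⟨i', rfl⟩ <;>
    simp_all [prickleEdge, petalEdge, Lab.idx]
  subst hi
  rfl

theorem not_free_base : ¬ (Vtx.base : Vtx n k).Free := fun h => h.1 rfl

theorem not_free_cone (i : Fin n) : ¬ (Vtx.cone i : Vtx n k).Free := fun h => h.2 i rfl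

/-- All edges of the folded thistle join the base point and the cone vertices, except for the edge
of `δ`, which is attached to the end of the path. -/
theorem IsStar.idx_of_free {δ : Idx n k} {z : ∀ i, A i} {v : Vtx n k} {e : Edge A k}
    (h : IsStar δ z v e) {b : Bool} (hf : (orig (e, b)).Free) : e.lab.idx = δ := by
  by_contra hne
  rcases h with ⟨i, rfl⟩ | ⟨i, rfl⟩ <;> cases b <;>
    simp_all [prickleEdge, petalEdge, Lab.idx, orig, not_free_base, not_free_cone]

/-- The path of darts avoids the factor `δ`, and passes through different vertices with
trivial group, after starting from a vertex of the folded thistle. -/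
structure PathOK (δ : Idx n k) (v : Vtx n k) (l : List (Edge A k × Bool)) : Prop where
  imm : ImmPath v l
  nodup : (l.map term).Nodup
  free : ∀ d ∈ l, (term d).Free
  idx : ∀ d ∈ l, d.1.lab.idx ≠ δ
  start : v = .base ∨ ∃ i, v = .cone i ∧ .inl i ≠ δ

namespace PathOK

variable {δ : Idx n k} {z : ∀ i, A i} {v : Vtx n k} {l : List (Edge A k × Bool)}

theorem start_not_free (h : PathOK δ v l) : ¬ v.Free := by
  rcases h.start with rfl | ⟨i, rfl, _⟩
  · exact not_free_base
  · exact not_free_cone i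

theorem not_mem (h : PathOK δ v l) : v ∉ l.map term := fun hv => by
  obtain ⟨d, hd, rfl⟩ := List.mem_map.1 hv
  exact h.start_not_free (h.free d hd)

theorem idx_ne (h : PathOK δ v l) {d : Edge A k × Bool} (hd : OnPath l d) :
    d.1.lab.idx ≠ δ := by
  rcases hd with hd | hd
  · exact h.idx d hd
  · exact h.idx (rev d) hd

/-- Every vertex of the path after the first is free, so a dart that leaves a vertex which is not
free leaves the start. -/
theorem head_of_not_free (h : PathOK δ v l) {d : Edge A k × Bool} (hd : OnPath l d)
    (hf : ¬ (orig d).Free) : ∃ tl, l = d :: tl := by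
  refine h.imm.head hd h.not_mem ?_
  rcases List.mem_cons.1 (h.imm.orig_mem hd) with e | e
  · exact e
  · obtain ⟨d', hd', e⟩ := List.mem_map.1 e
    exact absurd (e ▸ h.free d' hd') hf

theorem exists_free (h : PathOK δ v l) {e : Edge A k} {b : Bool} (hd : OnPath l (e, b)) :
    ∃ b, (orig (e, b)).Free := by
  rcases hd with hd | hd
  · refine ⟨!b, ?_⟩
    have := h.free _ hd
    rwa [← orig_rev] at this
  · have := h.free _ hd
    rw [term_rev] at this
    exact ⟨b, this⟩

theorem star_not_onPath (h : PathOK δ v l) {e : Edge A k} {b : Bool}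
    (hs : IsStar δ z (endV v l) e) (hd : OnPath l (e, b)) : False := by
  obtain ⟨b', hb⟩ := h.exists_free hd
  exact h.idx_ne hd (hs.idx_of_free hb)

/-- The first edge of the path is the only one that can be folded, and only with an edge of the
folded thistle. -/
theorem fold (h : PathOK δ v l) {e₁ e₂ : Edge A k} {v₁ v₂ : Vtx n k} {c : ∀ i, A i}
    (h₁ : e₁ ∈ (pathState δ z v l).edges) (h₂ : e₂ ∈ (pathState δ z v l).edges)
    (hf : FoldPair e₁ e₂ v₁ v₂ c) (hv : v₁.Free) (hne : v₁ ≠ v₂) :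
    ∃ b tl, l = (e₁, b) :: tl ∧ orig (e₂, b) = orig (e₁, b) ∧ germ (e₂, b) = germ (e₁, b) ∧
      v₁ = term (e₁, b) ∧ v₂ = term (e₂, b) ∧ IsStar δ z (endV v l) e₂ := by
  obtain ⟨b, ho, hg, rfl, rfl⟩ := hf.germ_eq
  have hi : e₁.lab.idx = e₂.lab.idx := by
    rw [← germ_idx (e₁, b), hg, germ_idx]
  -- The thistle has one edge over each factor, so two thistle edges do not fold. A thistle edge
  -- with a free end lies over `δ`, which the path avoids; so in a fold of a path edge with a
  -- thistle edge, the common vertex is not free and the path edge is the first one. Two path edges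
  -- are excluded by immersion.
  rcases (mem_edges_pathState b).1 h₁ with s₁ | p₁ <;>
    rcases (mem_edges_pathState b).1 h₂ with s₂ | p₂
  · exact absurd (by rw [s₁.eq s₂ hi]) hne
  · rw [← orig_rev] at hv
    exact absurd (hi ▸ s₁.idx_of_free hv) (h.idx_ne p₂)
  · by_cases hof : (orig (e₁, b)).Free
    · exact absurd (hi.trans (s₂.idx_of_free (ho ▸ hof))) (h.idx_ne p₁)
    · obtain ⟨tl, e⟩ := h.head_of_not_free p₁ hof
      exact ⟨b, tl, e, ho.symm, hg.symm, rfl, rfl, s₂⟩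
  · have hn : (v :: l.map term).Nodup := List.nodup_cons.2 ⟨h.not_mem, h.nodup⟩
    exact absurd (by rw [h.imm.eq_of_germ hn p₁ p₂ ho hg]) hne

end PathOK

theorem endV_cons_mem (v : Vtx n k) (d : Edge A k × Bool) (l : List (Edge A k × Bool)) :
    endV v (d :: l) ∈ (d :: l).map term := by
  induction l generalizing v d with
  | nil => simp [endV]
  | cons d' l ih =>
    rw [endV]
    exact List.mem_cons_of_mem _ (ih _ d')

theorem endV_free {δ : Idx n k} {v : Vtx n k} {d : Edge A k × Bool}
    {l : List (Edge A k × Bool)} (h : PathOK δ v (d :: l)) : (endV v (d :: l)).Free := by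
  obtain ⟨d', hd', e⟩ := List.mem_map.1 (endV_cons_mem v d l)
  exact e ▸ h.free d' hd'

/-! ### The part of the tree beyond the first edge, and the graph after folding it -/

/-- The vertices of the folded thistle, except for that of the factor `δ`. -/
def Near (δ : Idx n k) (v : Vtx n k) : Prop := v = .base ∨ ∃ i, v = .cone i ∧ .inl i ≠ δ

theorem Near.not_free {δ : Idx n k} {v : Vtx n k} (h : Near δ v) : ¬ v.Free := by
  rcases h with rfl | ⟨i, rfl, _⟩
  · exact not_free_base
  · exact not_free_cone i

/-- Without its first edge the arc, together with the factor `δ` at its end, is cut off from the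
rest of the thistle. Names of vertices that do not occur in the graph also count as beyond; they do
no harm, since only cone vertices and ends of marked edges are ever tested. -/
theorem beyond_pathState {δ : Idx n k} {z : ∀ i, A i} {v : Vtx n k} {d : Edge A k × Bool}
    {l : List (Edge A k × Bool)} (h : PathOK δ v (d :: l)) :
    beyond (pathState δ z v (d :: l)).tree d.1 = {x | ¬ Near δ x} := by
  ext x
  rw [beyond, Set.mem_ofPred_eq, Set.mem_ofPred_eq, not_iff_not]
  have hend := endV_free h
  constructor
  · intro hx
    -- No remaining tree edge joins a near vertex to one that is not near. The prickle of `δ`, if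
    -- there is one, hangs on the free end of the arc, and the other arc edges have two free ends.
    have key : ∀ x y, Joined ((pathState δ z v (d :: l)).tree \ {d.1}) x y →
        (Near δ x ↔ Near δ y) := by
      intro x y hxy
      induction hxy with
      | rel x y hxy =>
        obtain ⟨e, ⟨he, hne⟩, rfl, rfl⟩ := hxy
        rcases he with ⟨i, rfl⟩ | ⟨d', hd', rfl⟩
        · by_cases hi : .inl i = δ
          · have h1 : ¬ Near δ (endV v (d :: l)) := fun hN => hN.not_free hend
            have h2 : ¬ Near δ (.cone i) := by
              rintro (h | ⟨i', h, hi'⟩)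
              · cases h
              · cases h; exact hi' hi
            simp [prickleEdge, hi, h1, h2]
          · have h1 : Near δ .base := .inl rfl
            have h2 : Near δ (.cone i) := .inr ⟨i, rfl, hi⟩
            simp [prickleEdge, hi, h1, h2]
        · have hd : d' ∈ l := by
            rcases List.mem_cons.1 hd' with rfl | hd
            · exact absurd rfl hne
            · exact hd
          have hfree : ∀ x ∈ (d :: l).map term, x.Free := by
            intro x hx
            obtain ⟨d', hd', rfl⟩ := List.mem_map.1 hx
            exact h.free d' hd'
          have h1 := hfree _ (h.imm.2.2.orig_mem (.inl hd))
          have h2 := h.free d' hd'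
          have h3 : ¬ Near δ (orig d') := fun hN => hN.not_free h1
          have h4 : ¬ Near δ (term d') := fun hN => hN.not_free h2
          rcases d' with ⟨e, _ | _⟩
          · exact iff_of_false h4 h3
          · exact iff_of_false h3 h4
      | refl => rfl
      | symm _ _ _ ih => exact ih.symm
      | trans _ _ _ _ _ ih₁ ih₂ => exact ih₁.trans ih₂
    exact (key _ _ hx).1 (.inl rfl)
  · rintro (rfl | ⟨i, rfl, hi⟩)
    · exact .refl _
    · refine .rel _ _ ⟨prickleEdge δ z (endV v (d :: l)) i, ⟨.inl ⟨i, rfl⟩, ?_⟩, ?_, rfl⟩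
      · intro e
        obtain ⟨b, hb⟩ := h.exists_free (e := d.1) (b := d.2) (.inl List.mem_cons_self)
        rw [← Set.mem_singleton_iff.1 e] at hb
        cases b <;> simp [prickleEdge, orig, hi, not_free_base, not_free_cone] at hb
      · simp [prickleEdge, hi]

/-! ### The effect of folding the first edge of the path -/

open Classical in
/-- The effect on a dart of identifying two vertices. -/
noncomputable def mergeDart (v v' : Vtx n k) (c : ∀ i, A i) (d : Edge A k × Bool) :
    Edge A k × Bool := (Edge.merge v v' c d.1, d.2)

open Classical in
theorem term_mergeDart (v v' : Vtx n k) (c : ∀ i, A i) (d : Edge A k × Bool) :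
    term (mergeDart v v' c d) = if term d = v then v' else term d := by
  rcases d with ⟨e, _ | _⟩ <;> rfl

open Classical in
theorem endV_map_mergeDart (v v' x : Vtx n k) (c : ∀ i, A i) (l : List (Edge A k × Bool)) :
    endV (if x = v then v' else x) (l.map (mergeDart v v' c)) =
      if endV x l = v then v' else endV x l := by
  induction l generalizing x with
  | nil => rfl
  | cons d l ih => rw [List.map_cons, endV, endV, term_mergeDart, ih]

theorem merge_prickleEdge {δ : Idx n k} {z : ∀ i, A i} {v v' x : Vtx n k} {c : ∀ i, A i}
    (hv : v.Free) (i : Fin n) :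
    (prickleEdge δ z x i).merge v v' c =
      prickleEdge δ z (open Classical in if x = v then v' else x) i := by
  have h1 : Vtx.base ≠ v := fun e => not_free_base (e ▸ hv)
  have h2 : Vtx.cone i ≠ v := fun e => not_free_cone i (e ▸ hv)
  by_cases h : .inl i = δ
  · simp only [prickleEdge, if_pos h]
    simp [Edge.merge, h2]
  · simp only [prickleEdge, if_neg h]
    simp [Edge.merge, h1, h2]

theorem merge_petalEdge {δ : Idx n k} {v v' x : Vtx n k} {c : ∀ i, A i}
    (hv : v.Free) (j : Fin k) :
    (petalEdge δ x j : Edge A k).merge v v' c =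
      petalEdge δ (open Classical in if x = v then v' else x) j := by
  have h1 : Vtx.base ≠ v := fun e => not_free_base (e ▸ hv)
  by_cases h : .inr j = δ
  · simp only [petalEdge, if_pos h]
    simp [Edge.merge, h1]
  · simp only [petalEdge, if_neg h]
    simp [Edge.merge, h1]

/-- The case that matters is a path consisting of `d` alone: then the factor `δ` is reattached at
`v'` by the fold. -/
theorem endV_fold {v v' x : Vtx n k} {c : ∀ i, A i} {d : Edge A k × Bool}
    {l : List (Edge A k × Bool)} (hd : term d = v) :
    endV v' (l.map (mergeDart v v' c)) =
      open Classical in if endV x (d :: l) = v then v' else endV x (d :: l) := by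
  have := endV_map_mergeDart v v' (term d) c l
  rw [if_pos hd] at this
  exact this

theorem merge_marks {δ : Idx n k} {z : ∀ i, A i} {v v' x : Vtx n k} {c : ∀ i, A i}
    {d : Edge A k × Bool} {l : List (Edge A k × Bool)} (hv : v.Free) (hd : term d = v) :
    (fun j => (Edge.merge v v' c ((pathState δ z x (d :: l)).mark j).1,
      ((pathState δ z x (d :: l)).mark j).2)) =
      (pathState δ z v' (l.map (mergeDart v v' c))).mark := by
  funext j
  simp only [pathState, merge_petalEdge hv, endV_fold (x := x) hd]

/-- In a fold of two tree edges the first edge of the path lands on a prickle of the thistle, so it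
disappears from the path without being removed from the tree. -/
theorem merge_tree {δ : Idx n k} {z : ∀ i, A i} {v v' x : Vtx n k} {c : ∀ i, A i}
    {d : Edge A k × Bool} {l : List (Edge A k × Bool)} (hv : v.Free) (hd : term d = v)
    (hm : ∃ i, .inl i ≠ δ ∧ d.1.merge v v' c = ⟨.base, .cone i, .prickle i (z i)⟩) :
    Edge.merge v v' c '' (pathState δ z x (d :: l)).tree =
      (pathState δ z v' (l.map (mergeDart v v' c))).tree := by
  ext e
  simp only [pathState, Set.mem_image, Set.mem_ofPred_eq, endV_fold (x := x) hd]
  constructor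
  · rintro ⟨e', ⟨i, rfl⟩ | ⟨d', hd', rfl⟩, rfl⟩
    · exact .inl ⟨i, merge_prickleEdge hv i⟩
    · rcases List.mem_cons.1 hd' with rfl | hd'
      · obtain ⟨i, hi, e⟩ := hm
        exact .inl ⟨i, by simp [e, prickleEdge, hi]⟩
      · exact .inr ⟨_, List.mem_map_of_mem hd', rfl⟩
  · rintro (⟨i, rfl⟩ | ⟨d', hd', rfl⟩)
    · exact ⟨_, .inl ⟨i, rfl⟩, merge_prickleEdge hv i⟩
    · obtain ⟨d', hm', rfl⟩ := List.mem_map.1 hd'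
      exact ⟨_, .inr ⟨d', List.mem_cons_of_mem _ hm', rfl⟩, rfl⟩

theorem PathOK.head_not_mem_tail {δ : Idx n k} {v : Vtx n k} {d : Edge A k × Bool}
    {l : List (Edge A k × Bool)} (h : PathOK δ v (d :: l)) : ¬ ∃ d' ∈ l, d'.1 = d.1 := by
  intro hd
  have h1 := h.imm.2.2.orig_mem ((onPath_iff (l := l) (e := d.1) d.2).2 hd)
  have h2 : v ∈ (d :: l).map term := h.imm.1 ▸ h1
  exact h.not_mem h2

theorem tree_diff_head {δ : Idx n k} {z : ∀ i, A i} {v : Vtx n k} {d : Edge A k × Bool}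
    {l : List (Edge A k × Bool)} (h : PathOK δ v (d :: l)) :
    (pathState δ z v (d :: l)).tree \ {d.1} =
      {e | (∃ i, e = prickleEdge δ z (endV v (d :: l)) i) ∨ ∃ d' ∈ l, d'.1 = e} := by
  ext e
  simp only [pathState, Set.mem_sdiff, Set.mem_ofPred_eq, Set.mem_singleton_iff, List.mem_cons,
    exists_eq_or_imp]
  constructor
  · rintro ⟨h1 | rfl | h1, h2⟩
    · exact .inl h1
    · exact absurd rfl h2
    · exact .inr h1
  · rintro (h1 | h1)
    · refine ⟨.inl h1, ?_⟩
      rintro rfl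
      exact h.star_not_onPath (z := z) (.inl h1) ((onPath_iff true).2 ⟨d, List.mem_cons_self, rfl⟩)
    · refine ⟨.inr (.inr h1), ?_⟩
      rintro rfl
      exact h.head_not_mem_tail h1

/-- In a fold across a loop the first edge of the path lands on a marked petal, which lies outside
the tree; it is therefore removed from the tree before the vertices are identified. -/
theorem merge_tree_diff {δ : Idx n k} {z : ∀ i, A i} {v v' x : Vtx n k} {c : ∀ i, A i}
    {d : Edge A k × Bool} {l : List (Edge A k × Bool)} (hv : v.Free) (hd : term d = v)
    (h : PathOK δ x (d :: l)) :
    Edge.merge v v' c '' ((pathState δ z x (d :: l)).tree \ {d.1}) =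
      (pathState δ z v' (l.map (mergeDart v v' c))).tree := by
  rw [tree_diff_head h]
  ext e
  simp only [pathState, Set.mem_image, Set.mem_ofPred_eq, endV_fold (x := x) hd]
  constructor
  · rintro ⟨e', ⟨i, rfl⟩ | ⟨d', hd', rfl⟩, rfl⟩
    · exact .inl ⟨i, merge_prickleEdge hv i⟩
    · exact .inr ⟨_, List.mem_map_of_mem hd', rfl⟩
  · rintro (⟨i, rfl⟩ | ⟨d', hd', rfl⟩)
    · exact ⟨_, .inl ⟨i, rfl⟩, merge_prickleEdge hv i⟩
    · obtain ⟨d', hm', rfl⟩ := List.mem_map.1 hd'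
      exact ⟨_, .inr ⟨d', hm', rfl⟩, rfl⟩

end PathStates

section Moves

variable {n k : ℕ} {A : Fin n → Type u} [∀ i, Group (A i)]

/-! ### The unique step from a state that consists of a path -/

/-- The word by which an element `h` of the factor `i` acts on the factor `δ`. -/
noncomputable def blockWord (D : FactorData A) (δ i : Idx n k) (h : Factor A k i) :
    List (MulAut (FreeProd A k)) :=
  whitehead D i h {l | .inl l = δ} ∅ {j | .inr j = δ}

/-- Of all cone vertices and ends of marked edges, only the cone vertex of `δ`, or the end of the
petal `δ`, lies beyond the first edge. All petals start at the base point, so left multiplications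
never occur. -/
theorem whitehead_pathState (D : FactorData A) {δ : Idx n k} {z : ∀ i, A i} {v : Vtx n k}
    {d : Edge A k × Bool} {l : List (Edge A k × Bool)} (h : PathOK δ v (d :: l)) (i : Idx n k)
    (g : Factor A k i) :
    (pathState δ z v (d :: l)).whitehead D i g (beyond (pathState δ z v (d :: l)).tree d.1) =
      blockWord D δ i g := by
  have hend := endV_free h
  rw [beyond_pathState h, State.whitehead, blockWord]
  congr 1
  · ext l
    simp only [Set.mem_ofPred_eq, Near, reduceCtorEq, false_or, Vtx.cone.injEq, ne_eq,
      not_exists, not_and, not_not]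
    exact ⟨fun h => h l rfl, by rintro h _ rfl; exact h⟩
  · ext j
    simp [pathState, orig, petalEdge, Near]
  · ext j
    by_cases hj : .inr j = δ
    · have : ¬ Near δ (endV v (d :: l)) := fun hN => hN.not_free hend
      simp [pathState, term, petalEdge, hj, this]
    · simp [pathState, term, petalEdge, hj, Near]

theorem prickleEdge_of_ne {δ : Idx n k} {z : ∀ i, A i} {v : Vtx n k} {i : Fin n}
    (h : .inl i ≠ δ) :
    (prickleEdge δ z v i : Edge A k) = ⟨.base, .cone i, .prickle i (z i)⟩ := by
  rw [prickleEdge, if_neg h]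

theorem petalEdge_of_ne {δ : Idx n k} {v : Vtx n k} {j : Fin k} (h : .inr j ≠ δ) :
    (petalEdge δ v j : Edge A k) = ⟨.base, .base, .petal j⟩ := by
  rw [petalEdge, if_neg h]

theorem mem_edges_of_mem_tree {s : State A k} {e : Edge A k} (h : e ∈ s.tree) : e ∈ s.edges :=
  .inl h

theorem petal_mem_tree {δ : Idx n k} {z : ∀ i, A i} {v x y : Vtx n k} {j : Fin k}
    {l : List (Edge A k × Bool)} (b : Bool)
    (h : ⟨x, y, .petal j⟩ ∈ (pathState δ z v l).tree) : OnPath l (⟨x, y, .petal j⟩, b) := by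
  rcases h with ⟨i, h⟩ | h
  · simp [prickleEdge] at h
  · exact (onPath_iff b).2 h

theorem PathOK.mem_beyond {δ : Idx n k} {z : ∀ i, A i} {v : Vtx n k}
    {d : Edge A k × Bool} {l : List (Edge A k × Bool)} (h : PathOK δ v (d :: l)) :
    term d ∈ beyond (pathState δ z v (d :: l)).tree d.1 := by
  rw [beyond_pathState h]
  exact fun hN => hN.not_free (h.free d List.mem_cons_self)

/-- Only tree edges that lead away from the base point may be twisted. The thistle's own prickle at
a cone vertex visited by the path leads towards the base point, so only the first edge of the path
qualifies, and the only other group element available there is that of the thistle. -/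
theorem twist_cases {δ : Idx n k} {z : ∀ i, A i} {v : Vtx n k} {l : List (Edge A k × Bool)}
    (h : PathOK δ v l) {i : Fin n} {x x' : Vtx n k} {a a' : A i}
    (h₁ : ⟨x, .cone i, .prickle i a⟩ ∈ (pathState δ z v l).tree)
    (h₂ : ⟨x', .cone i, .prickle i a'⟩ ∈ (pathState δ z v l).edges) (hne : a ≠ a')
    (hx : x ∈ beyond (pathState δ z v l).tree ⟨x, .cone i, .prickle i a⟩) :
    (∃ tl, l = (⟨x, .cone i, .prickle i a⟩, false) :: tl) ∧ a' = z i := by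
  have key : ∀ {x : Vtx n k} {a : A i}, OnPath l (⟨x, .cone i, .prickle i a⟩, false) →
      ∃ tl, l = (⟨x, .cone i, .prickle i a⟩, false) :: tl :=
    fun h' => h.head_of_not_free h' (not_free_cone i)
  have hstar : ∀ {x : Vtx n k} {a : A i},
      IsStar δ z (endV v l) ⟨x, .cone i, .prickle i a⟩ → a = z i := by
    intro x a hs
    have := hs.eq (.inl ⟨i, rfl⟩) (e' := prickleEdge δ z (endV v l) i) rfl
    simp only [prickleEdge, Edge.mk.injEq, Lab.prickle.injEq, heq_eq_eq, true_and] at this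
    exact this.2
  rcases (mem_edges_pathState false).1 (mem_edges_of_mem_tree h₁) with s₁ | p₁
  · exfalso
    rcases (mem_edges_pathState false).1 h₂ with s₂ | p₂
    · exact hne ((hstar s₁).trans (hstar s₂).symm)
    · have hi : .inl i ≠ δ := h.idx_ne p₂
      have := s₁.eq (.inl ⟨i, rfl⟩) (e' := prickleEdge δ z (endV v l) i) rfl
      rw [prickleEdge_of_ne hi] at this
      obtain rfl : x = .base := congrArg Edge.src this
      exact hx (.refl _)
  · obtain ⟨tl, e⟩ := key p₁
    refine ⟨⟨tl, e⟩, ?_⟩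
    rcases (mem_edges_pathState false).1 h₂ with s₂ | p₂
    · exact hstar s₂
    · obtain ⟨tl', e'⟩ := key p₂
      rw [e] at e'
      simp at e'
      exact absurd e'.1.2 hne

theorem loop_mark {δ : Idx n k} {z : ∀ i, A i} {v w : Vtx n k} {l : List (Edge A k × Bool)}
    {j p : Fin k} {b : Bool} (h : (pathState δ z v l).mark j = (⟨w, w, .petal p⟩, b)) :
    w = .base ∧ p = j ∧ b = true := by
  simp only [pathState, petalEdge, Prod.mk.injEq, Edge.mk.injEq, Lab.petal.injEq] at h
  exact ⟨h.1.1.symm, h.1.2.2.symm, h.2.symm⟩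

/-- Every possible step acts on the first edge of the path, in one of three ways: a fold with a
thistle edge in the tree, a twist at a cone vertex, or a fold across a marked petal. The two
remaining kinds cannot occur, since the marked edges are petals and the only marked edge that may
fail to be a loop lies over `δ`. -/
theorem move_cases {D : FactorData A} {δ : Idx n k} {z : ∀ i, A i} {v : Vtx n k}
    {l : List (Edge A k × Bool)} (h : PathOK δ v l) {r : ℕ} {w : List (MulAut (FreeProd A k))}
    {s' : State A k} (hm : Move D (pathState δ z v l) r w s') :
    (∃ e b tl e₂ v₁ v₂ c, l = (e, b) :: tl ∧ FoldPair e e₂ v₁ v₂ c ∧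
      e₂ ∈ (pathState δ z v l).tree ∧ IsStar δ z (endV v l) e₂ ∧ germ (e₂, b) = germ (e, b) ∧
      v₁.Free ∧ r = 0 ∧ w = [] ∧
      s' = ⟨Edge.merge v₁ v₂ c '' (pathState δ z v l).tree, fun j =>
        (Edge.merge v₁ v₂ c ((pathState δ z v l).mark j).1, ((pathState δ z v l).mark j).2)⟩) ∨
    (∃ x i, ∃ a : A i, ∃ tl, l = (⟨x, .cone i, .prickle i a⟩, false) :: tl ∧ a ≠ z i ∧
      r = i + 1 ∧ w = blockWord D δ (.inl i) ((z i)⁻¹ * a : A i) ∧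
      s' = ⟨insert ⟨x, .cone i, .prickle i (z i)⟩
        ((pathState δ z v l).tree \ {⟨x, .cone i, .prickle i a⟩}), (pathState δ z v l).mark⟩) ∨
    (∃ y j b tl, l = (if b then ⟨.base, y, .petal j⟩ else ⟨y, .base, .petal j⟩, b) :: tl ∧
      r = n + j + 1 ∧ w = blockWord D δ (.inr j) (xpow j !b) ∧
      s' = pathState δ z .base (tl.map (mergeDart y .base 1))) := by
  cases hm with
  | treeFold e₁ e₂ v₁ v₂ c h₁ h₂ hf hv hne =>
    obtain ⟨b, tl, e, -, hg, -, -, hs⟩ :=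
      h.fold (mem_edges_of_mem_tree h₁) (mem_edges_of_mem_tree h₂) hf hv hne
    exact .inl ⟨e₁, b, tl, e₂, v₁, v₂, c, e, hf, h₂, hs, hg, hv, rfl, rfl, rfl⟩
  | twistTree i x x' a a' h₁ h₂ hne hx =>
    obtain ⟨⟨tl, e⟩, rfl⟩ := twist_cases h h₁ h₂ hne hx
    subst e
    exact .inr (.inl ⟨x, i, a, tl, rfl, hne, rfl, whitehead_pathState D h _ _, rfl⟩)
  | twistMark i j b x x' a a' h₁ h₂ hne =>
    simp [pathState, petalEdge] at h₁
  | loopFoldSrc j p b w y v₁ v₂ h₁ h₂ hy hv hvv =>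
    obtain ⟨rfl, rfl, rfl⟩ := loop_mark h₁
    obtain ⟨tl, rfl⟩ := h.head_of_not_free (petal_mem_tree true h₂) not_free_base
    obtain ⟨rfl, rfl⟩ : v₁ = y ∧ v₂ = .base := by
      rcases hvv with e | ⟨rfl, _⟩
      · exact e
      · exact absurd hv not_free_base
    have hb := h.mem_beyond (z := z)
    refine .inr (.inr ⟨v₁, p, true, tl, rfl, rfl, ?_, ?_⟩)
    · rw [whitehead_pathState D h]
      congr 2
      exact if_pos hb
    · rw [merge_marks hv rfl, merge_tree_diff hv rfl h]
  | loopFoldTgt j p b w y v₁ v₂ h₁ h₂ hy hv hvv =>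
    obtain ⟨rfl, rfl, rfl⟩ := loop_mark h₁
    obtain ⟨tl, rfl⟩ := h.head_of_not_free (petal_mem_tree false h₂) not_free_base
    obtain ⟨rfl, rfl⟩ : v₁ = y ∧ v₂ = .base := by
      rcases hvv with e | ⟨rfl, _⟩
      · exact e
      · exact absurd hv not_free_base
    have hb := h.mem_beyond (z := z)
    refine .inr (.inr ⟨v₁, p, false, tl, rfl, rfl, ?_, ?_⟩)
    · rw [whitehead_pathState D h]
      congr 2
      exact if_pos hb
    · rw [merge_marks hv rfl, merge_tree_diff hv rfl h]
  | treeChange j e₂ e' b' v₁ v₂ c hloop h₂ hf hne h' ho hsep =>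
    exfalso
    -- A marked edge that is not a loop is the petal of `δ`. No other edge lies over `δ`, in the
    -- thistle or on the path, so it has no partner for a fold.
    have hj : .inr j = δ := by
      by_contra hj
      exact hloop (by simp [pathState, petalEdge, hj])
    obtain ⟨b, -, hg, rfl, rfl⟩ := hf.germ_eq
    have hi : ((pathState δ z v l).mark j).1.lab.idx = e₂.lab.idx := by
      rw [← germ_idx (_, b), hg, germ_idx]
    have hs : IsStar δ z (endV v l) ((pathState δ z v l).mark j).1 := .inr ⟨j, rfl⟩
    rcases (mem_edges_pathState true).1 h₂ with s₂ | p₂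
    · exact hne (by rw [hs.eq s₂ hi])
    · exact h.idx_ne p₂ (hi.symm.trans hj)

/-- A step is uniquely determined by the state. -/
def UniqueMove (D : FactorData A) (s : State A k) (w : List (MulAut (FreeProd A k)))
    (s' : State A k) : Prop :=
  ∃ r, ∀ r₁ w₁ s₁, Move D s r₁ w₁ s₁ ↔ r₁ = r ∧ w₁ = w ∧ s₁ = s'

/-- With a single available step the minimality of its rank holds automatically. -/
theorem UniqueMove.folds {D : FactorData A} {s s' s'' : State A k}
    {w w' : List (MulAut (FreeProd A k))} (h : UniqueMove D s w s') (hf : Folds D s' w' s'') :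
    Folds D s (w' ++ w) s'' := by
  obtain ⟨r, hr⟩ := h
  exact .step s s' s'' r w w' ((hr _ _ _).2 ⟨rfl, rfl, rfl⟩)
    (fun r' w₁ s₁ hm => ((hr _ _ _).1 hm).1.ge) hf

theorem UniqueMove.folds_inv {D : FactorData A} {s s' s'' : State A k}
    {w w' : List (MulAut (FreeProd A k))} (h : UniqueMove D s w s') (hf : Folds D s w' s'')
    (ht : s''.Terminal D) : ∃ w₁, w' = w₁ ++ w ∧ Folds D s' w₁ s'' := by
  obtain ⟨r, hr⟩ := h
  cases hf with
  | refl => exact absurd ((hr _ _ _).2 ⟨rfl, rfl, rfl⟩) (ht _ _ _)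
  | step _ s₁ _ r₁ w₁ w₂ hm _ h =>
    obtain ⟨-, rfl, rfl⟩ := (hr _ _ _).1 hm
    exact ⟨w₂, rfl, h⟩

theorem IsStar.eq_prickleEdge {δ : Idx n k} {z : ∀ i, A i} {v : Vtx n k} {e : Edge A k}
    {i : Fin n} (h : IsStar δ z v e) (hi : e.lab.idx = .inl i) (hδ : .inl i ≠ δ) :
    e = ⟨.base, .cone i, .prickle i (z i)⟩ := by
  rw [← prickleEdge_of_ne (k := k) hδ (v := v)]
  exact h.eq (.inl ⟨i, rfl⟩) hi

/-- The forward half of a prickle letter folds onto the thistle's prickle. This makes the tip the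
cone vertex and transfers the factor `p⁻¹ * z i` to the edge by which the path returns. -/
theorem uniqueMove_tip (D : FactorData A) {δ : Idx n k} {z : ∀ i, A i} {t : Vtx n k} {i : Fin n}
    {p : A i} {tl : List (Edge A k × Bool)}
    (h : PathOK δ .base ((⟨.base, t, .prickle i p⟩, true) :: tl)) :
    UniqueMove D (pathState δ z .base ((⟨.base, t, .prickle i p⟩, true) :: tl)) []
      (pathState δ z (.cone i)
        (tl.map (mergeDart t (.cone i) (Pi.mulSingle i (p⁻¹ * z i))))) := by
  have ht : t.Free := h.free _ List.mem_cons_self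
  have hi : .inl i ≠ δ := h.idx _ List.mem_cons_self
  have hmerge : (⟨Edge.merge t (.cone i) (Pi.mulSingle i (p⁻¹ * z i)) ''
        (pathState δ z .base ((⟨.base, t, .prickle i p⟩, true) :: tl)).tree, fun j =>
        (Edge.merge t (.cone i) (Pi.mulSingle i (p⁻¹ * z i))
          ((pathState δ z .base ((⟨.base, t, .prickle i p⟩, true) :: tl)).mark j).1,
          ((pathState δ z .base ((⟨.base, t, .prickle i p⟩, true) :: tl)).mark j).2)⟩ :
        State A k) = pathState δ z (.cone i)
        (tl.map (mergeDart t (.cone i) (Pi.mulSingle i (p⁻¹ * z i)))) := by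
    rw [merge_marks ht rfl, merge_tree ht rfl ⟨i, hi, ?_⟩]
    have h1 : Vtx.base ≠ t := fun e => not_free_base (e ▸ ht)
    simp [Edge.merge, h1]
  refine ⟨0, fun r w s' => ⟨fun hm => ?_, ?_⟩⟩
  · rcases move_cases h hm with ⟨e, b, tl', e₂, v₁, v₂, c, e1, hf, -, hs, hg, hv, rfl, rfl, rfl⟩ |
      ⟨x, i', a, tl', e1, -⟩ | ⟨y, j, b, tl', e1, -⟩
    · obtain ⟨⟨rfl, rfl⟩, rfl⟩ : (_ ∧ _) ∧ _ := by simpa using e1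
      have h2 : e₂.lab.idx = .inl i := by rw [← germ_idx (e₂, true), hg, germ_idx]; rfl
      obtain rfl := hs.eq_prickleEdge h2 hi
      refine ⟨rfl, rfl, ?_⟩
      cases hf with
      | prickle_src => exact hmerge
      | prickle_tgt => exact absurd hv not_free_base
    · simp at e1
    · cases b <;> simp at e1
  · rintro ⟨rfl, rfl, rfl⟩
    rw [← hmerge]
    refine .treeFold _ ⟨.base, t, .prickle i p⟩ ⟨.base, .cone i, .prickle i (z i)⟩ _ _ _
      (.inr ⟨_, List.mem_cons_self, rfl⟩) (.inl ⟨i, (prickleEdge_of_ne hi).symm⟩)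
      (.prickle_src _ _ _ _ _ _) ht ?_
    rintro rfl
    exact not_free_cone i ht

/-- At the cone vertex the two edges carry different elements of `A_i`, so they do not fold
directly. The twist makes them agree, and it is the only contribution of a prickle letter. -/
theorem uniqueMove_twist (D : FactorData A) {δ : Idx n k} {z : ∀ i, A i} {x : Vtx n k} {i : Fin n}
    {a : A i} {tl : List (Edge A k × Bool)} (ha : a ≠ z i)
    (h : PathOK δ (.cone i) ((⟨x, .cone i, .prickle i a⟩, false) :: tl)) :
    UniqueMove D (pathState δ z (.cone i) ((⟨x, .cone i, .prickle i a⟩, false) :: tl))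
      (blockWord D δ (.inl i) ((z i)⁻¹ * a : A i))
      (pathState δ z (.cone i) ((⟨x, .cone i, .prickle i (z i)⟩, false) :: tl)) := by
  have hi : .inl i ≠ δ := h.idx _ List.mem_cons_self
  have hst : (⟨insert ⟨x, .cone i, .prickle i (z i)⟩
        ((pathState δ z (.cone i) ((⟨x, .cone i, .prickle i a⟩, false) :: tl)).tree \
          {⟨x, .cone i, .prickle i a⟩}),
        (pathState δ z (.cone i) ((⟨x, .cone i, .prickle i a⟩, false) :: tl)).mark⟩ :
        State A k) =
      pathState δ z (.cone i) ((⟨x, .cone i, .prickle i (z i)⟩, false) :: tl) := by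
    have h1 := tree_diff_head (z := z) h
    dsimp only at h1
    rw [h1]
    simp only [pathState, State.mk.injEq]
    refine ⟨?_, rfl⟩
    ext e
    simp only [Set.mem_insert_iff, Set.mem_ofPred_eq, List.mem_cons, exists_eq_or_imp,
      eq_comm (a := e), endV, term]
    exact or_left_comm
  refine ⟨i + 1, fun r w s' => ⟨fun hm => ?_, ?_⟩⟩
  · rcases move_cases h hm with ⟨e, b, tl', e₂, v₁, v₂, c, e1, hf, -, hs, hg, hv, rfl, rfl, rfl⟩ |
      ⟨x', i', a', tl', e1, -, rfl, rfl, rfl⟩ | ⟨y, j, b, tl', e1, -⟩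
    · obtain ⟨⟨rfl, rfl⟩, rfl⟩ : (_ ∧ _) ∧ _ := by simpa using e1
      have h2 : e₂.lab.idx = .inl i := by rw [← germ_idx (e₂, false), hg, germ_idx]; rfl
      obtain rfl := hs.eq_prickleEdge h2 hi
      simp [germ] at hg
      exact absurd hg.symm ha
    · obtain ⟨⟨rfl, rfl, -, e⟩, rfl⟩ : (x = x' ∧ i = i' ∧ i = i' ∧ a ≍ a') ∧ tl = tl' := by
        simpa using e1
      obtain rfl := eq_of_heq e
      exact ⟨rfl, rfl, hst⟩
    · cases b <;> simp at e1
  · rintro ⟨rfl, rfl, rfl⟩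
    rw [← hst]
    have hw := whitehead_pathState D (z := z) h (.inl i) ((z i)⁻¹ * a : A i)
    exact (congrArg (fun w => Move D _ (i + 1) w _) hw).mp <|
      .twistTree _ i x .base a (z i) (.inr ⟨_, List.mem_cons_self, rfl⟩)
        (.inl (.inl ⟨i, (prickleEdge_of_ne hi).symm⟩)) ha h.mem_beyond

/-- Once the group elements agree, no twist is left and the returning edge folds onto the thistle's
prickle, which brings the start of the path back to the base point. -/
theorem uniqueMove_cone (D : FactorData A) {δ : Idx n k} {z : ∀ i, A i} {x : Vtx n k} {i : Fin n}
    {tl : List (Edge A k × Bool)}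
    (h : PathOK δ (.cone i) ((⟨x, .cone i, .prickle i (z i)⟩, false) :: tl)) :
    UniqueMove D (pathState δ z (.cone i) ((⟨x, .cone i, .prickle i (z i)⟩, false) :: tl)) []
      (pathState δ z .base (tl.map (mergeDart x .base 1))) := by
  have hx : x.Free := h.free _ List.mem_cons_self
  have hi : .inl i ≠ δ := h.idx _ List.mem_cons_self
  have hmerge : (⟨Edge.merge x .base 1 '' (pathState δ z (.cone i)
          ((⟨x, .cone i, .prickle i (z i)⟩, false) :: tl)).tree, fun j =>
        (Edge.merge x .base 1 ((pathState δ z (.cone i)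
            ((⟨x, .cone i, .prickle i (z i)⟩, false) :: tl)).mark j).1,
          ((pathState δ z (.cone i)
            ((⟨x, .cone i, .prickle i (z i)⟩, false) :: tl)).mark j).2)⟩ :
        State A k) = pathState δ z .base (tl.map (mergeDart x .base 1)) := by
    rw [merge_marks hx rfl, merge_tree hx rfl ⟨i, hi, ?_⟩]
    have h1 : Vtx.cone i ≠ x := fun e => not_free_cone i (e ▸ hx)
    simp [Edge.merge, h1]
  refine ⟨0, fun r w s' => ⟨fun hm => ?_, ?_⟩⟩
  · rcases move_cases h hm with ⟨e, b, tl', e₂, v₁, v₂, c, e1, hf, -, hs, hg, hv, rfl, rfl, rfl⟩ |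
      ⟨x', i', a', tl', e1, ha, -⟩ | ⟨y, j, b, tl', e1, -⟩
    · obtain ⟨⟨rfl, rfl⟩, rfl⟩ : (_ ∧ _) ∧ _ := by simpa using e1
      have h2 : e₂.lab.idx = .inl i := by rw [← germ_idx (e₂, false), hg, germ_idx]; rfl
      obtain rfl := hs.eq_prickleEdge h2 hi
      obtain ⟨rfl, rfl, rfl⟩ : v₁ = x ∧ v₂ = .base ∧ c = 1 := by
        clear hmerge hg hs hm e1 h
        generalize z i = y at hf
        cases hf with
        | prickle_src => exact absurd hv (not_free_cone i)
        | prickle_tgt => exact ⟨rfl, rfl, rfl⟩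
      exact ⟨rfl, rfl, hmerge⟩
    · obtain ⟨⟨rfl, rfl, -, e⟩, rfl⟩ : (x = x' ∧ i = i' ∧ i = i' ∧ z i ≍ a') ∧ tl = tl' := by
        simpa using e1
      exact absurd (eq_of_heq e).symm ha
    · cases b <;> simp at e1
  · rintro ⟨rfl, rfl, rfl⟩
    rw [← hmerge]
    refine .treeFold _ ⟨x, .cone i, .prickle i (z i)⟩ ⟨.base, .cone i, .prickle i (z i)⟩ _ _ _
      (.inr ⟨_, List.mem_cons_self, rfl⟩) (.inl ⟨i, (prickleEdge_of_ne hi).symm⟩)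
      (.prickle_tgt _ _ _ _ _) hx ?_
    rintro rfl
    exact not_free_base hx

/-- The thistle's petal is the marked edge and not in the tree, so a fold inside the tree is
impossible and the fold across the loop is all that remains. The acting letter is inverse to the one
read along the path, because the far side of the folded edge is moved. -/
theorem uniqueMove_petal (D : FactorData A) {δ : Idx n k} {z : ∀ i, A i} {y : Vtx n k} {j : Fin k}
    {b : Bool} {tl : List (Edge A k × Bool)}
    (h : PathOK δ .base ((if b then ⟨.base, y, .petal j⟩ else ⟨y, .base, .petal j⟩, b) :: tl)) :
    UniqueMove D (pathState δ z .base
        ((if b then ⟨.base, y, .petal j⟩ else ⟨y, .base, .petal j⟩, b) :: tl))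
      (blockWord D δ (.inr j) (xpow j !b))
      (pathState δ z .base (tl.map (mergeDart y .base 1))) := by
  have hy : y.Free := by
    have := h.free _ List.mem_cons_self
    cases b <;> exact this
  have hyb : y ≠ .base := by rintro rfl; exact not_free_base hy
  have hj : .inr j ≠ δ := by
    have := h.idx _ List.mem_cons_self
    cases b <;> exact this
  refine ⟨n + j + 1, fun r w s' => ⟨fun hm => ?_, ?_⟩⟩
  · rcases move_cases h hm with ⟨e, b', tl', e₂, v₁, v₂, c, e1, hf, h₂, hs, hg, -⟩ |
      ⟨x', i', a', tl', e1, -⟩ | ⟨y', j', b', tl', e1, rfl, rfl, rfl⟩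
    · exfalso
      obtain ⟨⟨rfl, rfl⟩, rfl⟩ := (by simpa using e1 : (_ ∧ _) ∧ _)
      have h2 : e₂.lab.idx = .inr j := by
        rw [← germ_idx (e₂, b), hg, germ_idx]
        cases b <;> rfl
      rcases h₂ with ⟨i, rfl⟩ | h₂
      · simp [prickleEdge, Lab.idx] at h2
      · exact h.star_not_onPath hs ((onPath_iff true).2 h₂)
    · cases b <;> simp at e1
    · cases b <;> cases b' <;> simp at e1 <;> obtain ⟨⟨rfl, rfl⟩, rfl⟩ := e1 <;>
        exact ⟨rfl, rfl, rfl⟩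
  · rintro ⟨rfl, rfl, rfl⟩
    cases b
    · change PathOK δ .base ((⟨y, .base, .petal j⟩, false) :: tl) at h
      change Move D (pathState δ z .base ((⟨y, .base, .petal j⟩, false) :: tl)) _ _ _
      have hmark : (pathState δ z .base ((⟨y, .base, .petal j⟩, false) :: tl)).mark j =
          (⟨.base, .base, .petal j⟩, true) := congrArg (·, true) (petalEdge_of_ne hj)
      have hb : y ∈ beyond (pathState δ z .base ((⟨y, .base, .petal j⟩, false) :: tl)).tree ⟨y, .base, .petal j⟩ :=
        h.mem_beyond
      have hw := whitehead_pathState D (z := z) h (.inr j) (xpow j true)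
      have := Move.loopFoldTgt (D := D) _ j j true .base y y .base hmark
        (.inr ⟨_, List.mem_cons_self, rfl⟩) hyb hy (.inl ⟨rfl, rfl⟩)
      rw [if_pos hb, merge_marks hy rfl] at this
      have h3 := merge_tree_diff (z := z) (c := 1) (v' := .base) hy rfl h
      dsimp only at h3 hw
      rw [h3, hw] at this
      exact this
    · change PathOK δ .base ((⟨.base, y, .petal j⟩, true) :: tl) at h
      change Move D (pathState δ z .base ((⟨.base, y, .petal j⟩, true) :: tl)) _ _ _
      have hmark : (pathState δ z .base ((⟨.base, y, .petal j⟩, true) :: tl)).mark j =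
          (⟨.base, .base, .petal j⟩, true) := congrArg (·, true) (petalEdge_of_ne hj)
      have hb : y ∈ beyond (pathState δ z .base ((⟨.base, y, .petal j⟩, true) :: tl)).tree ⟨.base, y, .petal j⟩ :=
        h.mem_beyond
      have hw := whitehead_pathState D (z := z) h (.inr j) (xpow j !true)
      have := Move.loopFoldSrc (D := D) _ j j true .base y y .base hmark
        (.inr ⟨_, List.mem_cons_self, rfl⟩) hyb hy (.inl ⟨rfl, rfl⟩)
      rw [if_pos hb, merge_marks hy rfl] at this
      have h3 := merge_tree_diff (z := z) (c := 1) (v' := .base) hy rfl h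
      dsimp only at h3 hw
      rw [h3, hw] at this
      exact this

theorem terminal_pathState_nil (D : FactorData A) (δ : Idx n k) (z : ∀ i, A i) :
    (pathState δ z .base []).Terminal D := by
  intro r w s' hm
  have h : PathOK δ .base ([] : List (Edge A k × Bool)) :=
    ⟨trivial, by simp, by simp, by simp, .inl rfl⟩
  rcases move_cases h hm with ⟨_, _, _, _, _, _, _, e, -⟩ | ⟨_, _, _, _, e, -⟩ | ⟨_, _, _, _, e, -⟩ <;>
    cases e

end Moves

section Run

variable {n k : ℕ} {A : Fin n → Type u} [∀ i, Group (A i)]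

/-! ### The run of the folding procedure along a path -/

/-- The part of a path over one letter: along the prickle `i` to the vertex `t` and back to the
vertex `v`, or along the petal `j` to the vertex `v`. -/
inductive Step {n : ℕ} (A : Fin n → Type u) (k : ℕ) : Type u
  | prickle (i : Fin n) (p q : A i) (t v : Vtx n k) : Step A k
  | petal (j : Fin k) (b : Bool) (v : Vtx n k) : Step A k

/-- The inverse of the letter that is read along the step. -/
def Step.letter : Step A k → Letter A k
  | .prickle i p q _ _ => .prickle i (q * p⁻¹)
  | .petal j b _ => .petal j !b

/-- The vertices through which the step passes after its origin. -/
def Step.verts : Step A k → List (Vtx n k)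
  | .prickle _ _ _ t v => [t, v]
  | .petal _ _ v => [v]

/-- The path that consists of the given steps. -/
def stepDarts : Vtx n k → List (Step A k) → List (Edge A k × Bool)
  | _, [] => []
  | x, .prickle i p q t v :: l =>
      (⟨x, t, .prickle i p⟩, true) :: (⟨v, t, .prickle i q⟩, false) :: stepDarts v l
  | x, .petal j b v :: l => (if b then ⟨x, v, .petal j⟩ else ⟨v, x, .petal j⟩, b) :: stepDarts v l

theorem map_term_stepDarts (x : Vtx n k) (l : List (Step A k)) :
    (stepDarts x l).map term = l.flatMap Step.verts := by
  induction l generalizing x with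
  | nil => rfl
  | cons s l ih =>
    cases s with
    | prickle i p q t v => simp [stepDarts, Step.verts, ih, term]
    | petal j b v => cases b <;> simp [stepDarts, Step.verts, ih, term]

/-- The steps read a tight word that avoids the factor `δ`, through different vertices. -/
structure StepsOK (δ : Idx n k) (l : List (Step A k)) : Prop where
  tight : Tight (l.map Step.letter)
  idx : ∀ s ∈ l, s.letter.idx ≠ δ
  nodup : (l.flatMap Step.verts).Nodup
  free : ∀ v ∈ l.flatMap Step.verts, v.Free

theorem StepsOK.tail {δ : Idx n k} {s : Step A k} {l : List (Step A k)}
    (h : StepsOK δ (s :: l)) : StepsOK δ l where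
  tight := Tight.tail h.tight
  idx s hs := h.idx s (List.mem_cons_of_mem _ hs)
  nodup := (List.nodup_append.1 h.nodup).2.1
  free v hv := h.free v (List.mem_append_right _ hv)

/-- The germ at the origin of a step. -/
def Step.germ : Step A k → Lab A k × Bool
  | .prickle i _ _ _ _ => (.prickle i 1, true)
  | .petal j b _ => (.petal j, b)

/-- The germ at the end of a step. -/
def Step.backGerm : Step A k → Lab A k × Bool
  | .prickle i _ _ _ _ => (.prickle i 1, true)
  | .petal j b _ => (.petal j, !b)

theorem germ_head {x : Vtx n k} {l : List (Step A k)} {d : Edge A k × Bool}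
    (h : d ∈ (stepDarts x l).head?) : ∃ s ∈ l.head?, germ d = s.germ := by
  cases l with
  | nil => simp [stepDarts] at h
  | cons s l =>
    refine ⟨s, rfl, ?_⟩
    cases s with
    | prickle i p q t v =>
      simp only [stepDarts, List.head?_cons, Option.mem_def, Option.some.injEq] at h
      subst h
      rfl
    | petal j b v =>
      simp only [stepDarts, List.head?_cons, Option.mem_def, Option.some.injEq] at h
      subst h
      cases b <;> rfl

theorem germ_ne_backGerm {s s' : Step A k} (h : s.letter.Compatible s'.letter) :
    s'.germ ≠ s.backGerm := by
  cases s <;> cases s' <;> simp_all [Step.letter, Step.germ, Step.backGerm, Letter.Compatible]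
  rintro rfl; exact absurd rfl h

theorem StepsOK.germ_ne {δ : Idx n k} {s : Step A k} {l : List (Step A k)}
    (h : StepsOK δ (s :: l)) (x : Vtx n k) :
    ∀ d ∈ (stepDarts x l).head?, germ d ≠ s.backGerm := by
  intro d hd
  obtain ⟨s', hs', e⟩ := germ_head hd
  rw [e]
  apply germ_ne_backGerm
  cases l with
  | nil => cases hs'
  | cons s'' l =>
    cases hs'
    have := h.tight.1
    rw [List.map_cons, List.map_cons, List.isChain_cons_cons] at this
    exact this.1

theorem StepsOK.imm {δ : Idx n k} {l : List (Step A k)} (h : StepsOK δ l) (x : Vtx n k) :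
    ImmPath x (stepDarts x l) := by
  induction l generalizing x with
  | nil => trivial
  | cons s l ih =>
    have hg := fun x => h.germ_ne x
    cases s with
    | prickle i p q t v =>
      refine ⟨rfl, ?_, rfl, hg v, ih h.tail v⟩
      rintro _ ⟨⟩ e
      -- Backtracking at the tip would mean that the letter is the trivial element of `A_i`.
      have hpq : q = p := by
        simpa [germ, rev] using e
      exact h.tight.2 i (by simp [Step.letter, hpq])
    | petal j b v =>
      cases b
      · exact ⟨rfl, hg v, ih h.tail v⟩
      · exact ⟨rfl, hg v, ih h.tail v⟩

theorem StepsOK.dart_idx {δ : Idx n k} {l : List (Step A k)} (h : StepsOK δ l) (x : Vtx n k) :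
    ∀ d ∈ stepDarts x l, d.1.lab.idx ≠ δ := by
  induction l generalizing x with
  | nil => simp [stepDarts]
  | cons s l ih =>
    have h1 := h.idx s List.mem_cons_self
    have h2 := ih h.tail
    cases s with
    | prickle i p q t v =>
      intro d hd
      simp only [stepDarts, List.mem_cons] at hd
      rcases hd with rfl | rfl | hd
      · exact h1
      · exact h1
      · exact h2 v d hd
    | petal j b v =>
      intro d hd
      simp only [stepDarts, List.mem_cons] at hd
      rcases hd with rfl | hd
      · cases b <;> exact h1
      · exact h2 v d hd

theorem StepsOK.pathOK {δ : Idx n k} {l : List (Step A k)} (h : StepsOK δ l) :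
    PathOK δ .base (stepDarts .base l) where
  imm := h.imm _
  nodup := by rw [map_term_stepDarts]; exact h.nodup
  free d hd := h.free _ (by rw [← map_term_stepDarts .base]; exact List.mem_map_of_mem hd)
  idx := h.dart_idx _
  start := .inl rfl

theorem StepsOK.pathOK_cone {δ : Idx n k} {i : Fin n} {p q : A i} {t v : Vtx n k}
    {l : List (Step A k)} (h : StepsOK δ (.prickle i p q t v :: l)) (a : A i) :
    PathOK δ (.cone i) ((⟨v, .cone i, .prickle i a⟩, false) :: stepDarts v l) where
  imm := ⟨rfl, h.germ_ne v, h.tail.imm v⟩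
  nodup := by
    rw [List.map_cons, map_term_stepDarts]
    exact (List.nodup_cons.1 h.nodup).2
  free d hd := by
    refine h.free (term d) (List.mem_cons_of_mem t ?_)
    have := List.mem_map_of_mem (f := term) hd
    rwa [List.map_cons, map_term_stepDarts] at this
  idx d hd := by
    rcases List.mem_cons.1 hd with rfl | hd
    · exact h.idx _ List.mem_cons_self
    · exact h.tail.dart_idx v d hd
  start := .inr ⟨i, rfl, h.idx _ List.mem_cons_self⟩

-- The vertex `v` does not recur along the path, so its identification with `v'` is felt only at the
-- origin.
open Classical in
theorem map_mergeDart_stepDarts {v v' : Vtx n k} {c : ∀ i, A i} (x : Vtx n k)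
    {l : List (Step A k)} (hl : v ∉ l.flatMap Step.verts) :
    (stepDarts x l).map (mergeDart v v' c) = stepDarts (if x = v then v' else x) l := by
  induction l generalizing x with
  | nil => rfl
  | cons s l ih =>
    simp only [List.flatMap_cons, List.mem_append, not_or] at hl
    have h1 := fun x => ih x hl.2
    cases s with
    | prickle i p q t y =>
      simp only [Step.verts, List.mem_cons, List.not_mem_nil, or_false, not_or] at hl
      have h2 := h1 y
      rw [if_neg (Ne.symm hl.1.2)] at h2
      simp [stepDarts, mergeDart, Edge.merge, h2, Ne.symm hl.1.1, Ne.symm hl.1.2]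
    | petal j b y =>
      simp only [Step.verts, List.mem_cons, List.not_mem_nil, or_false] at hl
      have h2 := h1 y
      rw [if_neg (Ne.symm hl.1)] at h2
      cases b <;> simp [stepDarts, mergeDart, Edge.merge, h2, Ne.symm hl.1]

/-- The word that the folding procedure contributes along the given letters. -/
noncomputable def letterWord (D : FactorData A) (δ : Idx n k) (L : List (Letter A k)) :
    List (MulAut (FreeProd A k)) :=
  L.flatMap fun x => blockWord D δ x.idx x.elt

theorem letterWord_append (D : FactorData A) (δ : Idx n k) (L L' : List (Letter A k)) :
    letterWord D δ (L ++ L') = letterWord D δ L ++ letterWord D δ L' := by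
  simp [letterWord]

theorem letterWord_singleton (D : FactorData A) (δ : Idx n k) (x : Letter A k) :
    letterWord D δ [x] = blockWord D δ x.idx x.elt := by
  simp [letterWord]

/-- The first step of the path is folded by a sequence of uniquely determined steps. -/
theorem folds_step (D : FactorData A) {δ : Idx n k} {z : ∀ i, A i}
    (hz : ∀ i, ∀ a : A i, z i * a = a * z i) {s : Step A k} {l : List (Step A k)}
    (h : StepsOK δ (s :: l)) {s' : State A k} (ht : s'.Terminal D)
    (w : List (MulAut (FreeProd A k))) :
    Folds D (pathState δ z .base (stepDarts .base (s :: l))) w s' ↔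
      ∃ w', w = w' ++ letterWord D δ [s.letter] ∧
        Folds D (pathState δ z .base (stepDarts .base l)) w' s' := by
  have hn := h.nodup
  rw [letterWord_singleton]
  have hiff : ∀ {s₁ s₂ : State A k} {w₀ : List (MulAut (FreeProd A k))},
      UniqueMove D s₁ w₀ s₂ → ∀ w, Folds D s₁ w s' ↔ ∃ w', w = w' ++ w₀ ∧ Folds D s₂ w' s' := by
    intro s₁ s₂ w₀ hu w
    refine ⟨fun hf => hu.folds_inv hf ht, ?_⟩
    rintro ⟨w', rfl, hf⟩
    exact hu.folds hf
  cases s with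
  | prickle i p q t v =>
    simp only [List.flatMap_cons, Step.verts, List.cons_append, List.nil_append,
      List.nodup_cons, List.mem_cons, not_or] at hn
    have h1 := uniqueMove_tip D (z := z) h.pathOK
    have e1 : ((⟨v, t, .prickle i q⟩, false) :: stepDarts v l : List (Edge A k × Bool)).map
        (mergeDart t (.cone i) (Pi.mulSingle i (p⁻¹ * z i))) =
        (⟨v, .cone i, .prickle i (q * (p⁻¹ * z i))⟩, false) :: stepDarts v l := by
      rw [List.map_cons, map_mergeDart_stepDarts v hn.1.2, if_neg (Ne.symm hn.1.1)]
      simp [mergeDart, Edge.merge, Ne.symm hn.1.1]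
    rw [e1] at h1
    -- Equality would mean `q * p⁻¹ = 1`, a trivial letter, which tightness forbids. So a twist is
    -- really needed.
    have ha : q * (p⁻¹ * z i) ≠ z i := by
      intro e
      rw [← mul_assoc] at e
      have e' : q * p⁻¹ = 1 := mul_eq_right.1 e
      exact h.tight.2 i (by simp [Step.letter, e'])
    have h2 := uniqueMove_twist D ha (h.pathOK_cone _)
    have h3 := uniqueMove_cone D (z := z) (h.pathOK_cone _)
    have e3 : (stepDarts v l).map (mergeDart v .base 1) = stepDarts .base l := by
      rw [map_mergeDart_stepDarts v hn.2.1, if_pos rfl]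
    rw [e3] at h3
    -- Since `z i` is central, the contribution does not depend on which realization was chosen.
    have e4 : (z i)⁻¹ * (q * (p⁻¹ * z i)) = q * p⁻¹ := by
      rw [← mul_assoc q, ← hz i, inv_mul_cancel_left]
    have e5 : blockWord D δ (.inl i) ((z i)⁻¹ * (q * (p⁻¹ * z i)) : A i) =
        blockWord D δ (Step.prickle i p q t v).letter.idx
          (Step.prickle i p q t v).letter.elt := congrArg (blockWord D δ (.inl i)) e4
    rw [← e5]
    refine (hiff h1 w).trans ?_
    simp only [List.append_nil, exists_eq_left']
    refine (hiff h2 w).trans ?_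
    refine exists_congr fun w' => and_congr_right fun _ => ?_
    refine (hiff h3 w').trans ?_
    simp only [List.append_nil, exists_eq_left']
  | petal j b v =>
    simp only [List.flatMap_cons, Step.verts, List.cons_append, List.nil_append,
      List.nodup_cons] at hn
    have h1 := uniqueMove_petal D (z := z) h.pathOK
    rw [map_mergeDart_stepDarts v hn.1, if_pos rfl] at h1
    exact hiff h1 w

/-- The folding procedure along a path is deterministic. -/
theorem folds_iff (D : FactorData A) {δ : Idx n k} {z : ∀ i, A i}
    (hz : ∀ i, ∀ a : A i, z i * a = a * z i) {l : List (Step A k)}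
    (h : StepsOK δ l) {s' : State A k} (ht : s'.Terminal D)
    (w : List (MulAut (FreeProd A k))) :
    Folds D (pathState δ z .base (stepDarts .base l)) w s' ↔
      w = letterWord D δ (l.map Step.letter).reverse ∧ s' = pathState δ z .base [] := by
  induction l generalizing w with
  | nil =>
    constructor
    · intro hf
      cases hf with
      | refl => exact ⟨rfl, rfl⟩
      | step _ _ _ _ _ _ hm _ _ => exact absurd hm (terminal_pathState_nil D δ z _ _ _)
    · rintro ⟨rfl, rfl⟩
      exact .refl _
  | cons s l ih =>
    rw [folds_step D hz h ht, List.map_cons, List.reverse_cons, letterWord_append]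
    constructor
    · rintro ⟨w', rfl, hf⟩
      obtain ⟨rfl, rfl⟩ := (ih h.tail w').1 hf
      exact ⟨rfl, rfl⟩
    · rintro ⟨rfl, rfl⟩
      exact ⟨_, rfl, (ih h.tail _).2 ⟨rfl, rfl⟩⟩

theorem mulAut_ext {φ ψ : MulAut (FreeProd A k)}
    (h : ∀ (i : Fin n) (a : A i), φ (emb (.inl i) a) = ψ (emb (.inl i) a))
    (hx : ∀ j, φ (xG j) = ψ (xG j)) : φ = ψ := by
  have e : φ.toMonoidHom = ψ.toMonoidHom := by
    refine Monoid.CoprodI.ext_hom _ _ fun m => ?_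
    cases m with
    | inl i => exact MonoidHom.ext fun a => h i a
    | inr j =>
      exact FreeGroup.ext_hom
        (f := (φ.toMonoidHom.comp (emb (.inr j)) : FreeGroup PUnit.{u + 1} →* _))
        (g := (ψ.toMonoidHom.comp (emb (.inr j)) : FreeGroup PUnit.{u + 1} →* _)) fun _ => hx j
  exact MulEquiv.ext fun x => DFunLike.congr_fun e x

/-- The folded thistle with the elements `z i` induces conjugation by `z i` on `A_i`, which is
trivial because `z i` is central. Hence nothing is put in front of the word that folding produces.
-/
theorem realizes_pathState_nil {δ : Idx n k} {z : ∀ i, A i}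
    (hz : ∀ i, ∀ a : A i, z i * a = a * z i) {σ : MulAut (FreeProd A k)} :
    (pathState δ z .base []).Realizes σ ↔ σ = 1 := by
  have hpet : ∀ j : Fin k, (petalEdge δ .base j : Edge A k) = ⟨.base, .base, .petal j⟩ :=
    fun j => by simp [petalEdge]
  have hpri : ∀ i : Fin n, (prickleEdge δ z .base i : Edge A k) =
      ⟨.base, .cone i, .prickle i (z i)⟩ := fun j => by simp [prickleEdge]
  have hconj : ∀ (i : Fin n) (a : A i), (emb (.inl i) (z i) : FreeProd A k) *
      emb (.inl i) a * (emb (.inl i) (z i))⁻¹ = emb (.inl i) a := by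
    intro i a
    have : (emb (.inl i) (z i) : FreeProd A k) * emb (.inl i) a =
        emb (.inl i) a * emb (.inl i) (z i) :=
      (map_mul (emb (k := k) (.inl i)) (z i) a).symm.trans
        ((congrArg _ (hz i a)).trans (map_mul (emb (k := k) (.inl i)) a (z i)))
    rw [this]
    group
  constructor
  · rintro ⟨pos, h0, h1, h2, h3⟩
    refine mulAut_ext (fun i a => (h2 i a).trans ?_) fun j => ?_
    · have hp : pos (.cone i) = emb (.inl i) (z i) := by
        have := h1 _ (.inl ⟨i, rfl⟩)
        simp only [endV, hpri, h0, one_mul] at this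
        exact this
      rw [hp]
      exact hconj i a
    · have := h3 j
      simp only [pathState, endV, hpet, orig, term, dartVal, if_true, h0, one_mul, inv_one,
        mul_one] at this
      exact this
  · rintro rfl
    refine ⟨fun v => match v with
      | .cone i => emb (.inl i) (z i)
      | _ => 1, rfl, ?_, ?_, ?_⟩
    · rintro e (⟨i, rfl⟩ | ⟨d, hd, -⟩)
      · simp only [endV, hpri, one_mul]
        rfl
      · simp at hd
    · intro i a
      exact (hconj i a).symm
    · intro j
      simp only [pathState, endV, hpet, orig, term, dartVal, if_true, one_mul, inv_one, mul_one]
      rfl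

end Run

section Words

variable {n k : ℕ} {A : Fin n → Type u} [∀ i, Group (A i)]

/-! ### Automorphisms that act on one factor -/

/-- The elements of the factor `δ` on which an automorphism is prescribed: all of them for a
conjugation, the generator for a transvection. -/
def actSet (conj : Bool) (δ : Idx n k) : Set (FreeProd A k) :=
  if conj then Set.range (emb δ) else {g | ∃ j, δ = .inr j ∧ g = xG j}

/-- The automorphism fixes all factors except for `δ`, which it conjugates by `v`, or whose
generator it multiplies by `v` on the right. -/
structure Acts (conj : Bool) (δ : Idx n k) (v : FreeProd A k) (φ : MulAut (FreeProd A k)) :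
    Prop where
  fix : ∀ m, m ≠ δ → ∀ y : Factor A k m, φ (emb m y) = emb m y
  act : ∀ g ∈ actSet conj δ, φ g = (if conj then v⁻¹ else 1) * g * v

/-- The subgroup generated by the factors other than `δ`. -/
def restOf (A : Fin n → Type u) [∀ i, Group (A i)] (δ : Idx n k) : Subgroup (FreeProd A k) :=
  Subgroup.closure {g | ∃ m, m ≠ δ ∧ ∃ y : Factor A k m, g = emb m y}

theorem emb_mem_restOf {δ m : Idx n k} (h : m ≠ δ) (y : Factor A k m) :
    emb m y ∈ restOf A δ := Subgroup.subset_closure ⟨m, h, y, rfl⟩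

theorem lval_mem_restOf {δ : Idx n k} {L : List (Letter A k)} (h : ∀ x ∈ L, x.idx ≠ δ) :
    lval L ∈ restOf A δ := by
  refine Subgroup.list_prod_mem _ fun g hg => ?_
  obtain ⟨x, hx, rfl⟩ := List.mem_map.1 hg
  rw [Letter.val_eq]
  exact emb_mem_restOf (h x hx) _

theorem actSet_subset (conj : Bool) (δ : Idx n k) {g : FreeProd A k} (h : g ∈ actSet conj δ) :
    ∃ y, g = emb δ y := by
  cases conj
  · obtain ⟨j, rfl, rfl⟩ := h
    exact ⟨_, rfl⟩
  · obtain ⟨y, rfl⟩ := h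
    exact ⟨y, rfl⟩

theorem fix_restOf {δ : Idx n k} {φ : MulAut (FreeProd A k)}
    (h : ∀ m, m ≠ δ → ∀ y : Factor A k m, φ (emb m y) = emb m y) {v : FreeProd A k}
    (hv : v ∈ restOf A δ) : φ v = v := by
  induction hv using Subgroup.closure_induction with
  | mem g hg =>
    obtain ⟨m, hm, y, rfl⟩ := hg
    exact h m hm y
  | one => exact map_one φ
  | mul _ _ _ _ h₁ h₂ => rw [map_mul, h₁, h₂]
  | inv _ _ h => rw [map_inv, h]

theorem Acts.one (conj : Bool) (δ : Idx n k) : Acts conj δ (1 : FreeProd A k) 1 :=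
  ⟨fun _ _ _ => rfl, fun g _ => by cases conj <;> simp⟩

/-- The first automorphism fixes `v'`, a product of elements of factors that it does not move, so
the acting elements multiply in the order of composition. -/
theorem Acts.mul {conj : Bool} {δ : Idx n k} {v v' : FreeProd A k} {φ ψ : MulAut (FreeProd A k)}
    (h : Acts conj δ v φ) (h' : Acts conj δ v' ψ) (hv : v' ∈ restOf A δ) :
    Acts conj δ (v * v') (φ * ψ) := by
  refine ⟨fun m hm y => ?_, fun g hg => ?_⟩
  · rw [MulAut.mul_apply, h'.fix m hm, h.fix m hm]
  · rw [MulAut.mul_apply, h'.act g hg, map_mul, map_mul, h.act g hg, fix_restOf h.fix hv]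
    cases conj
    · simp [mul_assoc]
    · simp [fix_restOf h.fix hv, mul_assoc]

theorem Acts.pow {conj : Bool} {δ : Idx n k} {v : FreeProd A k} {φ : MulAut (FreeProd A k)}
    (h : Acts conj δ v φ) (hv : v ∈ restOf A δ) (N : ℕ) : Acts conj δ (v ^ N) (φ ^ N) := by
  induction N with
  | zero => simpa using Acts.one conj δ
  | succ N ih =>
    rw [pow_succ, pow_succ]
    exact ih.mul h hv

/-- With conjugation for an `A_i` and a transvection for an infinite cyclic factor, the action is
prescribed on a generating set of the whole group. -/
theorem Acts.eq {δ : Idx n k} {v : FreeProd A k} {φ ψ : MulAut (FreeProd A k)}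
    (h : Acts δ.isLeft δ v φ) (h' : Acts δ.isLeft δ v ψ) : φ = ψ := by
  refine mulAut_ext (fun i a => ?_) fun j => ?_
  · by_cases hi : .inl i = δ
    · subst hi
      rw [h.act _ ⟨a, rfl⟩, h'.act _ ⟨a, rfl⟩]
    · exact (h.fix _ hi _).trans (h'.fix _ hi _).symm
  · by_cases hj : .inr j = δ
    · subst hj
      rw [h.act _ ⟨j, rfl, rfl⟩, h'.act _ ⟨j, rfl, rfl⟩]
    · exact (h.fix _ hj _).trans (h'.fix _ hj _).symm

/-! ### Conjugation by automorphisms that fix the acted factor -/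

/-- The automorphisms that fix the factor `δ` and preserve the product of the other ones. -/
def stabOf (A : Fin n → Type u) [∀ i, Group (A i)] (δ : Idx n k) :
    Subgroup (MulAut (FreeProd A k)) where
  carrier := {θ | (∀ y : Factor A k δ, θ (emb δ y) = emb δ y) ∧
    ∀ v, θ v ∈ restOf A δ ↔ v ∈ restOf A δ}
  mul_mem' {θ θ'} h h' := ⟨fun y => by rw [MulAut.mul_apply, h'.1, h.1],
    fun v => by rw [MulAut.mul_apply, h.2, h'.2]⟩
  one_mem' := ⟨fun _ => rfl, fun _ => Iff.rfl⟩
  inv_mem' {θ} h := ⟨fun y => by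
      rw [← h.1 y, ← MulAut.mul_apply, inv_mul_cancel, MulAut.one_apply, h.1],
    fun v => by rw [← h.2, ← MulAut.mul_apply, mul_inv_cancel, MulAut.one_apply]⟩

/-- This is the source of the short words: one conjugation replaces the acting element `v` by its
possibly much longer image `θ v`, and the cost of `θ` is paid once for a whole power of `φ`. -/
theorem Acts.conj {conj : Bool} {δ : Idx n k} {v : FreeProd A k} {φ θ : MulAut (FreeProd A k)}
    (h : Acts conj δ v φ) (hθ : θ ∈ stabOf A δ) : Acts conj δ (θ v) (θ * φ * θ⁻¹) := by
  have hi := inv_mem hθ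
  have hc : ∀ g, θ (θ⁻¹ g) = g := fun g => by
    rw [← MulAut.mul_apply, mul_inv_cancel, MulAut.one_apply]
  refine ⟨fun m hm y => ?_, fun g hg => ?_⟩
  · rw [MulAut.mul_apply, MulAut.mul_apply,
      fix_restOf h.fix ((hi.2 _).2 (emb_mem_restOf hm y)), hc]
  · obtain ⟨y, rfl⟩ := actSet_subset _ _ hg
    rw [MulAut.mul_apply, MulAut.mul_apply, hi.1, h.act _ hg, map_mul, map_mul, hθ.1]
    cases conj <;> simp

theorem partialConj_inv {i c : Idx n k} (h : i ≠ c) (s : Factor A k i) :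
    partialConj h s⁻¹ = (partialConj h s)⁻¹ := by
  refine MulEquiv.ext fun x => ?_
  change conjHom c (emb i s⁻¹) x = conjHom c (emb i s⁻¹) x
  rfl

theorem rightTransv_inv {i : Idx n k} {j : Fin k} (h : i ≠ .inr j) (s : Factor A k i) :
    rightTransv h s⁻¹ = (rightTransv h s)⁻¹ := by
  refine MulEquiv.ext fun x => ?_
  change transHom j 1 (emb i s⁻¹) x = transHom j 1 (emb i s⁻¹) x
  rfl

theorem acts_partialConj {i δ : Idx n k} (h : i ≠ δ) (s : Factor A k i) :
    Acts true δ (emb i s) (partialConj h s) :=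
  ⟨fun _ hm y => conjHom_of_ne hm _ y, by rintro _ ⟨y, rfl⟩; exact conjHom_same _ _ y⟩

theorem acts_rightTransv {i : Idx n k} {j : Fin k} (h : i ≠ .inr j) (s : Factor A k i) :
    Acts false (.inr j) (emb i s) (rightTransv h s) :=
  ⟨fun _ hm y => transHom_of_ne hm _ _ y, by
    rintro _ ⟨j', e, rfl⟩
    cases e
    exact transHom_same _ _ _⟩

theorem map_restOf_le {θ : MulAut (FreeProd A k)} {δ : Idx n k}
    (h : ∀ m, m ≠ δ → ∀ y : Factor A k m, θ (emb m y) ∈ restOf A δ) {v : FreeProd A k}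
    (hv : v ∈ restOf A δ) : θ v ∈ restOf A δ := by
  induction hv using Subgroup.closure_induction with
  | mem g hg =>
    obtain ⟨m, hm, y, rfl⟩ := hg
    exact h m hm y
  | one => rw [map_one]; exact one_mem _
  | mul _ _ _ _ h₁ h₂ => rw [map_mul]; exact mul_mem h₁ h₂
  | inv _ _ h => rw [map_inv]; exact inv_mem h

theorem Acts.map_emb_mem {δ γ : Idx n k} {v : FreeProd A k} {φ : MulAut (FreeProd A k)}
    {conj : Bool} (h : Acts conj γ v φ) (hc : conj = true ∨ ∃ j, γ = .inr j)
    (hv : v ∈ restOf A δ) (m : Idx n k) (hm : m ≠ δ) (y : Factor A k m) :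
    φ (emb m y) ∈ restOf A δ := by
  by_cases hmγ : m = γ
  · subst hmγ
    cases conj
    · obtain ⟨j, rfl⟩ := hc.resolve_left (by simp)
      let f : FreeGroup PUnit.{u + 1} →* FreeProd A k := φ.toMonoidHom.comp (emb (.inr j))
      change f y ∈ restOf A δ
      induction (y : FreeGroup PUnit.{u + 1}) using FreeGroup.induction_on with
      | C1 => rw [map_one]; exact one_mem _
      | of _ =>
        have : f (FreeGroup.of PUnit.unit) = _ := h.act (xG j) ⟨j, rfl, rfl⟩
        rw [this]
        exact mul_mem (mul_mem (one_mem _) (emb_mem_restOf hm _)) hv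
      | inv_of _ ih => rw [map_inv]; exact inv_mem ih
      | mul _ _ h₁ h₂ => rw [map_mul]; exact mul_mem h₁ h₂
    · rw [h.act _ ⟨y, rfl⟩]
      exact mul_mem (mul_mem (inv_mem hv) (emb_mem_restOf hm _)) hv
  · rw [h.fix m hmγ]
    exact emb_mem_restOf hm y

/-- Acting on a factor `γ` other than `δ` by an element that avoids `δ` does not leave the product
of the factors other than `δ`. The same is needed for the inverse, since membership must be
preserved in both directions. -/
theorem Acts.mem_stabOf {δ γ : Idx n k} {v v' : FreeProd A k} {φ : MulAut (FreeProd A k)}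
    {conj : Bool} (h : Acts conj γ v φ) (h' : Acts conj γ v' φ⁻¹)
    (hc : conj = true ∨ ∃ j, γ = .inr j) (hv : v ∈ restOf A δ) (hv' : v' ∈ restOf A δ)
    (hδ : δ ≠ γ) : φ ∈ stabOf A δ := by
  refine ⟨h.fix δ hδ, fun g => ⟨fun hg => ?_, map_restOf_le (h.map_emb_mem hc hv)⟩⟩
  have := map_restOf_le (h'.map_emb_mem hc hv') hg
  rwa [← MulAut.mul_apply, inv_mul_cancel, MulAut.one_apply] at this

/-! ### Words of given length -/

/-- The automorphism is represented by a word of length `ℓ`. -/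
def FactorData.HasWord (D : FactorData A) (φ : MulAut (FreeProd A k)) (ℓ : ℕ) : Prop :=
  ∃ w, D.Represents w φ ∧ w.length = ℓ

theorem FactorData.HasWord.mul {D : FactorData A} {φ ψ : MulAut (FreeProd A k)} {ℓ ℓ' : ℕ}
    (h : D.HasWord φ ℓ) (h' : D.HasWord ψ ℓ') : D.HasWord (φ * ψ) (ℓ + ℓ') := by
  obtain ⟨w, ⟨hw, rfl⟩, rfl⟩ := h
  obtain ⟨w', ⟨hw', rfl⟩, rfl⟩ := h'
  refine ⟨w ++ w', ⟨fun x hx => ?_, List.prod_append⟩, List.length_append⟩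
  rcases List.mem_append.1 hx with hx | hx
  · exact hw x hx
  · exact hw' x hx

theorem FactorData.HasWord.one (D : FactorData A) : D.HasWord (1 : MulAut (FreeProd A k)) 0 :=
  ⟨[], ⟨by simp, rfl⟩, rfl⟩

theorem FactorData.HasWord.pow {D : FactorData A} {φ : MulAut (FreeProd A k)} {ℓ : ℕ}
    (h : D.HasWord φ ℓ) (N : ℕ) : D.HasWord (φ ^ N) (N * ℓ) := by
  induction N with
  | zero => simpa using FactorData.HasWord.one D
  | succ N ih =>
    rw [pow_succ, Nat.succ_mul]
    exact ih.mul h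

theorem FactorData.HasWord.inv {D : FactorData A} {φ : MulAut (FreeProd A k)} {ℓ : ℕ}
    (h : D.HasWord φ ℓ) : D.HasWord φ⁻¹ ℓ := by
  obtain ⟨w, ⟨hw, rfl⟩, rfl⟩ := h
  refine ⟨(w.map Inv.inv).reverse, ⟨fun x hx => ?_, (List.prod_inv_reverse w).symm⟩, by simp⟩
  obtain ⟨y, hy, rfl⟩ := List.mem_map.1 (List.mem_reverse.1 hx)
  rw [inv_inv]
  exact (hw y hy).symm

theorem FactorData.HasWord.of_mem {D : FactorData A} {φ : MulAut (FreeProd A k)}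
    (h : φ ∈ D.frGens k) : D.HasWord φ 1 :=
  ⟨[φ], ⟨by rintro x hx; rw [List.mem_singleton.1 hx]; exact .inl h, by simp⟩, rfl⟩

theorem FactorData.Represents.mem_autZero {D : FactorData A} {w : List (MulAut (FreeProd A k))}
    {φ : MulAut (FreeProd A k)} (h : D.Represents w φ) : φ ∈ autZero A k := by
  obtain ⟨hw, rfl⟩ := h
  have hsub : D.frGens k ⊆ frSet fun _ : Idx n k => (Set.univ : Set (Factor A k _)) := by
    rintro φ (⟨i, c, h, s, -, e⟩ | ⟨i, c, h, s, -, e⟩ | ⟨i, c, h, s, -, e⟩)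
    · exact .inl ⟨i, c, h, s, trivial, e⟩
    · exact .inr (.inl ⟨i, c, h, s, trivial, e⟩)
    · exact .inr (.inr ⟨i, c, h, s, trivial, e⟩)
  refine Subgroup.list_prod_mem _ fun x hx => ?_
  rcases hw x hx with h | h
  · exact Subgroup.subset_closure (hsub h)
  · exact inv_mem_iff.1 (Subgroup.subset_closure (hsub h))

theorem exists_acts_gen (D : FactorData A) {i δ : Idx n k} (h : i ≠ δ) {conj : Bool}
    (hc : conj = true ∨ ∃ j, δ = .inr j) {s : Factor A k i} (hs : s ∈ D.factorGens i) :
    ∃ φ : MulAut (FreeProd A k), D.HasWord φ 1 ∧ Acts conj δ (emb i s) φ ∧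
      ∀ δ', i ≠ δ' → δ' ≠ δ → φ ∈ stabOf A δ' := by
  cases conj
  · obtain ⟨j, rfl⟩ := hc.resolve_left (by simp)
    refine ⟨rightTransv h s, .of_mem (.inr (.inr ⟨i, j, h, s, hs, rfl⟩)),
      acts_rightTransv h s, fun δ' h1 h2 => ?_⟩
    refine (acts_rightTransv h s).mem_stabOf ?_ hc (emb_mem_restOf h1 s)
      (emb_mem_restOf h1 s⁻¹) h2
    rw [← rightTransv_inv]
    exact acts_rightTransv h s⁻¹
  · refine ⟨partialConj h s, .of_mem (.inl ⟨i, δ, h, s, hs, rfl⟩),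
      acts_partialConj h s, fun δ' h1 h2 => ?_⟩
    refine (acts_partialConj h s).mem_stabOf ?_ hc (emb_mem_restOf h1 s)
      (emb_mem_restOf h1 s⁻¹) h2
    rw [← partialConj_inv]
    exact acts_partialConj h s⁻¹

/-! ### The words that come from the folding procedure -/

theorem prod_map_toWord {α : Type*} [DecidableEq α] (g : FreeGroup α) :
    (g.toWord.map fun x => bif x.2 then FreeGroup.of x.1 else (FreeGroup.of x.1)⁻¹).prod = g := by
  rw [← FreeGroup.lift_mk, FreeGroup.mk_toWord]
  exact FreeGroup.lift_of_apply g

theorem factorNF_prod (D : FactorData A) (c : Idx n k) (a : Factor A k c) :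
    (D.factorNF c a).prod = a := by
  cases c with
  | inl i => exact D.nf_prod i a
  | inr j =>
    refine Eq.trans ?_ (prod_map_toWord (α := PUnit.{u + 1}) a)
    change ((FreeGroup.toWord (α := PUnit.{u + 1}) a).map _).prod = _
    congr 1
    refine List.map_congr_left fun p _ => ?_
    rcases p with ⟨_, _ | _⟩ <;> rfl

theorem factorNF_mem (D : FactorData A) (c : Idx n k) (a : Factor A k c) :
    ∀ s ∈ D.factorNF c a, s ∈ D.factorGens c ∨ s⁻¹ ∈ D.factorGens c := by
  cases c with
  | inl i => exact D.nf_letters i a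
  | inr j =>
    intro s hs
    obtain ⟨⟨_, b⟩, -, rfl⟩ := List.mem_map.1 hs
    cases b
    · exact .inr (xpow_not (A := A) j false).symm
    · exact .inl rfl

theorem flatMap_finRange_eq {β : Type*} {d : Fin n} {f : Fin n → List β}
    (h : ∀ l, l ≠ d → f l = []) : (List.finRange n).flatMap f = f d := by
  obtain ⟨s, t, e⟩ := List.append_of_mem (List.mem_finRange d)
  have hn := List.nodup_finRange n
  rw [e] at hn ⊢
  have hs : s.flatMap f = [] := by
    refine List.flatMap_eq_nil_iff.2 fun x hx => h x ?_
    rintro rfl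
    exact (List.disjoint_of_nodup_append hn) hx List.mem_cons_self
  have ht : t.flatMap f = [] := by
    refine List.flatMap_eq_nil_iff.2 fun x hx => h x ?_
    rintro rfl
    exact (List.nodup_cons.1 (List.nodup_append.1 hn).2.1).1 hx
  simp [hs, ht]

theorem blockWord_inl (D : FactorData A) {i : Idx n k} {d : Fin n} (hi : i ≠ .inl d)
    (h : Factor A k i) :
    blockWord D (.inl d) i h = (D.factorNF i h).map (partialConj hi) := by
  rw [blockWord, whitehead, flatMap_finRange_eq (d := d), List.flatMap_eq_nil_iff.2]
  · simp [hi]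
  · simp
  · intro l hl
    simp [hl]

theorem blockWord_inr (D : FactorData A) {i : Idx n k} {d : Fin k} (hi : i ≠ .inr d)
    (h : Factor A k i) :
    blockWord D (.inr d) i h = (D.factorNF i h).map (rightTransv hi) := by
  rw [blockWord, whitehead, flatMap_finRange_eq (d := d), List.flatMap_eq_nil_iff.2]
  · simp [hi]
  · simp
  · intro l hl
    simp [hl]

theorem acts_map_prod {i δ : Idx n k} (hi : i ≠ δ) {conj : Bool}
    {f : Factor A k i → MulAut (FreeProd A k)} (hf : ∀ s, Acts conj δ (emb i s) (f s))
    (l : List (Factor A k i)) : Acts conj δ (emb i l.prod) (l.map f).prod := by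
  induction l with
  | nil =>
    rw [List.prod_nil, map_one]
    exact Acts.one conj δ
  | cons s l ih =>
    rw [List.prod_cons, map_mul, List.map_cons, List.prod_cons]
    exact (hf s).mul ih (emb_mem_restOf hi _)

theorem acts_blockWord (D : FactorData A) {i δ : Idx n k} (hi : i ≠ δ) (h : Factor A k i) :
    Acts δ.isLeft δ (emb i h) (blockWord D δ i h).prod := by
  conv in emb i h => rw [← factorNF_prod D i h]
  cases δ with
  | inl d =>
    rw [blockWord_inl D hi]
    exact acts_map_prod hi (acts_partialConj hi) _
  | inr d =>
    rw [blockWord_inr D hi]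
    exact acts_map_prod hi (acts_rightTransv hi) _

theorem length_blockWord (D : FactorData A) {i δ : Idx n k} (hi : i ≠ δ) (h : Factor A k i) :
    (blockWord D δ i h).length = D.len i h := by
  cases δ with
  | inl d => rw [blockWord_inl D hi, List.length_map, FactorData.len]
  | inr d => rw [blockWord_inr D hi, List.length_map, FactorData.len]

theorem blockWord_mem (D : FactorData A) {i δ : Idx n k} (hi : i ≠ δ) (h : Factor A k i) :
    ∀ x ∈ blockWord D δ i h, x ∈ D.frGens k ∨ x⁻¹ ∈ D.frGens k := by
  intro x hx
  cases δ with
  | inl d =>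
    rw [blockWord_inl D hi] at hx
    obtain ⟨s, hs, rfl⟩ := List.mem_map.1 hx
    rw [← partialConj_inv]
    exact (factorNF_mem D i h s hs).imp (fun h => .inl ⟨_, _, hi, _, h, rfl⟩)
      fun h => .inl ⟨_, _, hi, _, h, rfl⟩
  | inr d =>
    rw [blockWord_inr D hi] at hx
    obtain ⟨s, hs, rfl⟩ := List.mem_map.1 hx
    rw [← rightTransv_inv]
    exact (factorNF_mem D i h s hs).imp (fun h => .inr (.inr ⟨_, _, hi, _, h, rfl⟩))
      fun h => .inr (.inr ⟨_, _, hi, _, h, rfl⟩)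

/-- The sum of the lengths of the normal forms of the letters. -/
def lenSum (D : FactorData A) (L : List (Letter A k)) : ℕ :=
  (L.map fun x => D.len x.idx x.elt).sum

theorem length_letterWord (D : FactorData A) {δ : Idx n k} {L : List (Letter A k)}
    (hL : ∀ x ∈ L, x.idx ≠ δ) : (letterWord D δ L).length = lenSum D L := by
  rw [letterWord, List.length_flatMap, lenSum]
  congr 1
  exact List.map_congr_left fun x hx => length_blockWord D (hL x hx) _

theorem letterWord_mem (D : FactorData A) {δ : Idx n k} {L : List (Letter A k)}
    (hL : ∀ x ∈ L, x.idx ≠ δ) :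
    ∀ x ∈ letterWord D δ L, x ∈ D.frGens k ∨ x⁻¹ ∈ D.frGens k := by
  intro x hx
  obtain ⟨y, hy, hx⟩ := List.mem_flatMap.1 hx
  exact blockWord_mem D (hL y hy) _ x hx

/-- Each block acts on `δ` by its letter and fixes all factors that occur in `L`, so the actions
multiply in the order of `L`. Together with `Acts.eq` this shows that the folding normal form
represents the given automorphism. -/
theorem acts_letterWord (D : FactorData A) {δ : Idx n k} {L : List (Letter A k)}
    (hL : ∀ x ∈ L, x.idx ≠ δ) : Acts δ.isLeft δ (lval L) (letterWord D δ L).prod := by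
  induction L with
  | nil => exact Acts.one _ δ
  | cons x L ih =>
    have hL' : ∀ x ∈ L, x.idx ≠ δ := fun y hy => hL y (List.mem_cons_of_mem _ hy)
    have : letterWord D δ (x :: L) = blockWord D δ x.idx x.elt ++ letterWord D δ L := by
      simp [letterWord]
    rw [this, List.prod_append, lval_cons, Letter.val_eq]
    exact (acts_blockWord D (hL x List.mem_cons_self) _).mul (ih hL') (lval_mem_restOf hL')

end Words

section Initial

variable {n k : ℕ} {A : Fin n → Type u} [∀ i, Group (A i)]

/-! ### The initial state -/

/-- The segments for a part of a path that starts after `t` of the `ℓ` letters. -/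
def segmentsFrom (c : Idx n k) (ℓ t : ℕ) : List (Letter A k) → List (Edge A k × Bool)
  | [] => []
  | .prickle i a :: P => (⟨node c ℓ t, .tip c t, .prickle i a⟩, true) ::
      (⟨node c ℓ (t + 1), .tip c t, .prickle i 1⟩, false) :: segmentsFrom c ℓ (t + 1) P
  | .petal j true :: P =>
      (⟨node c ℓ t, node c ℓ (t + 1), .petal j⟩, true) :: segmentsFrom c ℓ (t + 1) P
  | .petal j false :: P =>
      (⟨node c ℓ (t + 1), node c ℓ t, .petal j⟩, false) :: segmentsFrom c ℓ (t + 1) P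

theorem segments_eq (c : Idx n k) (P : List (Letter A k)) :
    segments c P = segmentsFrom c P.length 0 P := by
  rw [segments]
  generalize P.length = ℓ
  generalize 0 = t
  induction P generalizing t with
  | nil => rfl
  | cons x P ih =>
    rw [List.zipIdx_cons, List.flatMap_cons, ih]
    rcases x with _ | ⟨j, _ | _⟩ <;> rfl

theorem segmentsFrom_idx {c : Idx n k} {ℓ t : ℕ} {P : List (Letter A k)} {d : Edge A k × Bool}
    (hd : d ∈ segmentsFrom c ℓ t P) : ∃ x ∈ P, d.1.lab.idx = x.idx := by
  induction P generalizing t with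
  | nil => simp [segmentsFrom] at hd
  | cons x P ih =>
    have key : d ∈ segmentsFrom c ℓ (t + 1) P → ∃ x' ∈ x :: P, d.1.lab.idx = x'.idx := fun h => by
      obtain ⟨x', hx', e⟩ := ih h
      exact ⟨x', List.mem_cons_of_mem _ hx', e⟩
    rcases x with ⟨i, a⟩ | ⟨j, _ | _⟩ <;> simp only [segmentsFrom, List.mem_cons] at hd
    · rcases hd with rfl | rfl | hd
      · exact ⟨_, List.mem_cons_self, rfl⟩
      · exact ⟨_, List.mem_cons_self, rfl⟩
      · exact key hd
    · rcases hd with rfl | hd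
      · exact ⟨_, List.mem_cons_self, rfl⟩
      · exact key hd
    · rcases hd with rfl | hd
      · exact ⟨_, List.mem_cons_self, rfl⟩
      · exact key hd

/-- The steps along a path on a prickle. -/
def stepsF (c : Idx n k) (t : ℕ) : List (Letter A k) → List (Step A k)
  | [] => []
  | .prickle i a :: P => .prickle i a 1 (.tip c t) (.joint c (t + 1)) :: stepsF c (t + 1) P
  | .petal j b :: P => .petal j b (.joint c (t + 1)) :: stepsF c (t + 1) P

/-- The steps along the inverse of a path on a petal. -/
def stepsB (c : Idx n k) (t : ℕ) : List (Letter A k) → List (Step A k)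
  | [] => []
  | .prickle i a :: P => stepsB c (t + 1) P ++ [.prickle i 1 a (.tip c t) (.joint c t)]
  | .petal j b :: P => stepsB c (t + 1) P ++ [.petal j (!b) (.joint c t)]

theorem map_letter_stepsF (c : Idx n k) (t : ℕ) (P : List (Letter A k)) :
    (stepsF c t P).map Step.letter = P.map Letter.inv := by
  induction P generalizing t with
  | nil => rfl
  | cons x P ih => cases x <;> simp [stepsF, Step.letter, Letter.inv, ih]

theorem map_letter_stepsB (c : Idx n k) (t : ℕ) (P : List (Letter A k)) :
    (stepsB c t P).map Step.letter = P.reverse := by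
  induction P generalizing t with
  | nil => rfl
  | cons x P ih => cases x <;> simp [stepsB, Step.letter, ih]

theorem mem_verts_stepsF {c : Idx n k} {t : ℕ} {P : List (Letter A k)} {v : Vtx n k}
    (hv : v ∈ (stepsF c t P).flatMap Step.verts) :
    ∃ t', t ≤ t' ∧ (v = .tip c t' ∨ v = .joint c (t' + 1)) := by
  induction P generalizing t with
  | nil => simp [stepsF] at hv
  | cons x P ih =>
    have key : v ∈ (stepsF c (t + 1) P).flatMap Step.verts →
        ∃ t', t ≤ t' ∧ (v = .tip c t' ∨ v = .joint c (t' + 1)) := fun h => by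
      obtain ⟨t', h1, h2⟩ := ih h
      exact ⟨t', by omega, h2⟩
    cases x <;> simp only [stepsF, List.flatMap_cons, Step.verts, List.mem_append,
      List.mem_cons, List.not_mem_nil, or_false] at hv
    · rcases hv with (rfl | rfl) | hv
      · exact ⟨t, le_rfl, .inl rfl⟩
      · exact ⟨t, le_rfl, .inr rfl⟩
      · exact key hv
    · rcases hv with rfl | hv
      · exact ⟨t, le_rfl, .inr rfl⟩
      · exact key hv

theorem mem_verts_stepsB {c : Idx n k} {t : ℕ} {P : List (Letter A k)} {v : Vtx n k}
    (hv : v ∈ (stepsB c t P).flatMap Step.verts) :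
    ∃ t', t ≤ t' ∧ (v = .tip c t' ∨ v = .joint c t') := by
  induction P generalizing t with
  | nil => simp [stepsB] at hv
  | cons x P ih =>
    have key : v ∈ (stepsB c (t + 1) P).flatMap Step.verts →
        ∃ t', t ≤ t' ∧ (v = .tip c t' ∨ v = .joint c t') := fun h => by
      obtain ⟨t', h1, h2⟩ := ih h
      exact ⟨t', by omega, h2⟩
    cases x <;> simp only [stepsB, List.flatMap_append, List.flatMap_singleton, Step.verts,
      List.mem_append, List.mem_cons, List.not_mem_nil, or_false] at hv
    · rcases hv with hv | rfl | rfl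
      · exact key hv
      · exact ⟨t, le_rfl, .inl rfl⟩
      · exact ⟨t, le_rfl, .inr rfl⟩
    · rcases hv with hv | rfl
      · exact key hv
      · exact ⟨t, le_rfl, .inr rfl⟩

theorem free_tip (c : Idx n k) (t : ℕ) : (Vtx.tip c t).Free := ⟨nofun, nofun⟩

theorem free_joint (c : Idx n k) (t : ℕ) : (Vtx.joint c t).Free := ⟨nofun, nofun⟩

theorem nodup_stepsF (c : Idx n k) (t : ℕ) (P : List (Letter A k)) :
    ((stepsF c t P).flatMap Step.verts).Nodup := by
  induction P generalizing t with
  | nil => simp [stepsF]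
  | cons x P ih =>
    have h1 : .tip c t ∉ (stepsF c (t + 1) P).flatMap Step.verts := fun h => by
      obtain ⟨t', h1, h2 | h2⟩ := mem_verts_stepsF h <;> simp at h2; omega
    have h2 : .joint c (t + 1) ∉ (stepsF c (t + 1) P).flatMap Step.verts := fun h => by
      obtain ⟨t', h1, h2 | h2⟩ := mem_verts_stepsF h <;> simp at h2; omega
    cases x
    · exact List.nodup_cons.2 ⟨fun h => (List.mem_cons.1 h).elim nofun h1,
        List.nodup_cons.2 ⟨h2, ih _⟩⟩
    · exact List.nodup_cons.2 ⟨h2, ih _⟩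

theorem nodup_stepsB (c : Idx n k) (t : ℕ) (P : List (Letter A k)) :
    ((stepsB c t P).flatMap Step.verts).Nodup := by
  induction P generalizing t with
  | nil => simp [stepsB]
  | cons x P ih =>
    have h1 : .tip c t ∉ (stepsB c (t + 1) P).flatMap Step.verts := fun h => by
      obtain ⟨t', h1, h2 | h2⟩ := mem_verts_stepsB h <;> simp at h2; omega
    have h2 : .joint c t ∉ (stepsB c (t + 1) P).flatMap Step.verts := fun h => by
      obtain ⟨t', h1, h2 | h2⟩ := mem_verts_stepsB h <;> simp at h2; omega
    cases x <;> simp only [stepsB, List.flatMap_append, List.flatMap_singleton, Step.verts] <;>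
      refine (ih _).append (by simp) ?_
    · intro v hv hv'
      simp only [List.mem_cons, List.not_mem_nil, or_false] at hv'
      rcases hv' with rfl | rfl
      · exact h1 hv
      · exact h2 hv
    · intro v hv hv'
      obtain rfl := List.mem_singleton.1 hv'
      exact h2 hv

theorem node_inl (d : Fin n) (ℓ t : ℕ) :
    (node (.inl d) ℓ t : Vtx n k) = if t = 0 then .base else .joint (.inl d) t := by
  simp [node]

theorem stepDarts_stepsF (d : Fin n) (ℓ t : ℕ) (P : List (Letter A k)) :
    stepDarts (node (.inl d) ℓ t) (stepsF (.inl d) t P) = segmentsFrom (.inl d) ℓ t P := by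
  induction P generalizing t with
  | nil => rfl
  | cons x P ih =>
    have h := ih (t + 1)
    have e : (node (.inl d) ℓ (t + 1) : Vtx n k) = .joint (.inl d) (t + 1) := by simp [node_inl]
    rcases x with ⟨i, a⟩ | ⟨j, _ | _⟩ <;> simp [stepsF, stepDarts, segmentsFrom, ← h, e]

theorem endV_stepsF (d : Fin n) (ℓ t : ℕ) (P : List (Letter A k)) :
    endV (node (.inl d) ℓ t) (stepDarts (node (.inl d) ℓ t) (stepsF (.inl d) t P)) =
      node (.inl d) ℓ (t + P.length) := by
  induction P generalizing t with
  | nil => rfl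
  | cons x P ih =>
    have h := ih (t + 1)
    have e : (node (.inl d) ℓ (t + 1) : Vtx n k) = .joint (.inl d) (t + 1) := by simp [node_inl]
    rw [e, add_right_comm, add_assoc] at h
    rcases x with ⟨i, a⟩ | ⟨j, _ | _⟩ <;> simpa [stepsF, stepDarts, endV, term] using h

theorem endV_append (x : Vtx n k) (l l' : List (Edge A k × Bool)) :
    endV x (l ++ l') = endV (endV x l) l' := by
  induction l generalizing x with
  | nil => rfl
  | cons d l ih => exact ih _

theorem stepDarts_append (x : Vtx n k) (l l' : List (Step A k)) :
    stepDarts x (l ++ l') = stepDarts x l ++ stepDarts (endV x (stepDarts x l)) l' := by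
  induction l generalizing x with
  | nil => rfl
  | cons s l ih =>
    cases s with
    | prickle i p q t v => simp [stepDarts, ih, endV, term]
    | petal j b v => cases b <;> simp [stepDarts, ih, endV, term]

/-- A petal is attached to the base point at its far end, so its tree part is traversed backwards.
The start `0 < t` leaves out the first segment, which is the marked edge. -/
theorem stepDarts_stepsB (d : Fin k) (ℓ t : ℕ) (P : List (Letter A k)) (ht : 0 < t)
    (hℓ : t + P.length = ℓ) :
    stepDarts .base (stepsB (.inr d) t P) = ((segmentsFrom (.inr d) ℓ t P).map rev).reverse ∧
      endV .base (stepDarts .base (stepsB (.inr d) t P)) = node (.inr d) ℓ t := by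
  induction P generalizing t with
  | nil =>
    obtain rfl : t = ℓ := by simpa using hℓ
    simp [stepsB, stepDarts, segmentsFrom, endV, node]
  | cons x P ih =>
    rw [List.length_cons] at hℓ
    obtain ⟨h1, h2⟩ := ih (t + 1) (by omega) (by omega)
    have e : (node (.inr d) ℓ t : Vtx n k) = .joint (.inr d) t := by
      have : t ≠ ℓ := by omega
      simp [node, ht.ne', this]
    rcases x with ⟨i, a⟩ | ⟨j, _ | _⟩ <;> simp only [stepsB, stepDarts_append, endV_append, h2] <;>
      simp [h1, stepDarts, segmentsFrom, rev, endV, term, e]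

/-- Compatibility of letters is symmetric, so reversing a tight word without inverting its letters
keeps it tight. -/
theorem StepsOK.of_reverse {δ : Idx n k} {L : List (Letter A k)} {l : List (Step A k)}
    (hL : Tight L) (hδ : ∀ x ∈ L, x.idx ≠ δ) (hl : l.map Step.letter = L.reverse)
    (hn : (l.flatMap Step.verts).Nodup) (hf : ∀ v ∈ l.flatMap Step.verts, v.Free) :
    StepsOK δ l where
  tight := by
    rw [hl]
    refine ⟨?_, fun i => by rw [List.mem_reverse]; exact hL.2 i⟩
    rw [List.isChain_reverse]
    refine hL.1.imp fun x y h => ?_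
    cases x <;> cases y <;> simp_all [Letter.Compatible]
    exact Ne.symm h
  idx s hs := by
    have : s.letter ∈ L.reverse := hl ▸ List.mem_map_of_mem hs
    exact hδ _ (List.mem_reverse.1 this)
  nodup := hn
  free := hf

open Classical in
/-- The paths that realize the automorphism that acts on the factor `δ` by the value of `L`. -/
noncomputable def actPaths (δ : Idx n k) (L : List (Letter A k)) : Idx n k → List (Letter A k)
  | .inl i => if .inl i = δ then linv L else []
  | .inr j => .petal j true :: if .inr j = δ then L else []

/-- The state in which the folding procedure starts. -/
noncomputable def startState (δ : Idx n k) (L : List (Letter A k)) (z : ∀ i, A i) :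
    State A k where
  tree := ({e | ∃ c, ∃ p ∈ segments c (actPaths δ L c), p.1 = e} ∪
      Set.range fun i => ⟨node (.inl i) (actPaths δ L (.inl i)).length
        (actPaths δ L (.inl i)).length, .cone i, .prickle i (z i)⟩) \
      Set.range fun j => ⟨.base, node (.inr j) (actPaths δ L (.inr j)).length 1, .petal j⟩
  mark j := (⟨.base, node (.inr j) (actPaths δ L (.inr j)).length 1, .petal j⟩, true)

theorem segments_petal_cons (j : Fin k) (P : List (Letter A k)) :
    segments (.inr j) (.petal j true :: P) =
      (⟨.base, node (.inr j) (P.length + 1) 1, .petal j⟩, true) ::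
        segmentsFrom (.inr j) (P.length + 1) 1 P := by
  rw [segments_eq]
  simp [segmentsFrom, node]

theorem actPaths_inr_idx {δ : Idx n k} {L : List (Letter A k)} (hδ : ∀ x ∈ L, x.idx ≠ δ)
    (j : Fin k) : ∃ P, actPaths δ L (.inr j) = .petal j true :: P ∧ ∀ x ∈ P, x.idx ≠ .inr j := by
  by_cases h : .inr j = δ
  · exact ⟨L, by simp [actPaths, h], h ▸ hδ⟩
  · exact ⟨[], by simp [actPaths, h], by simp⟩

/-- `L` avoids `δ`, so in every subdivided petal only the first segment is mapped to that petal; the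
rule for the maximal tree leaves no other choice of the marked edge. -/
theorem IsInitial.eq_startState {Φ : MulAut (FreeProd A k)} {δ : Idx n k}
    {L : List (Letter A k)} {z : ∀ i, A i} {s : State A k} (hδ : ∀ x ∈ L, x.idx ≠ δ)
    (h : IsInitial Φ (actPaths δ L) z s) : s = startState δ L z := by
  have hmark : s.mark = (startState δ L z).mark := by
    funext j
    obtain ⟨P, e, hP⟩ := actPaths_inr_idx hδ j
    have h1 := h.mark_mem j
    have h2 := h.mark_lab j
    simp only [startState]
    rw [e, segments_petal_cons] at h1 h2
    have h3 := h2 ⟨_, List.mem_cons_self, rfl⟩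
    rcases List.mem_cons.1 h1 with h1 | h1
    · rw [h1, e, List.length_cons]
    · obtain ⟨x, hx, e⟩ := segmentsFrom_idx h1
      rw [h3] at e
      exact absurd e.symm (hP x hx)
  have htree := h.tree_eq
  rw [hmark] at htree
  cases s
  simp only at hmark htree
  subst hmark htree
  rfl

/-- On a prickle the arc is the subdivided path of `L⁻¹`, read from the base point. On a petal,
whose path reads `x_j L`, the arc is the part after the marked first segment, read backwards. Both
spell `L⁻¹`, and a step records the inverse of what it reads, so the recorded letters are those of
`L` in reverse order. -/
theorem startState_eq_pathState {δ : Idx n k} {L : List (Letter A k)} (hL : Tight L)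
    (hδ : ∀ x ∈ L, x.idx ≠ δ) (z : ∀ i, A i) :
    ∃ l : List (Step A k), StepsOK δ l ∧ l.map Step.letter = L.reverse ∧
      startState δ L z = pathState δ z .base (stepDarts .base l) := by
  obtain ⟨l, hl, hm, hseg, hend, hend'⟩ : ∃ l : List (Step A k), StepsOK δ l ∧
      l.map Step.letter = L.reverse ∧
      (∀ e, (∃ d ∈ stepDarts .base l, d.1 = e) ↔
        ((∃ c, ∃ p ∈ segments c (actPaths δ L c), p.1 = e) ∧
          ∀ j, e ≠ ⟨.base, node (.inr j) (actPaths δ L (.inr j)).length 1, .petal j⟩)) ∧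
      (∀ i, (⟨node (.inl i) (actPaths δ L (.inl i)).length
        (actPaths δ L (.inl i)).length, .cone i, .prickle i (z i)⟩ : Edge A k) =
          prickleEdge δ z (endV .base (stepDarts .base l)) i) ∧
      ∀ j, (⟨.base, node (.inr j) (actPaths δ L (.inr j)).length 1, .petal j⟩ : Edge A k) =
        petalEdge δ (endV .base (stepDarts .base l)) j := by
    cases δ with
    | inl d =>
      have hm : (stepsF (.inl d) 0 (linv L)).map Step.letter = L.reverse := by
        rw [map_letter_stepsF, linv, List.map_reverse, List.map_map]
        congr 1
        refine (List.map_congr_left fun x _ => ?_).trans (List.map_id _)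
        cases x <;> simp [Letter.inv]
      have hok : StepsOK (.inl d) (stepsF (.inl d) 0 (linv L)) := by
        refine .of_reverse hL hδ hm (nodup_stepsF _ _ _) fun v hv => ?_
        obtain ⟨t, -, rfl | rfl⟩ := mem_verts_stepsF hv
        · exact free_tip _ _
        · exact free_joint _ _
      have hs := stepDarts_stepsF d (linv L).length 0 (linv L)
      have he := endV_stepsF d (linv L).length 0 (linv L)
      rw [zero_add] at he
      rw [show (node (.inl d) (linv L).length 0 : Vtx n k) = .base from rfl] at hs he
      have hpet : ∀ j, (⟨.base, node (.inr j) (actPaths (.inl d) L (.inr j)).length 1,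
          .petal j⟩ : Edge A k) = ⟨.base, .base, .petal j⟩ := by
        intro j
        simp [actPaths, node]
      refine ⟨_, hok, hm, fun e => ?_, fun i => ?_, fun j => ?_⟩
      · simp only [hpet]
        constructor
        · rintro ⟨p, hp, rfl⟩
          refine ⟨⟨.inl d, p, ?_, rfl⟩, fun j e => ?_⟩
          · rw [segments_eq, actPaths, if_pos rfl, ← hs]
            exact hp
          · refine hok.pathOK.star_not_onPath (z := z) (e := p.1) (b := p.2) (.inr ⟨j, ?_⟩) (.inl hp)
            rw [e, petalEdge_of_ne (by simp)]
        · rintro ⟨⟨c, p, hp, rfl⟩, hne⟩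
          cases c with
          | inl i =>
            by_cases hi : i = d
            · subst hi
              rw [segments_eq, actPaths, if_pos rfl, ← hs] at hp
              exact ⟨p, hp, rfl⟩
            · simp [actPaths, hi, segments] at hp
          | inr j =>
            simp only [actPaths, reduceCtorEq, if_false, segments_petal_cons, segmentsFrom,
              List.mem_singleton] at hp
            exact absurd (by rw [hp]; simp [node]) (hne j)
      · by_cases hi : i = d
        · subst hi
          simp [actPaths, prickleEdge, he]
        · simp [actPaths, prickleEdge, hi, node]
      · rw [hpet, petalEdge_of_ne (by simp)]
    | inr d =>
      have hm := map_letter_stepsB (.inr d) 1 L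
      have hok : StepsOK (.inr d) (stepsB (.inr d) 1 L) := by
        refine .of_reverse hL hδ hm (nodup_stepsB _ _ _) fun v hv => ?_
        obtain ⟨t, -, rfl | rfl⟩ := mem_verts_stepsB hv
        · exact free_tip _ _
        · exact free_joint _ _
      obtain ⟨hs, he⟩ := stepDarts_stepsB d (L.length + 1) 1 L one_pos (add_comm _ _)
      have hpet : ∀ j, (⟨.base, node (.inr j) (actPaths (.inr d) L (.inr j)).length 1,
          .petal j⟩ : Edge A k) =
          petalEdge (.inr d) (endV .base (stepDarts .base (stepsB (.inr d) 1 L))) j := by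
        intro j
        rw [he]
        by_cases hj : j = d
        · subst hj
          simp [actPaths, petalEdge]
        · simp [actPaths, petalEdge, hj, node]
      refine ⟨_, hok, hm, fun e => ?_, fun i => ?_, hpet⟩
      · simp only [hpet]
        constructor
        · rintro ⟨p, hp, rfl⟩
          refine ⟨⟨.inr d, rev p, ?_, rfl⟩, fun j e => ?_⟩
          · rw [actPaths, if_pos rfl, segments_petal_cons]
            rw [hs, List.mem_reverse] at hp
            obtain ⟨p', hp', rfl⟩ := List.mem_map.1 hp
            rw [rev_rev]
            exact List.mem_cons_of_mem _ hp'
          · exact hok.pathOK.star_not_onPath (z := z) (e := p.1) (b := p.2) (.inr ⟨j, e⟩) (.inl hp)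
        · rintro ⟨⟨c, p, hp, rfl⟩, hne⟩
          cases c with
          | inl i => simp [actPaths, segments] at hp
          | inr j =>
            have hne := hne j
            rw [← hpet] at hne
            obtain ⟨P, e, -⟩ := actPaths_inr_idx hδ j
            rw [e, segments_petal_cons, List.mem_cons] at hp
            rw [e, List.length_cons] at hne
            rcases hp with rfl | hp
            · exact absurd rfl hne
            by_cases hj : j = d
            · subst hj
              obtain rfl : L = P := by simpa [actPaths] using e
              refine ⟨rev p, ?_, rfl⟩
              rw [hs, List.mem_reverse]
              exact List.mem_map_of_mem hp
            · obtain rfl : [] = P := by simpa [actPaths, hj] using e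
              simp [segmentsFrom] at hp
      · simp [actPaths, prickleEdge, node]
  refine ⟨l, hl, hm, ?_⟩
  simp only [startState, pathState, State.mk.injEq]
  refine ⟨?_, funext fun j => by rw [hend']⟩
  ext e
  simp only [Set.mem_sdiff, Set.mem_union, Set.mem_ofPred_eq, Set.mem_range, hseg, not_exists]
  simp only [hend, eq_comm (a := e)]
  constructor
  · rintro ⟨h1 | h1, h2⟩
    · exact .inr ⟨h1, fun j e => h2 j e.symm⟩
    · exact .inl h1
  · rintro (⟨i, rfl⟩ | ⟨h1, h2⟩)
    · exact ⟨.inr ⟨i, rfl⟩, fun j e => by simp [prickleEdge] at e⟩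
    · exact ⟨.inl h1, fun j e => h2 j e.symm⟩

/-! ### Uniqueness of the initial state and of the folding normal form -/

/-- On the petals this is uniqueness of normal forms. On a prickle the path is only determined by
how it conjugates `A_i`; the rule that it does not end in the prickle `i` moves the whole ambiguity
into `z i`, which must then be central. -/
theorem IsInitial.paths_unique [∀ i, Nontrivial (A i)] {Φ : MulAut (FreeProd A k)}
    {P Q : Idx n k → List (Letter A k)} {z : ∀ i, A i} {s s' : State A k}
    (h : IsInitial Φ P z s) (h' : IsInitial Φ Q 1 s') :
    P = Q ∧ ∀ i, ∀ a : A i, z i * a = a * z i := by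
  have key : ∀ i, P (.inl i) = Q (.inl i) ∧ ∀ a : A i, z i * a = a * z i := by
    intro i
    refine conj_tight_unique (h.tight _) (h'.tight _) (h.tight_end i) (h'.tight_end i) (z i)
      fun a => (h.map_factor i a).symm.trans ((h'.map_factor i a).trans ?_)
    have : (emb (.inl i) ((1 : ∀ i, A i) i) : FreeProd A k) = 1 := map_one (emb (.inl i))
    rw [this, mul_one]
    rfl
  refine ⟨funext fun c => ?_, fun i => (key i).2⟩
  cases c with
  | inl i => exact (key i).1
  | inr j => exact (h.tight _).eq_of_lval_eq (h'.tight _) ((h.map_x j).symm.trans (h'.map_x j))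

theorem isInitial_startState {Φ : MulAut (FreeProd A k)} {δ : Idx n k}
    {L : List (Letter A k)} (hL : Tight L) (hδ : ∀ x ∈ L, x.idx ≠ δ)
    (hΦ : Acts δ.isLeft δ (lval L) Φ) : IsInitial Φ (actPaths δ L) 1 (startState δ L 1) := by
  have hone : ∀ i, (emb (.inl i) ((1 : ∀ i, A i) i) : FreeProd A k) = 1 :=
    fun i => map_one (emb (.inl i))
  refine ⟨fun c => ?_, fun i a ha => ?_, fun i a => ?_, fun j => ?_, fun j => ?_, fun j _ => rfl,
    rfl⟩
  · cases c with
    | inl i =>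
      by_cases h : .inl i = δ
      · rw [actPaths, if_pos h]
        exact hL.inv
      · rw [actPaths, if_neg h]
        exact ⟨List.isChain_nil, by simp⟩
    | inr j =>
      by_cases h : .inr j = δ
      · rw [actPaths, if_pos h]
        refine ⟨hL.1.cons fun y hy => ?_, fun i => by simpa using hL.2 i⟩
        refine Letter.compatible_of_idx_ne fun e => ?_
        exact hδ y (List.mem_of_mem_head? hy) (e.symm.trans h)
      · rw [actPaths, if_neg h]
        exact ⟨List.isChain_singleton _, by simp⟩
  · by_cases h : .inl i = δ
    · rw [actPaths, if_pos h] at ha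
      obtain ⟨x, hx, e⟩ := List.mem_map.1 (List.mem_reverse.1 (List.mem_of_getLast? ha))
      refine hδ x hx ?_
      rw [← Letter.idx_inv, e]
      exact h
    · rw [actPaths, if_neg h] at ha
      simp at ha
  · rw [hone, mul_one]
    change _ = lval _ * _ * (lval _)⁻¹
    by_cases h : .inl i = δ
    · subst h
      rw [actPaths, if_pos rfl, lval_linv, inv_inv]
      exact hΦ.act _ ⟨a, rfl⟩
    · rw [actPaths, if_neg h]
      simpa using hΦ.fix _ h a
  · change _ = lval _
    by_cases h : .inr j = δ
    · subst h
      rw [actPaths, if_pos rfl, lval_cons]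
      refine (hΦ.act (xG j) ⟨j, rfl, rfl⟩).trans ?_
      exact congrArg (· * lval L) (one_mul (xG j))
    · rw [actPaths, if_neg h, lval_cons, lval_nil, mul_one]
      exact hΦ.fix _ h _
  · obtain ⟨P, e, -⟩ := actPaths_inr_idx hδ j
    simp only [startState]
    rw [e, segments_petal_cons]
    exact List.mem_cons_self

/-- There is exactly one folding normal form of an automorphism that acts on a single factor. -/
theorem isFoldingNormalForm_iff [∀ i, Nontrivial (A i)] (D : FactorData A)
    {Φ : MulAut (FreeProd A k)} {δ : Idx n k} {L : List (Letter A k)} (hL : Tight L)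
    (hδ : ∀ x ∈ L, x.idx ≠ δ) (hΦ : Acts δ.isLeft δ (lval L) Φ)
    (w : List (MulAut (FreeProd A k))) :
    IsFoldingNormalForm D Φ w ↔ w = letterWord D δ L := by
  have hinit := isInitial_startState hL hδ hΦ
  constructor
  · rintro ⟨P, z, s, s', σ, w₀, w₁, h1, h2, h3, h4, h5, h6, rfl⟩
    obtain ⟨rfl, hz⟩ := h1.paths_unique hinit
    obtain rfl := h1.eq_startState hδ
    obtain ⟨l, hl, hm, e⟩ := startState_eq_pathState hL hδ z
    rw [e, folds_iff D hz hl h3] at h2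
    obtain ⟨rfl, rfl⟩ := h2
    -- The final immersion induces the identity, so the prefix is empty.
    rw [h6 ((realizes_pathState_nil hz).1 h4), hm, List.reverse_reverse, List.nil_append]
  · rintro rfl
    obtain ⟨l, hl, hm, e⟩ := startState_eq_pathState hL hδ (1 : ∀ i, A i)
    have hz : ∀ i, ∀ a : A i, (1 : ∀ i, A i) i * a = a * (1 : ∀ i, A i) i := by simp
    have ht := terminal_pathState_nil D δ (1 : ∀ i, A i)
    refine ⟨_, _, _, _, 1, [], _, hinit, ?_, ht, (realizes_pathState_nil hz).2 rfl,
      ⟨by simp, rfl⟩, fun _ => rfl, rfl⟩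
    rw [e, folds_iff D hz hl ht, hm, List.reverse_reverse]
    exact ⟨rfl, rfl⟩

end Initial

section Examples

variable {n k : ℕ} {A : Fin n → Type u} [∀ i, Group (A i)]

/-! ### Powers of words -/

/-- The `m`-th power of a word. -/
def wpow (l : List (Letter A k)) (m : ℕ) : List (Letter A k) := (List.replicate m l).flatten

theorem wpow_succ (l : List (Letter A k)) (m : ℕ) : wpow l (m + 1) = l ++ wpow l m := by
  simp [wpow, List.replicate_succ]

theorem mem_of_mem_wpow {l : List (Letter A k)} {m : ℕ} {x : Letter A k} (h : x ∈ wpow l m) :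
    x ∈ l := by
  simp only [wpow, List.mem_flatten, List.mem_replicate] at h
  obtain ⟨_, ⟨-, rfl⟩, h⟩ := h
  exact h

theorem head_wpow {l : List (Letter A k)} {m : ℕ} {x : Letter A k} (h : x ∈ (wpow l m).head?) :
    x ∈ l.head? := by
  induction m with
  | zero => simp [wpow] at h
  | succ m ih =>
    rw [wpow_succ, List.head?_append, Option.mem_def, Option.or_eq_some_iff] at h
    exact h.elim id fun h => ih h.2

theorem getLast_wpow {l : List (Letter A k)} {m : ℕ} {x : Letter A k}
    (h : x ∈ (wpow l m).getLast?) : x ∈ l.getLast? := by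
  induction m with
  | zero => simp [wpow] at h
  | succ m ih =>
    rw [wpow_succ, List.getLast?_append, Option.mem_def, Option.or_eq_some_iff] at h
    exact h.elim ih fun h => h.2

theorem tight_wpow {l : List (Letter A k)} (hl : Tight l)
    (h : ∀ x ∈ l.getLast?, ∀ y ∈ l.head?, x.Compatible y) (m : ℕ) : Tight (wpow l m) := by
  refine ⟨?_, fun i hi => hl.2 i (mem_of_mem_wpow hi)⟩
  induction m with
  | zero => exact List.isChain_nil
  | succ m ih =>
    rw [wpow_succ]
    exact hl.1.append ih fun x hx y hy => h x hx y (head_wpow hy)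

theorem lval_wpow (l : List (Letter A k)) (m : ℕ) : lval (wpow l m) = lval l ^ m := by
  induction m with
  | zero => simp [wpow]
  | succ m ih => rw [wpow_succ, lval_append, ih, pow_succ']

theorem lenSum_append (D : FactorData A) (l l' : List (Letter A k)) :
    lenSum D (l ++ l') = lenSum D l + lenSum D l' := by
  simp [lenSum]

theorem lenSum_cons (D : FactorData A) (x : Letter A k) (l : List (Letter A k)) :
    lenSum D (x :: l) = D.len x.idx x.elt + lenSum D l := by
  simp [lenSum]

theorem lenSum_nil (D : FactorData A) : lenSum D ([] : List (Letter A k)) = 0 := rfl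

theorem lenSum_wpow (D : FactorData A) (l : List (Letter A k)) (m : ℕ) :
    lenSum D (wpow l m) = m * lenSum D l := by
  induction m with
  | zero => simp [wpow, lenSum]
  | succ m ih => rw [wpow_succ, lenSum_append, ih, Nat.succ_mul, add_comm]

/-! ### Lengths of normal forms -/

theorem len_pos (D : FactorData A) {c : Idx n k} {a : Factor A k c} (ha : a ≠ 1) :
    0 < D.len c a := by
  refine List.length_pos_iff.2 fun h => ha ?_
  rw [← factorNF_prod D c a, h, List.prod_nil]

theorem len_bound (D : FactorData A) {α β γ : Idx n k} {a : Factor A k α} {b : Factor A k β}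
    {c : Factor A k γ} (ha : a ≠ 1) (hb : b ≠ 1) (hc : c ≠ 1) (m N : ℕ) :
    N * (4 * m + 2) ≤ N * (m * (D.len β b⁻¹ + D.len α a⁻¹) + D.len γ c +
      m * (D.len α a + D.len β b) + D.len α a) := by
  have h1 := len_pos D ha
  have h2 := len_pos D hb
  have h3 := len_pos D hc
  have h4 := len_pos D (inv_ne_one.2 ha)
  have h5 := len_pos D (inv_ne_one.2 hb)
  have h6 : m * 2 ≤ m * (D.len β b⁻¹ + D.len α a⁻¹) := Nat.mul_le_mul_left m (by omega)
  have h7 : m * 2 ≤ m * (D.len α a + D.len β b) := Nat.mul_le_mul_left m (by omega)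
  exact Nat.mul_le_mul_left N (by omega)

theorem len_xpow (D : FactorData A) (j : Fin k) : D.len (.inr j) (xpow j true) = 1 := by
  rw [FactorData.len, FactorData.factorNF, List.length_map]
  exact congrArg List.length (FreeGroup.toWord_of PUnit.unit.{u + 1})

theorem len_inv_letter (D : FactorData A) (x : Letter A k) :
    D.len x.inv.idx x.inv.elt = D.len x.idx x.elt⁻¹ := by
  cases x with
  | prickle i a => rfl
  | petal j b => exact congrArg (D.len (.inr j)) (xpow_not j b)

theorem exists_letter (D : FactorData A) {α : Idx n k} {a : Factor A k α}
    (ha : a ∈ D.factorGens α) : ∃ (x : Letter A k) (h : x.idx = α), h ▸ x.elt = a := by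
  cases α with
  | inl i => exact ⟨.prickle i a, rfl, rfl⟩
  | inr j =>
    obtain rfl := Set.mem_singleton_iff.1 ha
    exact ⟨.petal j true, rfl, rfl⟩

theorem ne_prickle_one {x : Letter A k} (h : x.elt ≠ 1) (i : Fin n) : .prickle i 1 ≠ x := by
  rintro rfl
  exact h rfl

theorem ne_prickle_one_inv {x : Letter A k} (h : x.elt ≠ 1) (i : Fin n) :
    .prickle i 1 ≠ x.inv := by
  cases x with
  | prickle i' a =>
    intro e
    simp only [Letter.inv, Letter.prickle.injEq] at e
    obtain ⟨rfl, e⟩ := e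
    exact h (inv_eq_one.1 (eq_of_heq e).symm)
  | petal j b => nofun

/-- A generating set of a nontrivial group is not contained in `{1}`. -/
theorem exists_gen_ne_one [∀ i, Nontrivial (A i)] (D : FactorData A) (α : Idx n k) :
    ∃ x : Letter A k, x.idx = α ∧ x.elt ∈ D.factorGens x.idx ∧ x.elt ≠ 1 := by
  cases α with
  | inl i =>
    by_contra! h
    have : D.gens i ⊆ {1} := fun a ha => by_contra fun hne => hne (h (.prickle i a) rfl ha)
    have hbot : (⊤ : Subgroup (A i)) ≤ ⊥ := by
      rw [← D.closure_gens i, Subgroup.closure_le]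
      exact this
    obtain ⟨a, ha⟩ := exists_ne (1 : A i)
    exact ha (Subgroup.mem_bot.1 (hbot (Subgroup.mem_top a)))
  | inr j =>
    refine ⟨.petal j true, rfl, rfl, fun e => ?_⟩
    exact xpow_pow_ne_one (A := A) j true 0 ((pow_one _).trans e)

/-! ### Automorphisms with long folding normal forms -/

theorem foldingLengths_of_acts [∀ i, Nontrivial (A i)] {D : FactorData A}
    {Φ : MulAut (FreeProd A k)} {δ : Idx n k} {L : List (Letter A k)} (hL : Tight L)
    (hδ : ∀ x ∈ L, x.idx ≠ δ) (hΦ : Acts δ.isLeft δ (lval L) Φ) {ℓ : ℕ}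
    (hw : D.HasWord Φ ℓ) : FoldingLengths D Φ (lenSum D L) ℓ := by
  have hiff := isFoldingNormalForm_iff D hL hδ hΦ
  refine ⟨?_, ⟨_, (hiff _).2 rfl⟩, fun w h => ?_, hw⟩
  · obtain ⟨w, h, -⟩ := hw
    exact h.mem_autZero
  · obtain rfl := (hiff w).1 h
    exact ⟨⟨letterWord_mem D hδ, (acts_letterWord D hδ).eq hΦ⟩, length_letterWord D hδ⟩

/-- If the folding normal forms are much longer than another word, they are not quasi-geodesic. -/
theorem FoldingLengths.not_isQuasiGeodesic {D : FactorData A} {Φ : MulAut (FreeProd A k)}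
    {M ℓ : ℕ} (h : FoldingLengths D Φ M ℓ) {K C : ℝ} (hlt : ℓ < K⁻¹ * M - C) :
    Φ ∈ autZero A k ∧ (∃ w, IsFoldingNormalForm D Φ w) ∧
      ∀ w, IsFoldingNormalForm D Φ w → D.Represents w Φ ∧ ¬ D.IsQuasiGeodesic K C w := by
  obtain ⟨h1, h2, h3, h4⟩ := h
  refine ⟨h1, h2, fun w hw => ⟨(h3 w hw).1, fun hq => ?_⟩⟩
  obtain ⟨⟨-, hprod⟩, hlen⟩ := h3 w hw
  -- Only the lower bound between the two ends of the word is used.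
  have := (hq 0 w.length (Nat.zero_le _) le_rfl).1
  rw [List.take_zero, List.take_length, List.prod_nil, inv_one, one_mul, hprod, hlen] at this
  have hle : D.wordNorm Φ ≤ ℓ := Nat.sInf_le h4
  have hle' : (D.wordNorm Φ : ℝ) ≤ ℓ := by exact_mod_cast hle
  simp only [Nat.cast_zero, sub_zero, Nat.abs_cast] at this
  linarith

theorem isLeft_or (δ : Idx n k) : δ.isLeft = true ∨ ∃ j, δ = .inr j := by
  cases δ <;> simp

/-- A word of generators defines an automorphism that acts on one factor. -/
theorem exists_acts_list (D : FactorData A) {γ : Idx n k} {conj : Bool}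
    (hc : conj = true ∨ ∃ j, γ = .inr j) {Z : List (Letter A k)}
    (hgen : ∀ x ∈ Z, x.elt ∈ D.factorGens x.idx) (hγ : ∀ x ∈ Z, x.idx ≠ γ) :
    ∃ θ : MulAut (FreeProd A k), D.HasWord θ Z.length ∧ Acts conj γ (lval Z) θ ∧
      ∀ δ, (∀ x ∈ Z, x.idx ≠ δ) → δ ≠ γ → θ ∈ stabOf A δ := by
  induction Z with
  | nil => exact ⟨1, .one D, .one _ _, fun _ _ _ => one_mem _⟩
  | cons x Z ih =>
    have hγ' : ∀ x ∈ Z, x.idx ≠ γ := fun y hy => hγ y (List.mem_cons_of_mem _ hy)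
    obtain ⟨θ, h1, h2, h3⟩ := ih (fun y hy => hgen y (List.mem_cons_of_mem _ hy)) hγ'
    obtain ⟨φ, h1', h2', h3'⟩ :=
      exists_acts_gen D (hγ x List.mem_cons_self) hc (hgen x List.mem_cons_self)
    refine ⟨φ * θ, ?_, ?_, fun δ hδ hne => ?_⟩
    · rw [List.length_cons, add_comm]
      exact h1'.mul h1
    · rw [lval_cons, Letter.val_eq]
      exact h2'.mul h2 (lval_mem_restOf hγ')
    · exact mul_mem (h3' δ (hδ x List.mem_cons_self) hne)
        (h3 δ (fun y hy => hδ y (List.mem_cons_of_mem _ hy)) hne)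

/-- The automorphism that acts on the factor `δ` by `u ^ N`, where
`u = (x y)⁻ᵐ c (x y)ᵐ x`. -/
theorem exists_foldingLengths_conj [∀ i, Nontrivial (A i)] (D : FactorData A)
    {x y c : Letter A k} {δ : Idx n k} (hxy : x.idx ≠ y.idx) (hxc : x.idx ≠ c.idx)
    (hyc : y.idx ≠ c.idx) (hxδ : x.idx ≠ δ) (hyδ : y.idx ≠ δ) (hcδ : c.idx ≠ δ)
    (hx : x.elt ∈ D.factorGens x.idx) (hy : y.elt ∈ D.factorGens y.idx)
    (hc : c.elt ∈ D.factorGens c.idx) (hx1 : x.elt ≠ 1) (hy1 : y.elt ≠ 1) (hc1 : c.elt ≠ 1)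
    (m N : ℕ) :
    ∃ Φ : MulAut (FreeProd A k),
      Acts δ.isLeft δ ((((x.val * y.val) ^ m)⁻¹ * c.val * (x.val * y.val) ^ m * x.val) ^ N) Φ ∧
      FoldingLengths D Φ (N * (m * (D.len y.idx y.elt⁻¹ + D.len x.idx x.elt⁻¹) +
        D.len c.idx c.elt + m * (D.len x.idx x.elt + D.len y.idx y.elt) + D.len x.idx x.elt))
        (4 * m + 2 * N) := by
  -- The final letter `x` is essential: without it `U` would end in `y` and begin with `y⁻¹` for `m
  -- > 0`, and its powers would collapse to the conjugate of `c^N`.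
  set U : List (Letter A k) := wpow [y.inv, x.inv] m ++ (c :: (wpow [x, y] m ++ [x])) with hU
  have hmem : ∀ l ∈ U, l = x ∨ l = y ∨ l = c ∨ l = x.inv ∨ l = y.inv := by
    intro l hl
    simp only [hU, List.mem_append, List.mem_cons, List.not_mem_nil, or_false] at hl
    rcases hl with hl | hl | hl | hl
    · have := mem_of_mem_wpow hl
      simp at this
      tauto
    · tauto
    · have := mem_of_mem_wpow hl
      simp at this
      tauto
    · tauto
  have hcomp : ∀ {l l' : Letter A k}, l.idx ≠ l'.idx → l.Compatible l' :=
    Letter.compatible_of_idx_ne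
  have hn1 := ne_prickle_one hx1
  have hn2 := ne_prickle_one hy1
  have hn3 := ne_prickle_one hc1
  have hn4 := ne_prickle_one_inv hx1
  have hn5 := ne_prickle_one_inv hy1
  have hw1 : Tight (wpow [y.inv, x.inv] m) := by
    refine tight_wpow ⟨?_, fun i => by simp [hn4, hn5]⟩ ?_ m
    · exact List.isChain_pair.2 (hcomp (by simpa using hxy.symm))
    · simpa using hcomp (l := x.inv) (l' := y.inv) (by simpa using hxy)
  have hw2 : Tight (wpow [x, y] m) := by
    refine tight_wpow ⟨?_, fun i => by simp [hn1, hn2]⟩ ?_ m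
    · exact List.isChain_pair.2 (hcomp hxy)
    · simpa using hcomp hxy.symm
  have hUt : Tight U := by
    refine ⟨hw1.1.append (List.IsChain.cons
      (hw2.1.append (List.isChain_singleton x) ?_) ?_) ?_, fun i hi => ?_⟩
    · intro l hl l' hl'
      have h1 := getLast_wpow hl
      simp at h1 hl'
      subst h1 hl'
      exact hcomp hxy.symm
    · intro l hl
      have h1 := List.mem_of_mem_head? hl
      rw [List.mem_append] at h1
      rcases h1 with h1 | h1
      · have := mem_of_mem_wpow h1
        simp at this
        rcases this with rfl | rfl
        · exact hcomp hxc.symm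
        · exact hcomp hyc.symm
      · rw [List.mem_singleton.1 h1]
        exact hcomp hxc.symm
    · intro l hl l' hl'
      have h1 := mem_of_mem_wpow (List.mem_of_getLast? hl)
      simp at h1 hl'
      subst hl'
      rcases h1 with rfl | rfl
      · exact hcomp (by simpa using hyc)
      · exact hcomp (by simpa using hxc)
    · rcases hmem _ hi with h | h | h | h | h
      · exact hn1 i h
      · exact hn2 i h
      · exact hn3 i h
      · exact hn4 i h
      · exact hn5 i h
  have hLt : Tight (wpow U N) := by
    refine tight_wpow hUt (fun l hl l' hl' => ?_) N
    have h1 : l = x := by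
      simp [hU, List.getLast?_append, List.getLast?_cons] at hl
      exact hl.symm
    subst h1
    rw [hU, List.head?_append, Option.mem_def, Option.or_eq_some_iff] at hl'
    rcases hl' with h2 | ⟨-, h2⟩
    · have h3 := head_wpow h2
      simp at h3
      subst h3
      exact hcomp (by simpa using hxy)
    · simp at h2
      subst h2
      exact hcomp hxc
  have hLδ : ∀ l ∈ wpow U N, l.idx ≠ δ := by
    intro l hl
    rcases hmem l (mem_of_mem_wpow hl) with rfl | rfl | rfl | rfl | rfl
    · exact hxδ
    · exact hyδ
    · exact hcδ
    · simpa using hxδ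
    · simpa using hyδ
  have hval : lval (wpow U N) =
      (((x.val * y.val) ^ m)⁻¹ * c.val * (x.val * y.val) ^ m * x.val) ^ N := by
    rw [lval_wpow, hU]
    simp only [lval_append, lval_wpow, lval_cons, lval_nil, mul_one, Letter.val_inv,
      ← mul_inv_rev, inv_pow, mul_assoc]
  have hlen : lenSum D (wpow U N) = N * (m * (D.len y.idx y.elt⁻¹ + D.len x.idx x.elt⁻¹) +
        D.len c.idx c.elt + m * (D.len x.idx x.elt + D.len y.idx y.elt) +
        D.len x.idx x.elt) := by
    rw [lenSum_wpow, hU]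
    simp only [lenSum_append, lenSum_wpow, lenSum_cons, lenSum_nil, len_inv_letter]
    ring
  -- Here `θ` conjugates the whole factor of `c`, also when that factor is infinite cyclic; for this
  -- reason the kind of action in `Acts` is independent of the kind of factor.
  obtain ⟨θ, hθ1, hθ2, hθ3⟩ := exists_acts_list D (γ := c.idx) (conj := true) (.inl rfl)
    (Z := [x, y]) (by simp [hx, hy]) (by simp [hxc, hyc])
  obtain ⟨φ, hφ1, hφ2, -⟩ := exists_acts_list D (γ := δ) (isLeft_or δ)
    (Z := [c, x]) (by simp [hx, hc]) (by simp [hxδ, hcδ])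
  have hθ : Acts true c.idx (lval [x, y] ^ m) (θ ^ m) :=
    hθ2.pow (lval_mem_restOf (by simp [hxc, hyc])) m
  have hφ := (hφ2.pow (lval_mem_restOf (by simp [hxδ, hcδ])) N).conj
    (pow_mem (hθ3 δ (by simp [hxδ, hyδ]) hcδ.symm) m)
  have hΦ : Acts δ.isLeft δ (lval (wpow U N)) (θ ^ m * φ ^ N * (θ ^ m)⁻¹) := by
    convert hφ using 1
    rw [hval, map_pow]
    -- `θ^m` fixes `x` and conjugates `c` by `(x y)^m`, so it sends `c x` to the value of `U`.
    have h1 := hθ.fix x.idx hxc x.elt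
    have h2 := hθ.act (emb c.idx c.elt) ⟨c.elt, rfl⟩
    rw [← Letter.val_eq] at h1 h2
    simp only [lval_cons, lval_nil, mul_one, if_true] at h2 ⊢
    rw [map_mul, h1, h2]
  refine ⟨_, hval ▸ hΦ, ?_⟩
  rw [← hlen]
  refine foldingLengths_of_acts hLt hLδ hΦ ?_
  -- The word has length `2m + 2N + 2m`.
  have := ((hθ1.pow m).mul (hφ1.pow N)).mul (hθ1.pow m).inv
  convert this using 1
  simp only [List.length_cons, List.length_nil]
  ring

/-- The automorphism that acts on the factor `δ` by `(x_j vᵐ) ^ N`. -/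
theorem exists_foldingLengths_transv [∀ i, Nontrivial (A i)] (D : FactorData A)
    {Z : List (Letter A k)} {j : Fin k} {δ : Idx n k} (hZ : Tight Z)
    (hcyc : ∀ x ∈ Z.getLast?, ∀ y ∈ Z.head?, x.Compatible y)
    (hgen : ∀ x ∈ Z, x.elt ∈ D.factorGens x.idx) (hj : ∀ x ∈ Z, x.idx ≠ .inr j)
    (hδ : ∀ x ∈ Z, x.idx ≠ δ) (hjδ : .inr j ≠ δ) (m N : ℕ) :
    ∃ Φ : MulAut (FreeProd A k),
      Acts δ.isLeft δ ((xG j * lval Z ^ m) ^ N) Φ ∧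
      FoldingLengths D Φ (N * (1 + m * lenSum D Z)) (2 * m * Z.length + N) := by
  set c : Letter A k := .petal j true with hc
  set U : List (Letter A k) := c :: wpow Z m with hU
  have hUt : Tight U := by
    have hw := tight_wpow hZ hcyc m
    refine ⟨hw.1.cons fun l hl => ?_, fun i => by simpa [hU, hc] using hw.2 i⟩
    refine Letter.compatible_of_idx_ne fun e => ?_
    exact hj l (List.mem_of_mem_head? (head_wpow hl)) e.symm
  have hLt : Tight (wpow U N) := by
    refine tight_wpow hUt (fun l hl l' hl' => ?_) N
    obtain rfl : c = l' := by simpa [hU] using hl'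
    -- If no letter of `Z` occurs in `U`, the word `U` is the single petal `c`, which may follow
    -- itself.
    rcases List.mem_cons.1 (List.mem_of_getLast? hl) with rfl | h
    · exact fun _ => rfl
    · exact Letter.compatible_of_idx_ne (hj l (mem_of_mem_wpow h))
  have hLδ : ∀ l ∈ wpow U N, l.idx ≠ δ := by
    intro l hl
    rcases List.mem_cons.1 (mem_of_mem_wpow hl) with rfl | h
    · exact hjδ
    · exact hδ l (mem_of_mem_wpow h)
  have hval : lval (wpow U N) = (xG j * lval Z ^ m) ^ N := by
    rw [lval_wpow, hU, lval_cons, lval_wpow]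
    rfl
  have hlen : lenSum D (wpow U N) = N * (1 + m * lenSum D Z) := by
    rw [lenSum_wpow, hU, lenSum_cons, lenSum_wpow]
    exact congrArg (fun ℓ => N * (ℓ + m * lenSum D Z)) (len_xpow D j)
  -- As a right transvection, `θ^m` sends `x_j` to `x_j` times the `m`-th power of the value of `Z`.
  -- The letter `x_j` in front prevents cancellation between the powers, so no extra letter is
  -- needed, and the factors involved are `δ`, `⟨x_j⟩` and those of `Z`.
  obtain ⟨θ, hθ1, hθ2, hθ3⟩ := exists_acts_list D (γ := .inr j) (conj := false)
    (.inr ⟨j, rfl⟩) hgen hj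
  obtain ⟨φ, hφ1, hφ2, -⟩ := exists_acts_list D (γ := δ) (isLeft_or δ)
    (Z := [c]) (by simp only [List.mem_singleton, forall_eq]; exact rfl)
    (by simp only [List.mem_singleton, forall_eq]; exact hjδ)
  have hθ := hθ2.pow (lval_mem_restOf hj) m
  have hφ := (hφ2.pow (lval_mem_restOf
    (by simp only [List.mem_singleton, forall_eq]; exact hjδ)) N).conj
    (pow_mem (hθ3 δ hδ hjδ.symm) m)
  have hΦ : Acts δ.isLeft δ (lval (wpow U N)) (θ ^ m * φ ^ N * (θ ^ m)⁻¹) := by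
    convert hφ using 1
    rw [hval, map_pow]
    have h2 := hθ.act (xG j) ⟨j, rfl, rfl⟩
    have h3 : lval [c] = xG j := by
      rw [lval_cons, lval_nil, mul_one]
      rfl
    rw [h3, h2]
    simp
  refine ⟨_, hval ▸ hΦ, ?_⟩
  rw [← hlen]
  refine foldingLengths_of_acts hLt hLδ hΦ ?_
  have := ((hθ1.pow m).mul (hφ1.pow N)).mul (hθ1.pow m).inv
  convert this using 1
  simp only [List.length_cons, List.length_nil]
  ring

/-! ### Quadratic against linear length -/

theorem exists_nat_growth (K C : ℝ) (hK : 1 ≤ K) :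
    ∃ N : ℕ, 0 < N ∧ ((6 * N : ℕ) : ℝ) < K⁻¹ * ((N * N : ℕ) : ℝ) - C := by
  -- With this choice `N² / K` exceeds `(6 + |C|) N`, which is at least `6N + C` as `N ≥ 1`.
  obtain ⟨N, hN⟩ := exists_nat_gt (K * (6 + |C|))
  have hK0 : 0 < K := by linarith
  have hC := abs_nonneg C
  have hpos : (0 : ℝ) < N := by
    refine lt_of_le_of_lt ?_ hN
    positivity
  have hN1 : (1 : ℝ) ≤ N := by
    have : 0 < N := by exact_mod_cast hpos
    exact_mod_cast this
  refine ⟨N, by exact_mod_cast hpos, ?_⟩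
  have h1 : 6 + |C| < K⁻¹ * N := by
    rw [inv_mul_eq_div, lt_div_iff₀ hK0, mul_comm]
    exact hN
  have h2 : (6 + |C|) * N < K⁻¹ * N * N := mul_lt_mul_of_pos_right h1 hpos
  have h3 : |C| ≤ |C| * N := le_mul_of_one_le_right hC hN1
  have h4 := le_abs_self C
  push_cast
  linarith

theorem FoldingLengths.exists_of_growth {D : FactorData A} {Φ : MulAut (FreeProd A k)}
    {M ℓ N : ℕ} (h : FoldingLengths D Φ M ℓ) {K C : ℝ} (hK : 1 ≤ K)
    (hN : ((6 * N : ℕ) : ℝ) < K⁻¹ * ((N * N : ℕ) : ℝ) - C) (hM : N * N ≤ M) (hℓ : ℓ ≤ 6 * N) :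
    ∃ Φ ∈ autZero A k, (∃ w, IsFoldingNormalForm D Φ w) ∧
      ∀ w, IsFoldingNormalForm D Φ w → D.Represents w Φ ∧ ¬ D.IsQuasiGeodesic K C w := by
  refine ⟨Φ, h.not_isQuasiGeodesic ?_⟩
  have h1 : (ℓ : ℝ) ≤ (6 * N : ℕ) := by exact_mod_cast hℓ
  have h2 : ((N * N : ℕ) : ℝ) ≤ M := by exact_mod_cast hM
  have h3 : 0 ≤ K⁻¹ := by positivity
  have := mul_le_mul_of_nonneg_left h2 h3
  linarith

end Examples

end FoldingCombing

/-! ### Assembling the proposition -/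

theorem mainTheorem6 {n k : ℕ} (A : Fin n → Type*) [∀ i, Group (A i)]
    [∀ i, Nontrivial (A i)] (D : FactorData A) (hnk : 4 ≤ n + k ∨ (n = 0 ∧ k = 3)) :
    (∀ K C : ℝ, 1 ≤ K → 0 < C → ∃ Φ ∈ autZero A k,
      (∃ w, IsFoldingNormalForm D Φ w) ∧
      ∀ w, IsFoldingNormalForm D Φ w → D.Represents w Φ ∧ ¬ D.IsQuasiGeodesic K C w) ∧
    (∀ (α β γ : Idx n k) (a : Factor A k α) (b : Factor A k β) (c : Factor A k γ) (m N : ℕ),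
      α ≠ β → α ≠ γ → β ≠ γ → a ∈ D.factorGens α → b ∈ D.factorGens β → c ∈ D.factorGens γ →
      a ≠ 1 → b ≠ 1 → c ≠ 1 → 0 < m → 0 < N →
      (∀ δ : Fin n, α ≠ .inl δ → β ≠ .inl δ → γ ≠ .inl δ →
        ∃ Φ : MulAut (FreeProd A k),
          (∀ l, l ≠ .inl δ → ∀ y : Factor A k l, Φ (emb l y) = emb l y) ∧
          (∀ d : Factor A k (.inl δ), Φ (emb (.inl δ) d) =
            ((((emb α a * emb β b) ^ m)⁻¹ * emb γ c * (emb α a * emb β b) ^ m * emb α a) ^ N)⁻¹ *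
              emb (.inl δ) d *
            (((emb α a * emb β b) ^ m)⁻¹ * emb γ c * (emb α a * emb β b) ^ m * emb α a) ^ N) ∧
          N * (4 * m + 2) ≤ N * (m * (D.len β b⁻¹ + D.len α a⁻¹) + D.len γ c +
            m * (D.len α a + D.len β b) + D.len α a) ∧
          FoldingLengths D Φ (N * (m * (D.len β b⁻¹ + D.len α a⁻¹) + D.len γ c +
            m * (D.len α a + D.len β b) + D.len α a)) (4 * m + 2 * N)) ∧
      (∀ δ : Fin k, α ≠ .inr δ → β ≠ .inr δ → γ ≠ .inr δ →
        ∃ Φ : MulAut (FreeProd A k),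
          (∀ l, l ≠ .inr δ → ∀ y : Factor A k l, Φ (emb l y) = emb l y) ∧
          Φ (xG δ) = xG δ *
            (((emb α a * emb β b) ^ m)⁻¹ * emb γ c * (emb α a * emb β b) ^ m * emb α a) ^ N ∧
          N * (4 * m + 2) ≤ N * (m * (D.len β b⁻¹ + D.len α a⁻¹) + D.len γ c +
            m * (D.len α a + D.len β b) + D.len α a) ∧
          FoldingLengths D Φ (N * (m * (D.len β b⁻¹ + D.len α a⁻¹) + D.len γ c +
            m * (D.len α a + D.len β b) + D.len α a)) (4 * m + 2 * N)) ∧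
      (∀ (γ' δ : Fin k), γ = .inr γ' → α ≠ .inr δ → β ≠ .inr δ → γ ≠ .inr δ →
        ∃ Φ : MulAut (FreeProd A k),
          (∀ l, l ≠ .inr δ → ∀ y : Factor A k l, Φ (emb l y) = emb l y) ∧
          Φ (xG δ) = xG δ * (emb γ c * (emb α a * emb β b) ^ m) ^ N ∧
          N * (2 * m + 1) ≤ N * (1 + m * (D.len α a + D.len β b)) ∧
          FoldingLengths D Φ (N * (1 + m * (D.len α a + D.len β b))) (4 * m + N))) := by
  constructor
  · intro K C hK _
    obtain ⟨N, hN0, hN⟩ := exists_nat_growth K C hK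
    rcases hnk with hnk | ⟨rfl, rfl⟩
    · obtain ⟨f⟩ : Nonempty (Fin 4 ↪ Idx n k) :=
        Function.Embedding.nonempty_of_card_le (by simpa using hnk)
      have hf : ∀ {i j : Fin 4}, i ≠ j → f i ≠ f j := fun h e => h (f.injective e)
      obtain ⟨x, hx, hxg, hx1⟩ := exists_gen_ne_one D (f 0)
      obtain ⟨y, hy, hyg, hy1⟩ := exists_gen_ne_one D (f 1)
      obtain ⟨c, hc, hcg, hc1⟩ := exists_gen_ne_one D (f 2)
      obtain ⟨Φ, -, hΦ⟩ := exists_foldingLengths_conj D (δ := f 3)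
        (by rw [hx, hy]; exact hf (by decide)) (by rw [hx, hc]; exact hf (by decide))
        (by rw [hy, hc]; exact hf (by decide)) (by rw [hx]; exact hf (by decide))
        (by rw [hy]; exact hf (by decide)) (by rw [hc]; exact hf (by decide))
        hxg hyg hcg hx1 hy1 hc1 N N
      -- With `m = N` the short word has length `4N + 2N`, and the term `m (|a| + |b|)` alone makes
      -- the folding normal form at least `N²` long.
      refine hΦ.exists_of_growth hK hN (Nat.mul_le_mul_left N ?_) (by omega)
      have h1 := Nat.mul_le_mul_left N (len_pos D hx1)
      have h2 : N * D.len x.idx x.elt ≤ N * (D.len x.idx x.elt + D.len y.idx y.elt) :=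
        Nat.mul_le_mul_left N (Nat.le_add_right _ _)
      omega
    · have h1 : (Letter.petal 0 true : Letter A 3).elt ≠ 1 := fun e =>
        xpow_pow_ne_one (A := A) 0 true 0 ((pow_one _).trans e)
      -- The conjugation construction needs four factors. In rank three one uses the generators with
      -- indices `0`, `1` and `2`: the last is multiplied by `(x_1 x_0^N)^N`, and the short word has
      -- length `2N + N`.
      obtain ⟨Φ, -, hΦ⟩ := exists_foldingLengths_transv (k := 3) D (Z := [.petal 0 true]) (j := 1)
        (δ := .inr 2) ⟨List.isChain_singleton _, by simp⟩ (by simp [Letter.Compatible])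
        (by simp only [List.mem_singleton, forall_eq]; exact rfl)
        (by simp only [List.mem_singleton, forall_eq, Letter.idx]; decide)
        (by simp only [List.mem_singleton, forall_eq, Letter.idx]; decide) (by decide) N N
      refine hΦ.exists_of_growth hK hN (Nat.mul_le_mul_left N ?_) ?_
      · rw [lenSum_cons, lenSum_nil, add_zero]
        have := Nat.mul_le_mul_left N (len_pos D h1)
        omega
      · simp only [List.length_singleton]
        omega
  · intro α β γ a b c m N hαβ hαγ hβγ ha hb hc ha1 hb1 hc1 hm hN
    obtain ⟨x, rfl, rfl⟩ := exists_letter D ha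
    obtain ⟨y, rfl, rfl⟩ := exists_letter D hb
    have hx0 : 0 < D.len x.idx x.elt := len_pos D ha1
    have hy0 : 0 < D.len y.idx y.elt := len_pos D hb1
    refine ⟨fun δ hαδ hβδ hγδ => ?_, fun δ hαδ hβδ hγδ => ?_, fun γ' δ hγ hαδ hβδ hγδ => ?_⟩
    · obtain ⟨z, rfl, rfl⟩ := exists_letter D hc
      obtain ⟨Φ, h1, h2⟩ := exists_foldingLengths_conj D hαβ hαγ hβγ hαδ hβδ hγδ ha hb hc
        ha1 hb1 hc1 m N
      simp only [Letter.val_eq] at h1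
      exact ⟨Φ, h1.fix, fun d => h1.act _ ⟨d, rfl⟩, len_bound D ha1 hb1 hc1 m N, h2⟩
    · obtain ⟨z, rfl, rfl⟩ := exists_letter D hc
      obtain ⟨Φ, h1, h2⟩ := exists_foldingLengths_conj D hαβ hαγ hβγ hαδ hβδ hγδ ha hb hc
        ha1 hb1 hc1 m N
      simp only [Letter.val_eq] at h1
      refine ⟨Φ, h1.fix, ?_, len_bound D ha1 hb1 hc1 m N, h2⟩
      exact (h1.act _ ⟨δ, rfl, rfl⟩).trans (congrArg (· * _) (one_mul (xG δ)))
    · subst hγ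
      obtain rfl := Set.mem_singleton_iff.1 hc
      obtain ⟨Φ, h1, h2⟩ := exists_foldingLengths_transv D (Z := [x, y]) (j := γ') (δ := .inr δ)
        ⟨List.isChain_pair.2 (Letter.compatible_of_idx_ne hαβ),
          fun i => by simp [ne_prickle_one ha1, ne_prickle_one hb1]⟩
        (by simpa using Letter.compatible_of_idx_ne hαβ.symm) (by simp [ha, hb])
        (by simp [hαγ, hβγ]) (by simp [hαδ, hβδ]) hγδ m N
      have h3 : lenSum D [x, y] = D.len x.idx x.elt + D.len y.idx y.elt := by
        simp [lenSum]
      have h4 : lval [x, y] = emb x.idx x.elt * emb y.idx y.elt := by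
        rw [lval_cons, lval_cons, lval_nil, mul_one, Letter.val_eq, Letter.val_eq]
      rw [h3] at h2
      rw [h4] at h1
      refine ⟨Φ, h1.fix, ?_, Nat.mul_le_mul_left N ?_, ?_⟩
      · exact (h1.act _ ⟨δ, rfl, rfl⟩).trans (congrArg (· * _) (one_mul (xG δ)))
      · have : 2 ≤ D.len x.idx x.elt + D.len y.idx y.elt := by omega
        have := Nat.mul_le_mul_left m this
        change 2 * m + 1 ≤ 1 + m * (D.len x.idx x.elt + D.len y.idx y.elt)
        omega
      · convert h2 using 1
        simp only [List.length_cons, List.length_nil]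
        ring
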